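/- Let $d\ge 2$ be an integer. Let $\rho_1:\mathbb R\to\mathbb R$ be a $C^\infty$ function supported in $[1/2,2]$ and let $\rho(t)=\rho_1(t)\mathbf 1_{\{t>0\}}-\rho_1(-t)\mathbf 1_{\{t<0\}}$. Let $\Theta$ be a Schwartz function on $\mathbb R$ supported in $(-1,1)$ with $\Theta(\xi)=1$ for $|\xi|\le 1/2$, and let $\Phi$ be the Schwartz function with $\widehat\Phi(\xi)=\Theta(\xi/2)-\Theta(\xi)$, where $\widehat f(\xi)=\int_{\mathbb R} f(x)e^{-2\pi i x\xi}\,dx$. For $f\in L^2(\mathbb R)$ define $R_\Phi f$ by $\widehat{R_\Phi f}=\widehat f\,\widehat\Phi$. For integers $m\ge 0$ and $j$ define, for $f,g\in L^2(\mathbb R)$, $$\mathcal B_{j,m}(f,g)(x)=2^{-(d-1)j/2}\int_{\mathbb R}R_\Phi f\big(2^{-(d-1)j}x-2^mt\big)\,R_\Phi g\big(x-2^mt^d\big)\,\rho(t)\,dt\quad\text{if } j\ge 0,$$ $$\mathcal B_{j,m}(f,g)(x)=2^{(d-1)j/2}\int_{\mathbb R}R_\Phi f\big(x-2^mt\big)\,R_\Phi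 g\big(2^{(d-1)j}x-2^mt^d\big)\,\rho(t)\,dt\quad\text{if } j<0.$$ Let $L>2^{100}$ be a real number. Then there is a constant $C$, independent of $j$, $m$, $f$ and $g$, such that for all integers $j$ and $m\ge 0$ with $L\le|j|\le m/(d-1)$ and all $f,g\in L^2(\mathbb R)$, the function $\mathcal B_{j,m}(f,g)$ belongs to $L^1(\mathbb R)$ and $$\big\|\mathcal B_{j,m}(f,g)\big\|_1\le C\,2^{\frac{(d-1)|j|-m}{8}}\,\|f\|_2\,\|g\|_2 .$$ -/

import Mathlib

open MeasureTheory FourierTransform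
open scoped SchwartzMap ENNReal ContDiff

noncomputable section

/-- The odd extension of `ρ₁`: `ρ₁(t)` for `t > 0`, `-ρ₁(-t)` for `t < 0`, and `0` at `t = 0`. -/
def oddBump (ρ₁ : ℝ → ℝ) (t : ℝ) : ℝ :=
  if 0 < t then ρ₁ t else if t < 0 then -ρ₁ (-t) else 0

/-- The smooth Fourier restriction `R_Φ f` of `f ∈ L²(ℝ)`, whose Fourier transform is `f̂ · Φ̂`.
Here `f̂` is the `L²` (Plancherel) Fourier transform; `f̂ · Φ̂` is integrable, so `R_Φ f` is given
at every point by the inversion integral `∫ e^{2πixξ} f̂(ξ) Φ̂(ξ) dξ`. -/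
def smoothRestriction (Φ : 𝓢(ℝ, ℂ)) (f : Lp ℂ 2 (volume : Measure ℝ)) : ℝ → ℂ :=
  𝓕⁻ (fun ξ : ℝ => (𝓕 f : Lp ℂ 2 (volume : Measure ℝ)) ξ * (𝓕 Φ : 𝓢(ℝ, ℂ)) ξ)

/-- The bilinear Fourier restriction operator `B_{j,m}` attached to the curve `(t, t^d)`. -/
def bilinearRestriction (d : ℕ) (ρ : ℝ → ℝ) (Φ : 𝓢(ℝ, ℂ)) (j : ℤ) (m : ℕ)
    (f g : Lp ℂ 2 (volume : Measure ℝ)) (x : ℝ) : ℂ :=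
  if 0 ≤ j then
    (((2 : ℝ) ^ (-(((d : ℝ) - 1) * (j : ℝ) / 2)) : ℝ) : ℂ) *
      ∫ t : ℝ, smoothRestriction Φ f ((2 : ℝ) ^ (-(((d : ℝ) - 1) * (j : ℝ))) * x - 2 ^ m * t) *
        smoothRestriction Φ g (x - 2 ^ m * t ^ d) * (ρ t : ℂ)
  else
    (((2 : ℝ) ^ (((d : ℝ) - 1) * (j : ℝ) / 2) : ℝ) : ℂ) *
      ∫ t : ℝ, smoothRestriction Φ f (x - 2 ^ m * t) *
        smoothRestriction Φ g ((2 : ℝ) ^ (((d : ℝ) - 1) * (j : ℝ)) * x - 2 ^ m * t ^ d) * (ρ t : ℂ)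

end

/-! Write d = n + 1, N = 2^m, ε = 2^(-n|j|), and take j ≥ 0; for j < 0 the two coordinates of the
curve exchange roles, which is why the symbol bounds are proved for a symbol and for its transpose.
On the frequency side the operator sends u = f̂Φ̂ and v = ĝΦ̂, both carried by 1/2 ≤ |ξ| ≤ 2, to ζ ↦
∫ u(ξ) v(ζ - εξ) M(ξ, ζ - εξ) dξ, where M(ξ, η) = ∫ ρ(t) e^{-2πiN(ξt + ηt^d)} dt.

The symbol. Split ρ into its two halves and the frequencies by sign. Where the phase has no critical
point, the contribution to M is O(1/N), which is already enough. Elsewhere stationary phase gives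
e^{iNφ} times an amplitude which, together with its ξ-derivative, is O(N^{-1/2}); here φ is a
multiple of ξ^p η^(1-p) with p = 1 + 1/n. By the fundamental theorem of calculus the amplitude is a
superposition of products of a function of ξ and a function of η, and these are absorbed into u and
v (`BilinBound.superpose`). Only the unimodular symbol e^{iNφ} remains.

The oscillation (`exists_energy_bilinSymbol_osc_le`). Square the output: two frequency pairs with
the same ζ differ by a shift (τ, -ετ). For |τ| ≤ τ₀ take absolute values. For larger τ there appears
a linear oscillatory operator with phase φ(ξ + τ, η - ετ) - φ(ξ, η). Its mixed derivative is about τ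
∂_ξ∂_η(∂_ξ - ε∂_η)φ, which has size |τ| because p is neither 0 nor 1 and ε is small; so TT* gives
operator norm O((N|τ|)^{-1/2}). Cauchy–Schwarz in τ then costs ε^{-1/2}, since v is shifted only by
ετ. Taking τ₀ = (εN)^{-1/2} gives (εN)^{-1/4}. With the amplitude, the squared L² × L² → L² norm is
O(N^{-1}(εN)^{-1/4}).

From L² to L¹ (`lintegral_curveOp_le`). As R_Φ is convolution with a Schwartz function and |t| ≤ 2
on the support of ρ, on an x-interval of length N only the parts of f and g in windows of length
O(N) matter, up to tails of relative size O(1/N). Cauchy–Schwarz on the interval costs N^{1/2},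
which cancels the N^{-1/2}. Averaging over the intervals costs ε^{-1/2}, because one of the windows
moves at speed ε; the prefactor 2^(-n|j|/2) cancels this. What is left is (εN)^{-1/8} = 2^((n|j| -
m)/8). -/

/-! ### One-dimensional oscillatory integrals -/

/-- The unimodular function `e^{ix}`. -/
noncomputable def osc (x : ℝ) : ℂ := Complex.exp ((x : ℂ) * Complex.I)

theorem norm_osc (x : ℝ) : ‖osc x‖ = 1 := Complex.norm_exp_ofReal_mul_I x

theorem enorm_osc (x : ℝ) : ‖osc x‖ₑ = 1 := by
  rw [← ofReal_norm, norm_osc, ENNReal.ofReal_one]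

theorem osc_add (x y : ℝ) : osc (x + y) = osc x * osc y := by
  simp [osc, add_mul, Complex.exp_add]

theorem osc_sub (x y : ℝ) : osc (x - y) = osc x * osc (-y) := by
  rw [sub_eq_add_neg, osc_add]

theorem conj_osc (x : ℝ) : starRingEnd ℂ (osc x) = osc (-x) := by
  simp [osc, ← Complex.exp_conj]

@[fun_prop]
theorem continuous_osc : Continuous osc := by
  unfold osc; fun_prop

@[fun_prop]
theorem measurable_osc : Measurable osc := continuous_osc.measurable

theorem HasDerivAt.osc {Q : ℝ → ℝ} {q t : ℝ} (hQ : HasDerivAt Q q t) :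
    HasDerivAt (fun t => osc (Q t)) (q * Complex.I * osc (Q t)) t := by
  have := (hQ.ofReal_comp.mul_const Complex.I).cexp
  unfold _root_.osc
  exact this.congr_deriv (by ring)

theorem integral_inv_one_add_mul_sq_le {a b c N : ℝ} (hN : 0 < N) :
    ∫ t in a..b, (1 + N * (t - c) ^ 2)⁻¹ ≤ Real.pi / √N := by
  have hs : 0 < √N := Real.sqrt_pos.2 hN
  have hd : ∀ t ∈ Set.uIcc a b, HasDerivAt (fun t => Real.arctan (√N * (t - c)) / √N)
      ((1 + N * (t - c) ^ 2)⁻¹) t := by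
    intro t _
    have h1 : HasDerivAt (fun t : ℝ => √N * (t - c)) (√N) t := by
      simpa using ((hasDerivAt_id t).sub_const c).const_mul (√N)
    have h2 := (h1.arctan).div_const (√N)
    refine h2.congr_deriv ?_
    rw [mul_pow, Real.sq_sqrt hN.le]
    field_simp
  have hc : Continuous fun t : ℝ => (1 + N * (t - c) ^ 2)⁻¹ := by
    refine Continuous.inv₀ (by fun_prop) fun t => ?_
    positivity
  rw [intervalIntegral.integral_eq_sub_of_hasDerivAt hd (hc.intervalIntegrable _ _), ← sub_div]
  gcongr
  have := Real.arctan_lt_pi_div_two (√N * (b - c))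
  have := Real.neg_pi_div_two_lt_arctan (√N * (a - c))
  linarith

theorem abs_mul_inv_one_add_mul_sq_le {N : ℝ} (hN : 0 < N) (s : ℝ) :
    |s| * (1 + N * s ^ 2)⁻¹ ≤ 1 / (2 * √N) := by
  have hs : 0 < √N := Real.sqrt_pos.2 hN
  have hp : 0 < 1 + N * s ^ 2 := by positivity
  rw [← div_eq_mul_inv, div_le_div_iff₀ hp (by positivity)]
  have h1 : √N ^ 2 = N := Real.sq_sqrt hN.le
  have h2 : |s| ^ 2 = s ^ 2 := sq_abs s
  nlinarith [sq_nonneg (√N * |s| - 1)]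

/-- Van der Corput type bound for a phase with a single nondegenerate critical point `c`. -/
theorem norm_integral_mul_osc_le_of_stationary {a b c r₀ K N : ℝ} (hab : a ≤ b) (hr₀ : 0 < r₀)
    (hN : 0 < N) {h h' : ℝ → ℂ} {Q R R' : ℝ → ℝ}
    (hh : ∀ t ∈ Set.Icc a b, HasDerivAt h (h' t) t) (hh'c : ContinuousOn h' (Set.Icc a b))
    (ha : h a = 0) (hb : h b = 0)
    (hQ : ∀ t ∈ Set.Icc a b, HasDerivAt Q ((t - c) * R t) t)
    (hR : ∀ t ∈ Set.Icc a b, HasDerivAt R (R' t) t) (hR'c : ContinuousOn R' (Set.Icc a b))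
    (hRr : ∀ t ∈ Set.Icc a b, r₀ ≤ R t) (hR'K : ∀ t ∈ Set.Icc a b, |R' t| ≤ K)
    (hhK : ∀ t ∈ Set.Icc a b, ‖h t‖ ≤ K) (hh'K : ∀ t ∈ Set.Icc a b, ‖h' t‖ ≤ K) :
    ‖∫ t in a..b, h t * osc (-(N * Q t))‖ ≤
      (K * Real.pi * (1 + 1 / r₀) + (K / (2 * r₀) + K ^ 2 / (2 * r₀ ^ 2)) * (b - a)) / √N := by
  have hs : 0 < √N := Real.sqrt_pos.2 hN
  have hK : 0 ≤ K := (norm_nonneg _).trans (hhK a (Set.left_mem_Icc.2 hab))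
  -- The weight `k` lives at the scale N^{-1/2} of the critical point. Since N(t - c)²k = 1 - k, it
  -- replaces cutting out a neighbourhood of c by a single weighted integration by parts.
  set k : ℝ → ℝ := fun t => (1 + N * (t - c) ^ 2)⁻¹ with hk
  have hkc : Continuous k := by
    refine Continuous.inv₀ (by fun_prop) fun t => ?_
    positivity
  have hkpos : ∀ t, 0 < k t := fun t => by simp only [hk]; positivity
  have hkd : ∀ t, HasDerivAt k (-(2 * N * (t - c)) * k t ^ 2) t := by
    intro t
    have h1 : HasDerivAt (fun t : ℝ => 1 + N * (t - c) ^ 2) (2 * N * (t - c)) t := by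
      have := ((((hasDerivAt_id t).sub_const c).pow 2).const_mul N).const_add 1
      refine this.congr_deriv ?_
      simp; ring
    have h2 := h1.inv (by positivity)
    refine h2.congr_deriv ?_
    simp only [hk, inv_pow]; ring
  have hRne : ∀ t ∈ Set.Icc a b, R t ≠ 0 := fun t ht => (hr₀.trans_le (hRr t ht)).ne'
  set g : ℝ → ℝ := fun t => (t - c) * k t * (R t)⁻¹ with hg
  set g' : ℝ → ℝ := fun t => (k t + (t - c) * (-(2 * N * (t - c)) * k t ^ 2)) * (R t)⁻¹ +
    (t - c) * k t * (-R' t / R t ^ 2) with hg'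
  have hgd : ∀ t ∈ Set.Icc a b, HasDerivAt g (g' t) t := by
    intro t ht
    have := (((hasDerivAt_id t).sub_const c).mul (hkd t)).mul ((hR t ht).inv (hRne t ht))
    refine this.congr_deriv ?_
    simp [hg']
  have hRc : ContinuousOn R (Set.Icc a b) := fun t ht => (hR t ht).continuousAt.continuousWithinAt
  have hQc : ContinuousOn Q (Set.Icc a b) := fun t ht => (hQ t ht).continuousAt.continuousWithinAt
  have hhc : ContinuousOn h (Set.Icc a b) := fun t ht => (hh t ht).continuousAt.continuousWithinAt
  have hgc : ContinuousOn g (Set.Icc a b) := fun t ht => (hgd t ht).continuousAt.continuousWithinAt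
  have hg'c : ContinuousOn g' (Set.Icc a b) := by
    simp only [hg']
    have h1 : ContinuousOn (fun t => (R t)⁻¹) (Set.Icc a b) := hRc.inv₀ hRne
    have h2 : ContinuousOn (fun t => -R' t / R t ^ 2) (Set.Icc a b) :=
      hR'c.neg.div (hRc.pow 2) fun t ht => pow_ne_zero _ (hRne t ht)
    fun_prop
  have hoc : ContinuousOn (fun t => osc (-(N * Q t))) (Set.Icc a b) :=
    continuous_osc.comp_continuousOn (by fun_prop)
  -- When the derivative of `D` falls on the exponential it produces h(1 - k) times the exponential;
  -- hence h times the exponential is D' + E. The boundary terms of `D` vanish, and `E` is bounded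
  -- by a multiple of k + N^{-1/2}, where k has integral at most π/√N.
  set D : ℝ → ℂ := fun t => h t * (Complex.I * g t) * osc (-(N * Q t)) with hD
  set E : ℝ → ℂ := fun t => (h t * k t - h' t * (Complex.I * g t) - h t * (Complex.I * g' t)) *
    osc (-(N * Q t)) with hE
  have hDd : ∀ t ∈ Set.Icc a b, HasDerivAt D (h t * osc (-(N * Q t)) - E t) t := by
    intro t ht
    have := ((hh t ht).mul ((hgd t ht).ofReal_comp.const_mul Complex.I)).mul
      (((hQ t ht).const_mul N).neg.osc)
    refine this.congr_deriv ?_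
    have hk1 : (k t : ℂ) * (1 + N * (t - c) ^ 2) = 1 := by
      have : k t * (1 + N * (t - c) ^ 2) = 1 := inv_mul_cancel₀ (by positivity)
      exact_mod_cast this
    have hR1 : ((R t : ℂ))⁻¹ * R t = 1 := inv_mul_cancel₀ (by exact_mod_cast hRne t ht)
    have hI : Complex.I * Complex.I = -1 := Complex.I_mul_I
    simp only [hE, Pi.mul_apply, hg]
    push_cast
    linear_combination h t * osc (-(N * Q t)) * hk1 -
      h t * N * (t - c) ^ 2 * k t * osc (-(N * Q t)) * (hI * (R t)⁻¹ * R t - hR1)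
  have hEc : ContinuousOn E (Set.Icc a b) := by
    simp only [hE]
    have h1 : ContinuousOn (fun t => (g t : ℂ)) (Set.Icc a b) :=
      Complex.continuous_ofReal.comp_continuousOn hgc
    have h2 : ContinuousOn (fun t => (g' t : ℂ)) (Set.Icc a b) :=
      Complex.continuous_ofReal.comp_continuousOn hg'c
    have h3 : ContinuousOn (fun t => (k t : ℂ)) (Set.Icc a b) :=
      (Complex.continuous_ofReal.comp hkc).continuousOn
    fun_prop
  have hint : ∀ {f : ℝ → ℂ}, ContinuousOn f (Set.Icc a b) → IntervalIntegrable f volume a b :=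
    fun hf => ContinuousOn.intervalIntegrable (by rwa [Set.uIcc_of_le hab])
  have hheint : IntervalIntegrable (fun t => h t * osc (-(N * Q t))) volume a b :=
    hint (hhc.mul hoc)
  have hEint := hint hEc
  have h0 : ∫ t in a..b, (h t * osc (-(N * Q t)) - E t) = 0 := by
    rw [intervalIntegral.integral_eq_sub_of_hasDerivAt (f := D)
      (by rwa [Set.uIcc_of_le hab]) (hheint.sub hEint)]
    simp [hD, ha, hb]
  have h1 : ∫ t in a..b, h t * osc (-(N * Q t)) = ∫ t in a..b, E t := by
    rw [← sub_eq_zero, ← intervalIntegral.integral_sub hheint hEint, h0]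
  rw [h1]
  have hbound : ∀ t ∈ Set.Ioc a b, ‖E t‖ ≤
      K * (1 + 1 / r₀) * k t + (K / (2 * r₀) + K ^ 2 / (2 * r₀ ^ 2)) / √N := by
    intro t ht'
    have ht : t ∈ Set.Icc a b := ⟨ht'.1.le, ht'.2⟩
    have hRpos : 0 < R t := hr₀.trans_le (hRr t ht)
    have hRi : (R t)⁻¹ ≤ 1 / r₀ := by rw [one_div]; exact inv_anti₀ hr₀ (hRr t ht)
    have hsk := abs_mul_inv_one_add_mul_sq_le hN (t - c)
    change |t - c| * k t ≤ _ at hsk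
    have hgb : |g t| ≤ 1 / (2 * √N) * (1 / r₀) := by
      simp only [hg, abs_mul, abs_of_pos (hkpos t), abs_of_pos (inv_pos.2 hRpos)]
      gcongr
    -- The derivative of (t - c)k is k(2k - 1), and 0 < k ≤ 1.
    have hg'1 : |k t + (t - c) * (-(2 * N * (t - c)) * k t ^ 2)| ≤ k t := by
      have h1 : k t * (1 + N * (t - c) ^ 2) = 1 := inv_mul_cancel₀ (by positivity)
      have h2 : 0 ≤ N * (t - c) ^ 2 := by positivity
      have h3 := hkpos t
      have h4 : k t + (t - c) * (-(2 * N * (t - c)) * k t ^ 2) =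
          k t * (2 * k t - 1) := by linear_combination -2 * k t * h1
      have h5 : k t ≤ 1 := by nlinarith
      rw [h4, abs_mul, abs_of_pos h3]
      have : |2 * k t - 1| ≤ 1 := by rw [abs_le]; constructor <;> linarith
      nlinarith
    have hg'b : |g' t| ≤ k t * (1 / r₀) + 1 / (2 * √N) * (K / r₀ ^ 2) := by
      refine (abs_add_le _ _).trans ?_
      rw [abs_mul, abs_mul, abs_mul, abs_of_pos (inv_pos.2 hRpos), abs_of_pos (hkpos t), abs_div,
        abs_neg, abs_of_pos (pow_pos hRpos 2)]
      have := hR'K t ht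
      have := hRr t ht
      gcongr
    have e1 : ‖E t‖ ≤ ‖h t‖ * k t + ‖h' t‖ * |g t| + ‖h t‖ * |g' t| := by
      simp only [hE, norm_mul, norm_osc, mul_one]
      refine (norm_sub_le _ _).trans (add_le_add ((norm_sub_le _ _).trans ?_) ?_)
      · simp [abs_of_pos (hkpos t)]
      · simp
    have e2 := hhK t ht
    have e3 := hh'K t ht
    have e4 := (hkpos t).le
    calc ‖E t‖ ≤ K * k t + K * (1 / (2 * √N) * (1 / r₀)) +
          K * (k t * (1 / r₀) + 1 / (2 * √N) * (K / r₀ ^ 2)) := by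
          refine e1.trans ?_
          gcongr
      _ = _ := by field_simp; ring
  have hbi : IntervalIntegrable (fun t => K * (1 + 1 / r₀) * k t +
      (K / (2 * r₀) + K ^ 2 / (2 * r₀ ^ 2)) / √N) volume a b :=
    (by fun_prop : Continuous _).intervalIntegrable _ _
  refine (intervalIntegral.norm_integral_le_of_norm_le hab (Filter.Eventually.of_forall hbound)
    hbi).trans ?_
  rw [intervalIntegral.integral_add ((by fun_prop : Continuous _).intervalIntegrable _ _)
    (by simp), intervalIntegral.integral_const_mul, intervalIntegral.integral_const]
  have h2 := integral_inv_one_add_mul_sq_le (a := a) (b := b) (c := c) hN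
  change ∫ t in a..b, k t ≤ _ at h2
  calc _ ≤ K * (1 + 1 / r₀) * (Real.pi / √N) +
        (b - a) • ((K / (2 * r₀) + K ^ 2 / (2 * r₀ ^ 2)) / √N) := by gcongr
    _ = _ := by simp only [smul_eq_mul]; ring

/-- One integration by parts against a phase without critical points. -/
theorem norm_integral_mul_osc_le_of_nonstationary {a b B K N : ℝ} (hab : a ≤ b) (hB : 0 < B)
    (hN : 0 < N) {h h' : ℝ → ℂ} {q q' Q : ℝ → ℝ}
    (hh : ∀ t ∈ Set.Icc a b, HasDerivAt h (h' t) t) (hh'c : ContinuousOn h' (Set.Icc a b))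
    (ha : h a = 0) (hb : h b = 0)
    (hQ : ∀ t ∈ Set.Icc a b, HasDerivAt Q (q t) t)
    (hq : ∀ t ∈ Set.Icc a b, HasDerivAt q (q' t) t) (hq'c : ContinuousOn q' (Set.Icc a b))
    (hqB : ∀ t ∈ Set.Icc a b, B ≤ |q t|)
    (hK : ∀ t ∈ Set.Icc a b, ‖(h' t * q t - h t * q' t) / (q t : ℂ) ^ 2‖ ≤ K) :
    (∫ t in a..b, h t * osc (N * Q t)) =
      Complex.I / N * ∫ t in a..b, (h' t * q t - h t * q' t) / (q t : ℂ) ^ 2 * osc (N * Q t) ∧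
    ‖∫ t in a..b, h t * osc (N * Q t)‖ ≤ K * (b - a) / N := by
  have hqne : ∀ t ∈ Set.Icc a b, (q t : ℂ) ≠ 0 := fun t ht => by
    have := hB.trans_le (hqB t ht)
    exact_mod_cast abs_pos.1 this
  have hqc : ContinuousOn (fun t => (q t : ℂ)) (Set.Icc a b) := fun t ht =>
    ((hq t ht).ofReal_comp).continuousAt.continuousWithinAt
  have hq'c' : ContinuousOn (fun t => (q' t : ℂ)) (Set.Icc a b) :=
    Complex.continuous_ofReal.comp_continuousOn hq'c
  have hQc : ContinuousOn Q (Set.Icc a b) := fun t ht => (hQ t ht).continuousAt.continuousWithinAt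
  have hhc : ContinuousOn h (Set.Icc a b) := fun t ht => (hh t ht).continuousAt.continuousWithinAt
  have hoc : ContinuousOn (fun t => osc (N * Q t)) (Set.Icc a b) :=
    continuous_osc.comp_continuousOn (by fun_prop)
  have hint : ∀ {f : ℝ → ℂ}, ContinuousOn f (Set.Icc a b) → IntervalIntegrable f volume a b :=
    fun hf => ContinuousOn.intervalIntegrable (by rwa [Set.uIcc_of_le hab])
  set D : ℝ → ℂ := fun t => (h t / q t) * osc (N * Q t) with hD
  set E : ℝ → ℂ := fun t => (h' t * q t - h t * q' t) / (q t : ℂ) ^ 2 * osc (N * Q t) with hE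
  have hDd : ∀ t ∈ Set.Icc a b,
      HasDerivAt D (E t + Complex.I * N * (h t * osc (N * Q t))) t := by
    intro t ht
    have := ((hh t ht).div (hq t ht).ofReal_comp (hqne t ht)).mul (((hQ t ht).const_mul N).osc)
    refine this.congr_deriv ?_
    have := hqne t ht
    simp only [hE, Pi.div_apply]
    push_cast
    field_simp
  have hEint : IntervalIntegrable E volume a b := by
    refine hint (ContinuousOn.mul (ContinuousOn.div (by fun_prop) (by fun_prop) ?_) hoc)
    exact fun t ht => pow_ne_zero _ (hqne t ht)
  have hheint : IntervalIntegrable (fun t => h t * osc (N * Q t)) volume a b :=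
    hint (hhc.mul hoc)
  have h0 : ∫ t in a..b, (E t + Complex.I * N * (h t * osc (N * Q t))) = 0 := by
    rw [intervalIntegral.integral_eq_sub_of_hasDerivAt (f := D)
      (by rwa [Set.uIcc_of_le hab]) (hEint.add (hheint.const_mul _))]
    simp [hD, ha, hb]
  rw [intervalIntegral.integral_add hEint (hheint.const_mul _),
    intervalIntegral.integral_const_mul] at h0
  have hN' : (N : ℂ) ≠ 0 := by exact_mod_cast hN.ne'
  have h1 : (∫ t in a..b, h t * osc (N * Q t)) = Complex.I / N * ∫ t in a..b, E t := by
    field_simp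
    linear_combination (-Complex.I) * h0 +
      N * (∫ t in a..b, h t * osc (N * Q t)) * Complex.I_mul_I
  refine ⟨h1, ?_⟩
  have h2 : ‖∫ t in a..b, E t‖ ≤ K * |b - a| := by
    refine intervalIntegral.norm_integral_le_of_norm_le_const fun t ht => ?_
    rw [Set.uIoc_of_le hab] at ht
    simp only [hE, norm_mul, norm_osc, mul_one]
    exact hK t ⟨ht.1.le, ht.2⟩
  rw [h1, norm_mul]
  rw [abs_of_nonneg (sub_nonneg.2 hab)] at h2
  have : ‖Complex.I / (N : ℂ)‖ = 1 / N := by simp [abs_of_pos hN]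
  rw [this]
  calc 1 / N * ‖∫ t in a..b, E t‖ ≤ 1 / N * (K * (b - a)) := by gcongr
    _ = _ := by ring

/-- Two integrations by parts against a phase without critical points. -/
theorem norm_integral_mul_osc_le_of_nonstationary_sq {a b B K N : ℝ} (hab : a ≤ b) (hB : 0 < B)
    (hN : 0 < N) {h h' h'' : ℝ → ℂ} {q q' q'' Q : ℝ → ℝ}
    (hh : ∀ t ∈ Set.Icc a b, HasDerivAt h (h' t) t)
    (hh' : ∀ t ∈ Set.Icc a b, HasDerivAt h' (h'' t) t) (hh''c : ContinuousOn h'' (Set.Icc a b))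
    (ha : h a = 0) (hb : h b = 0) (ha' : h' a = 0) (hb' : h' b = 0)
    (hQ : ∀ t ∈ Set.Icc a b, HasDerivAt Q (q t) t)
    (hq : ∀ t ∈ Set.Icc a b, HasDerivAt q (q' t) t)
    (hq' : ∀ t ∈ Set.Icc a b, HasDerivAt q' (q'' t) t) (hq''c : ContinuousOn q'' (Set.Icc a b))
    (hqB : ∀ t ∈ Set.Icc a b, B ≤ |q t|)
    (hq'B : ∀ t ∈ Set.Icc a b, |q' t| ≤ K * B) (hq''B : ∀ t ∈ Set.Icc a b, |q'' t| ≤ K * B)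
    (hhK : ∀ t ∈ Set.Icc a b, ‖h t‖ ≤ K) (hh'K : ∀ t ∈ Set.Icc a b, ‖h' t‖ ≤ K)
    (hh''K : ∀ t ∈ Set.Icc a b, ‖h'' t‖ ≤ K) :
    ‖∫ t in a..b, h t * osc (N * Q t)‖ ≤
      (K + 4 * K ^ 2 + 3 * K ^ 3) * (b - a) / (N * B) ^ 2 := by
  have hK : 0 ≤ K := (norm_nonneg _).trans (hhK a (Set.left_mem_Icc.2 hab))
  have hqne : ∀ t ∈ Set.Icc a b, (q t : ℂ) ≠ 0 := fun t ht => by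
    have := hB.trans_le (hqB t ht)
    exact_mod_cast abs_pos.1 this
  have hcts : ∀ {E : Type} [NormedAddCommGroup E] [NormedSpace ℝ E] {f f' : ℝ → E},
      (∀ t ∈ Set.Icc a b, HasDerivAt f (f' t) t) → ContinuousOn f (Set.Icc a b) :=
    fun hf t ht => (hf t ht).continuousAt.continuousWithinAt
  have hh'c := hcts hh'
  have hq'c := hcts hq'
  have hqc := hcts fun t ht => (hq t ht).ofReal_comp
  have hq'c' := hcts fun t ht => (hq' t ht).ofReal_comp
  have hq''c' : ContinuousOn (fun t => (q'' t : ℂ)) (Set.Icc a b) :=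
    Complex.continuous_ofReal.comp_continuousOn hq''c
  have hhc := hcts hh
  set g : ℝ → ℂ := fun t => (h' t * q t - h t * q' t) / (q t : ℂ) ^ 2 with hg
  set g' : ℝ → ℂ := fun t => ((h'' t * q t - h t * q'' t) * (q t : ℂ) ^ 2 -
    (h' t * q t - h t * q' t) * (2 * q t * q' t)) / ((q t : ℂ) ^ 2) ^ 2 with hg'
  have hgd : ∀ t ∈ Set.Icc a b, HasDerivAt g (g' t) t := by
    intro t ht
    have := (((hh' t ht).mul (hq t ht).ofReal_comp).sub
      ((hh t ht).mul (hq' t ht).ofReal_comp)).div ((hq t ht).ofReal_comp.pow 2)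
      (pow_ne_zero _ (hqne t ht))
    refine this.congr_deriv ?_
    simp only [hg', Pi.mul_apply, Pi.sub_apply, Pi.pow_apply]
    congr 1
    rw [show (2 - 1 : ℕ) = 1 from rfl]
    push_cast
    ring
  have hg'c : ContinuousOn g' (Set.Icc a b) := by
    refine ContinuousOn.div (by fun_prop) (by fun_prop) ?_
    exact fun t ht => pow_ne_zero _ (pow_ne_zero _ (hqne t ht))
  have hgc := hcts hgd
  obtain ⟨K₁, hK₁⟩ := isCompact_Icc.exists_bound_of_continuousOn hgc
  have h1 := (norm_integral_mul_osc_le_of_nonstationary hab hB hN hh hh'c ha hb hQ hq hq'c hqB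
    hK₁).1
  have hbd : ∀ t ∈ Set.Icc a b, ‖(g' t * q t - g t * q' t) / (q t : ℂ) ^ 2‖ ≤
      (K + 4 * K ^ 2 + 3 * K ^ 3) / B ^ 2 := by
    intro t ht
    have hne := hqne t ht
    have hpos : 0 < |q t| := hB.trans_le (hqB t ht)
    have e : (g' t * q t - g t * q' t) / (q t : ℂ) ^ 2 =
        h'' t / q t ^ 2 - h t * q'' t / q t ^ 3 - 3 * h' t * q' t / q t ^ 3 +
          3 * h t * q' t ^ 2 / q t ^ 4 := by
      simp only [hg, hg']
      field_simp
      ring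
    have b1 : ‖h'' t / q t ^ 2‖ ≤ K / B ^ 2 := by
      rw [norm_div, norm_pow, Complex.norm_real, Real.norm_eq_abs]
      have := hqB t ht
      have := hh''K t ht
      gcongr
    have b2 : ‖h t * q'' t / q t ^ 3‖ ≤ K * (K * B) / B ^ 3 := by
      rw [norm_div, norm_mul, norm_pow, Complex.norm_real, Complex.norm_real, Real.norm_eq_abs,
        Real.norm_eq_abs]
      have := hqB t ht
      have := hhK t ht
      have := hq''B t ht
      gcongr
    have b3 : ‖3 * h' t * q' t / q t ^ 3‖ ≤ 3 * K * (K * B) / B ^ 3 := by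
      rw [norm_div, norm_mul, norm_mul, norm_pow, Complex.norm_real, Complex.norm_real,
        Real.norm_eq_abs, Real.norm_eq_abs, Complex.norm_ofNat]
      have := hqB t ht
      have := hh'K t ht
      have := hq'B t ht
      gcongr
    have b4 : ‖3 * h t * q' t ^ 2 / q t ^ 4‖ ≤ 3 * K * (K * B) ^ 2 / B ^ 4 := by
      rw [norm_div, norm_mul, norm_mul, norm_pow, norm_pow, Complex.norm_real, Complex.norm_real,
        Real.norm_eq_abs, Real.norm_eq_abs, Complex.norm_ofNat]
      have := hqB t ht
      have := hhK t ht
      have := hq'B t ht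
      gcongr
    rw [e]
    calc _ ≤ K / B ^ 2 + K * (K * B) / B ^ 3 + 3 * K * (K * B) / B ^ 3 +
          3 * K * (K * B) ^ 2 / B ^ 4 :=
          (norm_add_le _ _).trans (add_le_add ((norm_sub_le _ _).trans
            (add_le_add ((norm_sub_le _ _).trans (add_le_add b1 b2)) b3)) b4)
      _ = _ := by field_simp; ring
  -- The second integration by parts has the new amplitude `g`, which vanishes at the endpoints
  -- because both h and h' do.
  have h2 := (norm_integral_mul_osc_le_of_nonstationary hab hB hN hgd hg'c (by simp [hg, ha, ha'])
    (by simp [hg, hb, hb']) hQ hq hq'c hqB hbd).2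
  rw [h1, norm_mul]
  have : ‖Complex.I / (N : ℂ)‖ = 1 / N := by simp [abs_of_pos hN]
  rw [this]
  calc _ ≤ 1 / N * ((K + 4 * K ^ 2 + 3 * K ^ 3) / B ^ 2 * (b - a) / N) := by gcongr
    _ = _ := by field_simp

/-! ### The oscillatory kernel of the phase `ξ ^ p * η ^ q` -/

theorem exists_mem_Icc_sub_eq_mul {l u a b : ℝ} {f f' : ℝ → ℝ} (ha : a ∈ Set.Icc l u)
    (hb : b ∈ Set.Icc l u) (hf : ∀ x ∈ Set.Icc l u, HasDerivAt f (f' x) x) :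
    ∃ y ∈ Set.Icc l u, f b - f a = (b - a) * f' y := by
  have key : ∀ {a b : ℝ}, a ∈ Set.Icc l u → b ∈ Set.Icc l u → a < b →
      ∃ y ∈ Set.Icc l u, f b - f a = (b - a) * f' y := by
    intro a b ha hb hab
    have hsub : Set.Icc a b ⊆ Set.Icc l u := Set.Icc_subset_Icc ha.1 hb.2
    obtain ⟨y, hy, h⟩ := exists_hasDerivAt_eq_slope f f' hab
      (fun x hx => (hf x (hsub hx)).continuousAt.continuousWithinAt)
      (fun x hx => hf x (hsub (Set.Ioo_subset_Icc_self hx)))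
    refine ⟨y, hsub (Set.Ioo_subset_Icc_self hy), ?_⟩
    rw [h]
    field_simp [sub_ne_zero.2 hab.ne']
  rcases lt_trichotomy a b with hab | hab | hab
  · exact key ha hb hab
  · exact ⟨a, ha, by simp [hab]⟩
  · obtain ⟨y, hy, h⟩ := key hb ha hab
    exact ⟨y, hy, by linear_combination -h⟩

/-- The second mixed difference of `ξ ^ r * η ^ q`, along the shift `(τ, -ετ)` and in the second
variable. -/
noncomputable def mixedDiff (r q ε τ η η' ξ : ℝ) : ℝ :=
  ((ξ + τ) ^ r * (η - ε * τ) ^ q - ξ ^ r * η ^ q) -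
    ((ξ + τ) ^ r * (η' - ε * τ) ^ q - ξ ^ r * η' ^ q)

/-- The mean value theorem is applied twice, first in η and then along the segment of the shift (τ,
-ετ). The last factor comes from the directional derivative ∂_ξ - ε∂_η. The formula is exact, so it
yields upper and lower bounds alike. -/
theorem exists_mixedDiff_eq {r q τ ε ξ η η' : ℝ}
    (hξ : ξ ∈ Set.Icc (1 / 4 : ℝ) (9 / 4)) (hξτ : ξ + τ ∈ Set.Icc (1 / 4 : ℝ) (9 / 4))
    (hη : η ∈ Set.Icc (1 / 2 : ℝ) 2) (hητ : η - ε * τ ∈ Set.Icc (1 / 2 : ℝ) 2)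
    (hη' : η' ∈ Set.Icc (1 / 2 : ℝ) 2) (hητ' : η' - ε * τ ∈ Set.Icc (1 / 2 : ℝ) 2) :
    ∃ X ∈ Set.Icc (1 / 4 : ℝ) (9 / 4), ∃ Y ∈ Set.Icc (1 / 2 : ℝ) 2,
      mixedDiff r q ε τ η η' ξ =
        τ * (η - η') * (q * X ^ (r - 1) * Y ^ (q - 2) * (r * Y - ε * (q - 1) * X)) := by
  -- The points that stay in [1/2, 2] after the shift form an interval, so every intermediate point
  -- keeps positive bases for the real powers.
  have hmem : ∀ {y : ℝ}, y ∈ Set.Icc (max (1 / 2) (1 / 2 + ε * τ)) (min 2 (2 + ε * τ)) ↔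
      y ∈ Set.Icc (1 / 2 : ℝ) 2 ∧ y - ε * τ ∈ Set.Icc (1 / 2 : ℝ) 2 := by
    intro y
    simp only [Set.mem_Icc, max_le_iff, le_min_iff]
    constructor
    · rintro ⟨⟨h1, h2⟩, h3, h4⟩
      exact ⟨⟨h1, h3⟩, by linarith, by linarith⟩
    · rintro ⟨⟨h1, h2⟩, h3, h4⟩
      exact ⟨⟨h1, by linarith⟩, h2, by linarith⟩
  obtain ⟨y, hy, h1⟩ := exists_mem_Icc_sub_eq_mul
    (f := fun y => (ξ + τ) ^ r * (y - ε * τ) ^ q - ξ ^ r * y ^ q)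
    (f' := fun y => (ξ + τ) ^ r * (q * (y - ε * τ) ^ (q - 1)) - ξ ^ r * (q * y ^ (q - 1)))
    (hmem.2 ⟨hη', hητ'⟩) (hmem.2 ⟨hη, hητ⟩) (by
      intro y hy
      obtain ⟨hy1, hy2⟩ := hmem.1 hy
      have a1 := ((hasDerivAt_id y).sub_const (ε * τ)).rpow_const (p := q)
        (Or.inl (by simp only [id]; linarith [hy2.1]))
      have a2 := (hasDerivAt_id y).rpow_const (p := q) (Or.inl (by simp only [id]; linarith [hy1.1]))
      refine ((a1.const_mul ((ξ + τ) ^ r)).sub (a2.const_mul (ξ ^ r))).congr_deriv ?_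
      simp)
  obtain ⟨hy1, hy2⟩ := hmem.1 hy
  have hX : ∀ s ∈ Set.Icc (0 : ℝ) 1, ξ + s * τ ∈ Set.Icc (1 / 4 : ℝ) (9 / 4) := by
    intro s hs
    have e : ξ + s * τ = (1 - s) * ξ + s * (ξ + τ) := by ring
    rw [e]
    exact (convex_Icc _ _) hξ hξτ (by linarith [hs.2]) hs.1 (by ring)
  have hY : ∀ s ∈ Set.Icc (0 : ℝ) 1, y - s * (ε * τ) ∈ Set.Icc (1 / 2 : ℝ) 2 := by
    intro s hs
    have e : y - s * (ε * τ) = (1 - s) * y + s * (y - ε * τ) := by ring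
    rw [e]
    exact (convex_Icc _ _) hy1 hy2 (by linarith [hs.2]) hs.1 (by ring)
  obtain ⟨s, hs, h2⟩ := exists_mem_Icc_sub_eq_mul
    (f := fun s => (ξ + s * τ) ^ r * (y - s * (ε * τ)) ^ (q - 1))
    (f' := fun s => τ * (ξ + s * τ) ^ (r - 1) * (y - s * (ε * τ)) ^ (q - 2) *
      (r * (y - s * (ε * τ)) - ε * (q - 1) * (ξ + s * τ)))
    (Set.left_mem_Icc.2 zero_le_one) (Set.right_mem_Icc.2 zero_le_one) (by
      intro s hs
      have hx0 : 0 < ξ + s * τ := by linarith [(hX s hs).1]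
      have hy0 : 0 < y - s * (ε * τ) := by linarith [(hY s hs).1]
      have a1 := (((hasDerivAt_id s).mul_const τ).const_add ξ).rpow_const (p := r)
        (Or.inl (by simpa using hx0.ne'))
      have a2 := (((hasDerivAt_id s).mul_const (ε * τ)).const_sub y).rpow_const (p := q - 1)
        (Or.inl (by simpa using hy0.ne'))
      refine (a1.mul a2).congr_deriv ?_
      simp only [id]
      have e1 : (ξ + s * τ) ^ r = (ξ + s * τ) ^ (r - 1) * (ξ + s * τ) := by
        rw [← Real.rpow_add_one hx0.ne']; ring_nf
      have e2 : (y - s * (ε * τ)) ^ (q - 1) = (y - s * (ε * τ)) ^ (q - 2) * (y - s * (ε * τ)) := by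
        rw [← Real.rpow_add_one hy0.ne']; ring_nf
      rw [show q - 1 - 1 = q - 2 by ring, e1, e2]
      ring)
  refine ⟨ξ + s * τ, hX s hs, y - s * (ε * τ), hY s hs, ?_⟩
  simp only [one_mul, zero_mul, add_zero, sub_zero] at h1 h2
  unfold mixedDiff
  rw [h1]
  linear_combination (η - η') * q * h2

/-- Differentiating in ξ only lowers the exponent, so all derivatives of the phase stay in the same
family and are controlled by `exists_mixedDiff_eq`. -/
theorem hasDerivAt_mixedDiff {r q ε τ η η' ξ : ℝ} (hξ : 0 < ξ) (hξτ : 0 < ξ + τ) :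
    HasDerivAt (mixedDiff r q ε τ η η') (r * mixedDiff (r - 1) q ε τ η η' ξ) ξ := by
  have a1 := ((hasDerivAt_id ξ).add_const τ).rpow_const (p := r)
    (Or.inl (by simpa using hξτ.ne'))
  have a2 := (hasDerivAt_id ξ).rpow_const (p := r) (Or.inl (by simpa using hξ.ne'))
  refine (((a1.mul_const ((η - ε * τ) ^ q)).sub (a2.mul_const (η ^ q))).sub
    ((a1.mul_const ((η' - ε * τ) ^ q)).sub (a2.mul_const (η' ^ q)))).congr_deriv ?_
  simp only [id, mixedDiff]
  ring

theorem exists_rpow_bounds (e : ℝ) :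
    ∃ M : ℝ, 0 < M ∧ ∀ x ∈ Set.Icc (1 / 4 : ℝ) (9 / 4), M⁻¹ ≤ x ^ e ∧ x ^ e ≤ M := by
  have hc : ∀ e : ℝ, ∃ M : ℝ, ∀ x ∈ Set.Icc (1 / 4 : ℝ) (9 / 4), x ^ e ≤ M := by
    intro e
    have : ContinuousOn (fun x : ℝ => x ^ e) (Set.Icc (1 / 4 : ℝ) (9 / 4)) := fun x hx =>
      (Real.continuousAt_rpow_const x e (Or.inl (by linarith [hx.1]))).continuousWithinAt
    obtain ⟨M, hM⟩ := isCompact_Icc.exists_bound_of_continuousOn this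
    exact ⟨M, fun x hx => (le_abs_self _).trans (hM x hx)⟩
  obtain ⟨M₁, h₁⟩ := hc e
  obtain ⟨M₂, h₂⟩ := hc (-e)
  refine ⟨max 1 (max M₁ M₂), by positivity, fun x hx => ⟨?_, (h₁ x hx).trans (by simp)⟩⟩
  have hx0 : 0 < x := by linarith [hx.1]
  have h3 := h₂ x hx
  rw [Real.rpow_neg hx0.le] at h3
  exact inv_le_of_inv_le₀ (by positivity) (h3.trans (by simp))

theorem exists_abs_mixedDiff_le (r q e₀ : ℝ) : ∃ K : ℝ, 0 ≤ K ∧ ∀ {τ ε ξ η η' : ℝ}, |ε| ≤ e₀ →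
    ξ ∈ Set.Icc (1 / 4 : ℝ) (9 / 4) → ξ + τ ∈ Set.Icc (1 / 4 : ℝ) (9 / 4) →
    η ∈ Set.Icc (1 / 2 : ℝ) 2 → η - ε * τ ∈ Set.Icc (1 / 2 : ℝ) 2 →
    η' ∈ Set.Icc (1 / 2 : ℝ) 2 → η' - ε * τ ∈ Set.Icc (1 / 2 : ℝ) 2 →
    |mixedDiff r q ε τ η η' ξ| ≤ K * |τ * (η - η')| := by
  obtain ⟨M₁, hM₁, h₁⟩ := exists_rpow_bounds (r - 1)
  obtain ⟨M₂, hM₂, h₂⟩ := exists_rpow_bounds (q - 2)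
  refine ⟨|q| * M₁ * M₂ * (|r| * 2 + |e₀| * |q - 1| * (9 / 4)), by positivity, ?_⟩
  intro τ ε ξ η η' hε hξ hξτ hη hητ hη' hητ'
  obtain ⟨X, hX, Y, hY, h⟩ := exists_mixedDiff_eq (r := r) (q := q) hξ hξτ hη hητ hη' hητ'
  have hY' : Y ∈ Set.Icc (1 / 4 : ℝ) (9 / 4) := ⟨by linarith [hY.1], by linarith [hY.2]⟩
  have hX0 : 0 < X := by linarith [hX.1]
  have hY0 : 0 < Y := by linarith [hY.1]
  have b1 := (h₁ X hX).2
  have b2 := (h₂ Y hY').2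
  have hε' : |ε| ≤ |e₀| := hε.trans (le_abs_self _)
  rw [h, abs_mul, mul_comm]
  refine mul_le_mul_of_nonneg_right ?_ (abs_nonneg _)
  rw [abs_mul, abs_mul, abs_mul, abs_of_pos (Real.rpow_pos_of_pos hX0 _),
    abs_of_pos (Real.rpow_pos_of_pos hY0 _)]
  have b3 : |r * Y - ε * (q - 1) * X| ≤ |r| * 2 + |e₀| * |q - 1| * (9 / 4) := by
    refine (abs_sub _ _).trans ?_
    rw [abs_mul, abs_mul, abs_mul, abs_of_pos hX0, abs_of_pos hY0]
    have := hX.2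
    have := hY.2
    gcongr
  gcongr

/-- Up to the factor p, this is the ξ-derivative of the phase of the TT* kernel. The critical factor
is (p - 1)Y + εpX, which could vanish for ε of size one; the smallness of ε is needed exactly here.
-/
theorem exists_le_abs_mixedDiff {p : ℝ} (hp1 : p ≠ 1) :
    ∃ κ : ℝ, 0 < κ ∧ ∀ {τ ε ξ η η' : ℝ}, 12 * (|ε| * |p|) ≤ |p - 1| →
    ξ ∈ Set.Icc (1 / 4 : ℝ) (9 / 4) → ξ + τ ∈ Set.Icc (1 / 4 : ℝ) (9 / 4) →
    η ∈ Set.Icc (1 / 2 : ℝ) 2 → η - ε * τ ∈ Set.Icc (1 / 2 : ℝ) 2 →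
    η' ∈ Set.Icc (1 / 2 : ℝ) 2 → η' - ε * τ ∈ Set.Icc (1 / 2 : ℝ) 2 →
    κ * |τ * (η - η')| ≤ |mixedDiff (p - 1) (1 - p) ε τ η η' ξ| := by
  obtain ⟨M₁, hM₁, h₁⟩ := exists_rpow_bounds (p - 1 - 1)
  obtain ⟨M₂, hM₂, h₂⟩ := exists_rpow_bounds (1 - p - 2)
  have hp1' : 0 < |p - 1| := abs_pos.2 (sub_ne_zero.2 hp1)
  have hp1'' : |1 - p| = |p - 1| := abs_sub_comm _ _
  refine ⟨|1 - p| * M₁⁻¹ * M₂⁻¹ * (|p - 1| / 4), by rw [hp1'']; positivity, ?_⟩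
  intro τ ε ξ η η' hε hξ hξτ hη hητ hη' hητ'
  obtain ⟨X, hX, Y, hY, h⟩ := exists_mixedDiff_eq (r := p - 1) (q := 1 - p) hξ hξτ hη hητ hη' hητ'
  have hY' : Y ∈ Set.Icc (1 / 4 : ℝ) (9 / 4) := ⟨by linarith [hY.1], by linarith [hY.2]⟩
  have hX0 : 0 < X := by linarith [hX.1]
  have hY0 : 0 < Y := by linarith [hY.1]
  have b1 := (h₁ X hX).1
  have b2 := (h₂ Y hY').1
  rw [h, abs_mul (τ * (η - η')), mul_comm]
  refine mul_le_mul_of_nonneg_left ?_ (abs_nonneg _)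
  rw [abs_mul, abs_mul, abs_mul, abs_of_pos (Real.rpow_pos_of_pos hX0 _),
    abs_of_pos (Real.rpow_pos_of_pos hY0 _)]
  -- With Y ≥ 1/2 and X ≤ 9/4 the factor is at least |p - 1|(1/2 - 9/48), which exceeds |p - 1|/4.
  have b3 : |p - 1| / 4 ≤ |(p - 1) * Y - ε * (1 - p - 1) * X| := by
    have e : (p - 1) * Y - ε * (1 - p - 1) * X = (p - 1) * Y - -(ε * p * X) := by ring
    rw [e]
    refine le_trans ?_ (abs_sub_abs_le_abs_sub _ _)
    rw [abs_neg, abs_mul, abs_mul, abs_mul, abs_of_pos hX0, abs_of_pos hY0]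
    have := hX.2
    have := hY.1
    have := mul_nonneg (abs_nonneg ε) (abs_nonneg p)
    nlinarith
  gcongr

/-! ### Decay of the TT* kernel, with a smooth frequency cutoff. -/

/-- A smooth cutoff equal to one on `[1/2, 2]` and supported in `(1/4, 9/4)`. -/
noncomputable def freqBump : ContDiffBump (5 / 4 : ℝ) := ⟨3 / 4, 1, by norm_num, by norm_num⟩

theorem freqBump_eq_one {x : ℝ} (hx : x ∈ Set.Icc (1 / 2 : ℝ) 2) : freqBump x = 1 := by
  refine freqBump.one_of_mem_closedBall ?_
  simp only [freqBump, Metric.mem_closedBall, Real.dist_eq, abs_le]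
  constructor <;> linarith [hx.1, hx.2]

theorem support_freqBump : Function.support freqBump = Set.Ioo (1 / 4 : ℝ) (9 / 4) := by
  rw [freqBump.support_eq, Real.ball_eq_Ioo]
  norm_num [freqBump]

theorem freqBump_eq_zero {x : ℝ} (hx : x ∉ Set.Ioo (1 / 4 : ℝ) (9 / 4)) : freqBump x = 0 := by
  rwa [← support_freqBump, Function.notMem_support] at hx

theorem exists_freqBump_derivatives : ∃ (χ' χ'' : ℝ → ℝ) (K : ℝ), 0 ≤ K ∧
    (∀ x, HasDerivAt freqBump (χ' x) x) ∧ (∀ x, HasDerivAt χ' (χ'' x) x) ∧ Continuous χ'' ∧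
    (∀ x, |freqBump x| ≤ K) ∧ (∀ x, |χ' x| ≤ K) ∧ (∀ x, |χ'' x| ≤ K) ∧
    (∀ x, x ∉ Set.Ioo (1 / 4 : ℝ) (9 / 4) → χ' x = 0) := by
  have h0 : ContDiff ℝ ∞ (freqBump : ℝ → ℝ) := freqBump.contDiff
  have h1 : ContDiff ℝ ∞ (deriv (freqBump : ℝ → ℝ)) := (contDiff_infty_iff_deriv.1 h0).2
  have h2 : ContDiff ℝ ∞ (deriv (deriv (freqBump : ℝ → ℝ))) := (contDiff_infty_iff_deriv.1 h1).2
  have c0 : HasCompactSupport (freqBump : ℝ → ℝ) := freqBump.hasCompactSupport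
  have c1 := c0.deriv
  have c2 := c1.deriv
  obtain ⟨K0, hK0⟩ := h0.continuous.bounded_above_of_compact_support c0
  obtain ⟨K1, hK1⟩ := h1.continuous.bounded_above_of_compact_support c1
  obtain ⟨K2, hK2⟩ := h2.continuous.bounded_above_of_compact_support c2
  refine ⟨_, _, max 0 (max K0 (max K1 K2)), by positivity,
    fun x => (h0.differentiable (by simp) x).hasDerivAt,
    fun x => (h1.differentiable (by simp) x).hasDerivAt, h2.continuous,
    fun x => (hK0 x).trans (by simp), fun x => (hK1 x).trans (by simp),
    fun x => (hK2 x).trans (by simp), fun x hx => ?_⟩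
  -- Outside its support the nonnegative cutoff attains its minimum 0, so its derivative vanishes
  -- there, endpoints included.
  refine IsLocalMin.deriv_eq_zero (Filter.Eventually.of_forall fun y => ?_)
  rw [freqBump_eq_zero hx]
  exact freqBump.nonneg

set_option maxHeartbeats 1000000 in
/-- Decay of the kernel of `T T*` for the phase `ξ ^ p * η ^ (1 - p)`. -/
theorem exists_norm_integral_osc_mixedDiff_le {p : ℝ} (hp0 : p ≠ 0) (hp1 : p ≠ 1) :
    ∃ C : ℝ, 0 ≤ C ∧ ∀ {τ ε μ η η' : ℝ}, 12 * (|ε| * |p|) ≤ |p - 1| → 0 < μ →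
    η ∈ Set.Icc (1 / 2 : ℝ) 2 → η - ε * τ ∈ Set.Icc (1 / 2 : ℝ) 2 →
    η' ∈ Set.Icc (1 / 2 : ℝ) 2 → η' - ε * τ ∈ Set.Icc (1 / 2 : ℝ) 2 →
    ‖∫ ξ : ℝ, ((freqBump ξ * freqBump (ξ + τ) : ℝ) : ℂ) *
      osc (μ * mixedDiff p (1 - p) ε τ η η' ξ)‖ ≤ C / (1 + (μ * τ * (η - η')) ^ 2) := by
  obtain ⟨χ', χ'', K, hK, hχ, hχ', hχ''c, hχK, hχ'K, hχ''K, hχ'0⟩ := exists_freqBump_derivatives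
  obtain ⟨κ, hκ, hlow⟩ := exists_le_abs_mixedDiff hp1
  obtain ⟨K₂, hK₂, hup₂⟩ := exists_abs_mixedDiff_le (p - 1 - 1) (1 - p) (|p - 1| / (12 * |p|))
  obtain ⟨K₃, hK₃, hup₃⟩ := exists_abs_mixedDiff_le (p - 1 - 1 - 1) (1 - p)
    (|p - 1| / (12 * |p|))
  have hp : 0 < |p| := abs_pos.2 hp0
  -- One constant serves for the amplitude with its two derivatives (the term 4K²) and for the
  -- ratios of the second and third phase derivatives to the lower bound `B` of the first. These
  -- ratios do not depend on τ or η - η', since all the phase derivatives scale like τ(η - η').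
  set k : ℝ := 4 * K ^ 2 + |p - 1| * K₂ / κ + |p - 1| * |p - 1 - 1| * K₃ / κ with hk
  have hk0 : 0 ≤ k := by positivity
  set C₂ : ℝ := (k + 4 * k ^ 2 + 3 * k ^ 3) * 2 with hC₂
  have hC₂0 : 0 ≤ C₂ := by positivity
  refine ⟨k * 2 + C₂ / (|p| * κ) ^ 2, by positivity, ?_⟩
  intro τ ε μ η η' hε hμ hη hητ hη' hητ'
  have hε' : |ε| ≤ |p - 1| / (12 * |p|) := by
    rw [le_div_iff₀ (by positivity)]; linarith
  -- [a, b] is the set where both ξ and ξ + τ lie in [1/4, 9/4]. At each endpoint one of the two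
  -- cutoffs vanishes together with its derivative.
  set a : ℝ := max (1 / 4) (1 / 4 - τ) with ha
  set b : ℝ := min (9 / 4) (9 / 4 - τ) with hb
  have hmem : ∀ {ξ : ℝ}, ξ ∈ Set.Icc a b ↔ ξ ∈ Set.Icc (1 / 4 : ℝ) (9 / 4) ∧
      ξ + τ ∈ Set.Icc (1 / 4 : ℝ) (9 / 4) := by
    intro ξ
    simp only [Set.mem_Icc, ha, hb, max_le_iff, le_min_iff]
    constructor
    · rintro ⟨⟨h1, h2⟩, h3, h4⟩
      exact ⟨⟨h1, h3⟩, by linarith, by linarith⟩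
    · rintro ⟨⟨h1, h2⟩, h3, h4⟩
      exact ⟨⟨h1, by linarith⟩, h2, by linarith⟩
  set f : ℝ → ℂ := fun ξ => ((freqBump ξ * freqBump (ξ + τ) : ℝ) : ℂ) *
      osc (μ * mixedDiff p (1 - p) ε τ η η' ξ) with hf
  have hsupp : Function.support f ⊆ Set.Ioc a b := by
    intro ξ hξ
    have h1 : freqBump ξ ≠ 0 := by
      rintro h; exact hξ (by simp [hf, h])
    have h2 : freqBump (ξ + τ) ≠ 0 := by
      rintro h; exact hξ (by simp [hf, h])
    have h1' : ξ ∈ Set.Ioo (1 / 4 : ℝ) (9 / 4) := by rw [← support_freqBump]; exact h1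
    have h2' : ξ + τ ∈ Set.Ioo (1 / 4 : ℝ) (9 / 4) := by rw [← support_freqBump]; exact h2
    refine ⟨max_lt h1'.1 (by linarith [h2'.1]), le_min h1'.2.le (by linarith [h2'.2])⟩
  have hpos : 0 < 1 + (μ * τ * (η - η')) ^ 2 := by positivity
  rcases lt_or_ge b a with hab | hab
  · have : f = 0 := by
      rw [← Function.support_eq_empty_iff, ← Set.subset_empty_iff]
      exact hsupp.trans (by rw [Set.Ioc_eq_empty (by linarith)])
    have h0 : ∫ ξ, f ξ = 0 := by simp [this]
    change ‖∫ ξ, f ξ‖ ≤ _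
    rw [h0, norm_zero]
    positivity
  rw [← intervalIntegral.integral_eq_integral_of_support_subset hsupp]
  set h : ℝ → ℂ := fun ξ => ((freqBump ξ * freqBump (ξ + τ) : ℝ) : ℂ) with hh
  set h' : ℝ → ℂ := fun ξ => ((χ' ξ * freqBump (ξ + τ) + freqBump ξ * χ' (ξ + τ) : ℝ) : ℂ) with hh'
  set h'' : ℝ → ℂ := fun ξ => ((χ'' ξ * freqBump (ξ + τ) + χ' ξ * χ' (ξ + τ) +
    (χ' ξ * χ' (ξ + τ) + freqBump ξ * χ'' (ξ + τ)) : ℝ) : ℂ) with hh''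
  have hba : b - a ≤ 2 := by
    have := min_le_left (9 / 4) (9 / 4 - τ)
    have := le_max_left (1 / 4) (1 / 4 - τ)
    linarith
  have hχτ : ∀ ξ, HasDerivAt (fun ξ => freqBump (ξ + τ)) (χ' (ξ + τ)) ξ := fun ξ =>
    (hχ (ξ + τ)).comp_add_const ξ τ
  have hχτ' : ∀ ξ, HasDerivAt (fun ξ => χ' (ξ + τ)) (χ'' (ξ + τ)) ξ := fun ξ =>
    (hχ' (ξ + τ)).comp_add_const ξ τ
  have mulK : ∀ {x y : ℝ}, |x| ≤ K → |y| ≤ K → |x * y| ≤ K ^ 2 := fun hx hy => by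
    rw [abs_mul, sq]; gcongr
  have hkK : 4 * K ^ 2 ≤ k := by
    have : 0 ≤ |p - 1| * K₂ / κ + |p - 1| * |p - 1 - 1| * K₃ / κ := by positivity
    rw [hk]; linarith
  have bh : ∀ ξ, ‖h ξ‖ ≤ k := fun ξ => by
    simp only [hh, Complex.norm_real, Real.norm_eq_abs]
    have := mulK (hχK ξ) (hχK (ξ + τ))
    nlinarith [sq_nonneg K]
  have bh' : ∀ ξ, ‖h' ξ‖ ≤ k := fun ξ => by
    simp only [hh', Complex.norm_real, Real.norm_eq_abs]
    have h1 := mulK (hχ'K ξ) (hχK (ξ + τ))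
    have h2 := mulK (hχK ξ) (hχ'K (ξ + τ))
    have := abs_add_le (χ' ξ * freqBump (ξ + τ)) (freqBump ξ * χ' (ξ + τ))
    nlinarith [sq_nonneg K]
  have bh'' : ∀ ξ, ‖h'' ξ‖ ≤ k := fun ξ => by
    simp only [hh'', Complex.norm_real, Real.norm_eq_abs]
    have h1 := mulK (hχ''K ξ) (hχK (ξ + τ))
    have h2 := mulK (hχK ξ) (hχ''K (ξ + τ))
    have h3 := mulK (hχ'K ξ) (hχ'K (ξ + τ))
    have := abs_add_le (χ'' ξ * freqBump (ξ + τ)) (χ' ξ * χ' (ξ + τ))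
    have := abs_add_le (χ' ξ * χ' (ξ + τ)) (freqBump ξ * χ'' (ξ + τ))
    have := abs_add_le (χ'' ξ * freqBump (ξ + τ) + χ' ξ * χ' (ξ + τ))
      (χ' ξ * χ' (ξ + τ) + freqBump ξ * χ'' (ξ + τ))
    linarith
  have trivial_bound : ‖∫ ξ in a..b, f ξ‖ ≤ k * 2 := by
    have : ‖∫ ξ in a..b, f ξ‖ ≤ k * |b - a| := by
      refine intervalIntegral.norm_integral_le_of_norm_le_const fun ξ _ => ?_
      simp only [hf, norm_mul, norm_osc, mul_one]
      exact bh ξ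
    rw [abs_of_nonneg (sub_nonneg.2 hab)] at this
    exact this.trans (by gcongr)
  rcases eq_or_ne (τ * (η - η')) 0 with h0 | h0
  · rw [mul_assoc, h0]
    simp only [mul_zero, ne_eq, OfNat.ofNat_ne_zero, not_false_eq_true, zero_pow, add_zero, div_one]
    refine trivial_bound.trans ?_
    have : 0 ≤ C₂ / (|p| * κ) ^ 2 := by positivity
    linarith
  have hΔ : 0 < |τ * (η - η')| := abs_pos.2 h0
  set B : ℝ := |p| * (κ * |τ * (η - η')|) with hB
  have hBpos : 0 < B := by positivity
  have hend : ∀ {ξ : ℝ}, ξ ∉ Set.Ioo (1 / 4 : ℝ) (9 / 4) ∨ ξ + τ ∉ Set.Ioo (1 / 4 : ℝ) (9 / 4) →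
      h ξ = 0 ∧ h' ξ = 0 := by
    rintro ξ (hξ | hξ)
    · simp [hh, hh', freqBump_eq_zero hξ, hχ'0 _ hξ]
    · simp [hh, hh', freqBump_eq_zero hξ, hχ'0 _ hξ]
  have hea : h a = 0 ∧ h' a = 0 := by
    apply hend
    rcases max_cases (1 / 4) (1 / 4 - τ) with h | h
    · left; rw [ha, h.1]; simp
    · right; rw [ha, h.1]; simp
  have heb : h b = 0 ∧ h' b = 0 := by
    apply hend
    rcases min_cases (9 / 4) (9 / 4 - τ) with h | h
    · left; rw [hb, h.1]; simp
    · right; rw [hb, h.1]; simp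
  have hxpos : ∀ {ξ : ℝ}, ξ ∈ Set.Icc a b → 0 < ξ ∧ 0 < ξ + τ := fun hξ =>
    ⟨by linarith [(hmem.1 hξ).1.1], by linarith [(hmem.1 hξ).2.1]⟩
  have main := norm_integral_mul_osc_le_of_nonstationary_sq (K := k) (B := B) (N := μ)
    (h := h) (h' := h') (h'' := h'') (Q := mixedDiff p (1 - p) ε τ η η')
    (q := fun ξ => p * mixedDiff (p - 1) (1 - p) ε τ η η' ξ)
    (q' := fun ξ => p * ((p - 1) * mixedDiff (p - 1 - 1) (1 - p) ε τ η η' ξ))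
    (q'' := fun ξ => p * ((p - 1) * ((p - 1 - 1) *
      mixedDiff (p - 1 - 1 - 1) (1 - p) ε τ η η' ξ)))
    hab hBpos hμ
    (fun ξ _ => ((hχ ξ).mul (hχτ ξ)).ofReal_comp)
    (fun ξ _ => (((hχ' ξ).mul (hχτ ξ)).add ((hχ ξ).mul (hχτ' ξ))).ofReal_comp)
    (by
      have c0 : Continuous (freqBump : ℝ → ℝ) := freqBump.continuous
      have c1 : Continuous χ' := continuous_iff_continuousAt.2 fun x => (hχ' x).continuousAt
      exact (Complex.continuous_ofReal.comp (by fun_prop)).continuousOn)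
    hea.1 heb.1 hea.2 heb.2
    (fun ξ hξ => hasDerivAt_mixedDiff (hxpos hξ).1 (hxpos hξ).2)
    (fun ξ hξ => (hasDerivAt_mixedDiff (hxpos hξ).1 (hxpos hξ).2).const_mul p)
    (fun ξ hξ => ((hasDerivAt_mixedDiff (hxpos hξ).1 (hxpos hξ).2).const_mul _).const_mul p)
    (fun ξ hξ => ((((hasDerivAt_mixedDiff (hxpos hξ).1 (hxpos hξ).2).const_mul _).const_mul
      _).const_mul p).continuousAt.continuousWithinAt)
    (fun ξ hξ => by
      rw [abs_mul, hB]
      obtain ⟨h1, h2⟩ := hmem.1 hξ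
      exact mul_le_mul_of_nonneg_left (hlow hε h1 h2 hη hητ hη' hητ') hp.le)
    (fun ξ hξ => by
      obtain ⟨h1, h2⟩ := hmem.1 hξ
      have h3 := hup₂ hε' h1 h2 hη hητ hη' hητ'
      rw [abs_mul, abs_mul]
      calc _ ≤ |p| * (|p - 1| * (K₂ * |τ * (η - η')|)) := by gcongr
        _ = |p - 1| * K₂ / κ * B := by rw [hB]; field_simp
        _ ≤ _ := by
          refine mul_le_mul_of_nonneg_right ?_ hBpos.le
          have : 0 ≤ 4 * K ^ 2 + |p - 1| * |p - 1 - 1| * K₃ / κ := by positivity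
          rw [hk]; linarith)
    (fun ξ hξ => by
      obtain ⟨h1, h2⟩ := hmem.1 hξ
      have h3 := hup₃ hε' h1 h2 hη hητ hη' hητ'
      rw [abs_mul, abs_mul, abs_mul]
      calc _ ≤ |p| * (|p - 1| * (|p - 1 - 1| * (K₃ * |τ * (η - η')|))) := by gcongr
        _ = |p - 1| * |p - 1 - 1| * K₃ / κ * B := by rw [hB]; field_simp
        _ ≤ _ := by
          refine mul_le_mul_of_nonneg_right ?_ hBpos.le
          have : 0 ≤ 4 * K ^ 2 + |p - 1| * K₂ / κ := by positivity
          rw [hk]; linarith)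
    (fun ξ _ => bh ξ) (fun ξ _ => bh' ξ) (fun ξ _ => bh'' ξ)
  have main' : ‖∫ ξ in a..b, f ξ‖ ≤ C₂ / (μ * B) ^ 2 := by
    refine main.trans ?_
    exact div_le_div_of_nonneg_right
      (mul_le_mul_of_nonneg_left hba (by positivity)) (by positivity)
  -- The 1 in the denominator is paid by the trivial bound, the square by the two integrations by
  -- parts.
  rw [le_div_iff₀ hpos, mul_add, mul_one]
  refine add_le_add trivial_bound ?_
  have e : (μ * τ * (η - η')) ^ 2 = (μ * B) ^ 2 / (|p| * κ) ^ 2 := by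
    rw [eq_div_iff (by positivity)]
    have : (|τ * (η - η')|) ^ 2 = (τ * (η - η')) ^ 2 := sq_abs _
    rw [hB]
    linear_combination (-(μ ^ 2 * (|p| * κ) ^ 2)) * this
  rw [e]
  calc _ ≤ C₂ / (μ * B) ^ 2 * ((μ * B) ^ 2 / (|p| * κ) ^ 2) := by gcongr
    _ = _ := by
      have : (μ * B) ^ 2 ≠ 0 := by positivity
      field_simp

/-! ### `L²` bounds for oscillatory operators -/

section CauchySchwarz

variable {α : Type*} [MeasurableSpace α] {ν : Measure α}

theorem lintegral_mul_le_sqrt_mul_sqrt {f g : α → ℝ≥0∞} (hf : AEMeasurable f ν)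
    (hg : AEMeasurable g ν) :
    ∫⁻ x, f x * g x ∂ν ≤ (∫⁻ x, f x ^ 2 ∂ν) ^ (1 / 2 : ℝ) * (∫⁻ x, g x ^ 2 ∂ν) ^ (1 / 2 : ℝ) := by
  have := ENNReal.lintegral_mul_le_Lp_mul_Lq ν Real.HolderConjugate.two_two hf hg
  simpa [ENNReal.rpow_two] using this

theorem ENNReal.sqrt_sq (a : ℝ≥0∞) : (a ^ (1 / 2 : ℝ)) ^ 2 = a := by
  rw [← ENNReal.rpow_two, ← ENNReal.rpow_mul]; norm_num

theorem ENNReal.sqrt_of_sq (a : ℝ≥0∞) : (a ^ 2) ^ (1 / 2 : ℝ) = a := by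
  rw [← ENNReal.rpow_two, ← ENNReal.rpow_mul]; norm_num

theorem sq_lintegral_mul_le {f g : α → ℝ≥0∞} (hf : AEMeasurable f ν) (hg : AEMeasurable g ν) :
    (∫⁻ x, f x * g x ∂ν) ^ 2 ≤ (∫⁻ x, f x ^ 2 ∂ν) * ∫⁻ x, g x ^ 2 ∂ν := by
  calc _ ≤ ((∫⁻ x, f x ^ 2 ∂ν) ^ (1 / 2 : ℝ) * (∫⁻ x, g x ^ 2 ∂ν) ^ (1 / 2 : ℝ)) ^ 2 := by
        gcongr; exact lintegral_mul_le_sqrt_mul_sqrt hf hg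
    _ = _ := by rw [mul_pow, ENNReal.sqrt_sq, ENNReal.sqrt_sq]

theorem sq_setLIntegral_le {f : α → ℝ≥0∞} {s : Set α} (hf : AEMeasurable f ν) :
    (∫⁻ x in s, f x ∂ν) ^ 2 ≤ ν s * ∫⁻ x, f x ^ 2 ∂ν := by
  have := sq_lintegral_mul_le (ν := ν.restrict s) (f := fun _ => 1) aemeasurable_const hf.restrict
  simp only [one_mul, one_pow, lintegral_const, Measure.restrict_apply, MeasurableSet.univ,
    Set.univ_inter] at this
  refine this.trans ?_
  gcongr
  exact Measure.restrict_le_self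

end CauchySchwarz

/-- The square of the `L²` norm. -/
noncomputable def energy (u : ℝ → ℂ) : ℝ≥0∞ := ∫⁻ x, ‖u x‖ₑ ^ 2

theorem integrable_of_energy {u : ℝ → ℂ} (hu : Measurable u) (hE : energy u ≠ ⊤) {a b : ℝ}
    (hs : ∀ x, u x ≠ 0 → x ∈ Set.Icc a b) : Integrable u := by
  refine ⟨hu.aestronglyMeasurable, ?_⟩
  have h1 : ∫⁻ x, ‖u x‖ₑ = ∫⁻ x in Set.Icc a b, ‖u x‖ₑ := by
    rw [← lintegral_indicator measurableSet_Icc]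
    refine lintegral_congr fun x => ?_
    by_cases hx : x ∈ Set.Icc a b
    · simp [hx]
    · have : u x = 0 := by by_contra h; exact hx (hs x h)
      simp [this, hx]
  have h2 := sq_setLIntegral_le (ν := volume) (s := Set.Icc a b) (f := fun x => ‖u x‖ₑ)
    hu.enorm.aemeasurable
  rw [← h1] at h2
  have h3 : (∫⁻ x, ‖u x‖ₑ) ^ 2 < ⊤ :=
    h2.trans_lt (ENNReal.mul_lt_top (by simp) (lt_top_iff_ne_top.2 hE))
  rw [hasFiniteIntegral_iff_enorm]
  simpa using h3

/-- Schur's test for a convolution kernel. -/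
theorem lintegral_prod_mul_kernel_le {V k : ℝ → ℝ≥0∞} (hV : Measurable V) (hk : Measurable k) :
    ∫⁻ z : ℝ × ℝ, V z.1 * V z.2 * k (z.1 - z.2) ≤ 2 * (∫⁻ x, k x) * ∫⁻ x, V x ^ 2 := by
  have hab : ∀ a b : ℝ≥0∞, a * b ≤ a ^ 2 + b ^ 2 := by
    intro a b
    rcases le_total a b with h | h
    · calc a * b ≤ b * b := by gcongr
        _ ≤ _ := by rw [← sq]; exact le_add_self
    · calc a * b ≤ a * a := by gcongr
        _ ≤ _ := by rw [← sq]; exact le_self_add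
  calc _ ≤ ∫⁻ z : ℝ × ℝ, (V z.1 ^ 2 * k (z.1 - z.2) + V z.2 ^ 2 * k (z.1 - z.2)) := by
        refine lintegral_mono fun z => ?_
        rw [← add_mul]
        gcongr
        exact hab _ _
    _ = (∫⁻ z : ℝ × ℝ, V z.1 ^ 2 * k (z.1 - z.2)) + ∫⁻ z : ℝ × ℝ, V z.2 ^ 2 * k (z.1 - z.2) :=
        lintegral_add_left (by fun_prop) _
    _ = (∫⁻ x, k x) * (∫⁻ x, V x ^ 2) + (∫⁻ x, k x) * ∫⁻ x, V x ^ 2 := by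
        congr 1
        · rw [Measure.volume_eq_prod, lintegral_prod _ (by fun_prop)]
          have : ∀ x, ∫⁻ y, V x ^ 2 * k (x - y) = V x ^ 2 * ∫⁻ x, k x := fun x => by
            rw [lintegral_const_mul _ (by fun_prop), lintegral_sub_left_eq_self]
          simp only [this]
          rw [lintegral_mul_const _ (by fun_prop), mul_comm]
        · rw [Measure.volume_eq_prod, lintegral_prod_symm _ (by fun_prop)]
          have : ∀ y, ∫⁻ x, V y ^ 2 * k (x - y) = V y ^ 2 * ∫⁻ x, k x := fun y => by
            rw [lintegral_const_mul _ (by fun_prop), lintegral_sub_right_eq_self]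
          simp only [this]
          rw [lintegral_mul_const _ (by fun_prop), mul_comm]
    _ = _ := by ring

theorem lintegral_ofReal_div_one_add_sq {C a : ℝ} (hC : 0 ≤ C) (ha : a ≠ 0) :
    ∫⁻ x : ℝ, ENNReal.ofReal (C / (1 + (a * x) ^ 2)) = ENNReal.ofReal (C * Real.pi / |a|) := by
  have hi : Integrable fun x : ℝ => C / (1 + (a * x) ^ 2) := by
    have := (integrable_inv_one_add_sq.comp_mul_left' ha).const_mul C
    simpa [div_eq_mul_inv] using this
  rw [← ofReal_integral_eq_lintegral_ofReal hi
    (Filter.Eventually.of_forall fun x => by positivity)]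
  congr 1
  have h1 := Measure.integral_comp_mul_left (fun x : ℝ => C * (1 + x ^ 2)⁻¹) a
  simp only [div_eq_mul_inv]
  rw [h1, integral_const_mul, integral_univ_inv_one_add_sq, abs_inv, smul_eq_mul]
  ring

/-- The increment of the phase `ξ ^ p * η ^ (1 - p)` along the shift `(τ, -ετ)`. -/
noncomputable def phaseDiff (p ε τ ξ η : ℝ) : ℝ :=
  (ξ + τ) ^ p * (η - ε * τ) ^ (1 - p) - ξ ^ p * η ^ (1 - p)

theorem phaseDiff_sub (p ε τ ξ η η' : ℝ) :
    phaseDiff p ε τ ξ η - phaseDiff p ε τ ξ η' = mixedDiff p (1 - p) ε τ η η' ξ := rfl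

theorem measurable_phaseDiff (p ε τ : ℝ) :
    Measurable fun z : ℝ × ℝ => phaseDiff p ε τ z.1 z.2 := by
  unfold phaseDiff; fun_prop

/-- TT*: expand the square, integrate in ξ first, and apply Schur's test to the kernel C/(1 + (μτ(η
- η'))²), whose integral is Cπ/(μ|τ|). -/
theorem exists_lintegral_sq_oscillatory_le {p : ℝ} (hp0 : p ≠ 0) (hp1 : p ≠ 1) :
    ∃ C : ℝ, 0 ≤ C ∧ ∀ {τ ε μ : ℝ} {V : ℝ → ℂ}, 12 * (|ε| * |p|) ≤ |p - 1| → 0 < μ → τ ≠ 0 →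
    Measurable V → (∀ η, V η ≠ 0 → η ∈ Set.Icc (1 / 2 : ℝ) 2 ∧ η - ε * τ ∈ Set.Icc (1 / 2 : ℝ) 2) →
    ∫⁻ ξ in {ξ | ξ ∈ Set.Icc (1 / 2 : ℝ) 2 ∧ ξ + τ ∈ Set.Icc (1 / 2 : ℝ) 2},
      ‖∫ η, V η * osc (μ * phaseDiff p ε τ ξ η)‖ₑ ^ 2 ≤
      ENNReal.ofReal (C / (μ * |τ|)) * energy V := by
  obtain ⟨C, hC, hker⟩ := exists_norm_integral_osc_mixedDiff_le hp0 hp1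
  -- The extra 1 makes the constant positive, so that the right side is infinite when `energy V` is.
  refine ⟨2 * (C * Real.pi) + 1, by positivity, ?_⟩
  intro τ ε μ V hε hμ hτ hV hVs
  have hτ' : 0 < |τ| := abs_pos.2 hτ
  by_cases hE : energy V = ⊤
  · rw [hE, ENNReal.mul_top]
    · exact le_top
    · rw [Ne, ENNReal.ofReal_eq_zero, not_le]; positivity
  have hVi : Integrable V := integrable_of_energy hV hE fun η hη => (hVs η hη).1
  -- This smooth weight is 1 on the set of integration. It replaces the sharp restriction, which
  -- would not allow two integrations by parts.
  set w : ℝ → ℝ := fun ξ => freqBump ξ * freqBump (ξ + τ) with hw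
  have hw0 : ∀ ξ, 0 ≤ w ξ := fun ξ => mul_nonneg freqBump.nonneg freqBump.nonneg
  have hwc : Continuous w := by
    have c0 : Continuous (freqBump : ℝ → ℝ) := freqBump.continuous
    fun_prop
  have hwi : Integrable fun ξ => (w ξ : ℂ) := by
    refine Integrable.ofReal (hwc.integrable_of_hasCompactSupport ?_)
    exact freqBump.hasCompactSupport.mul_right
  set S : ℝ → ℂ := fun ξ => ∫ η, V η * osc (μ * phaseDiff p ε τ ξ η) with hS
  set g : ℝ → ℝ := fun ξ => w ξ * ‖S ξ‖ ^ 2 with hg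
  have hmp := measurable_phaseDiff p ε τ
  set F : ℝ → ℝ × ℝ → ℂ := fun ξ z => (w ξ : ℂ) * ((V z.1 * starRingEnd ℂ (V z.2)) *
    osc (μ * mixedDiff p (1 - p) ε τ z.1 z.2 ξ)) with hF
  have hVV : Integrable (fun z : ℝ × ℝ => V z.1 * starRingEnd ℂ (V z.2))
      (volume.prod volume) :=
    hVi.mul_prod (g := fun η => starRingEnd ℂ (V η)) ((Complex.conjLIE : ℂ →L[ℝ] ℂ).integrable_comp hVi)
  have hmF : Measurable fun y : ℝ × ℝ × ℝ =>
      osc (μ * mixedDiff p (1 - p) ε τ y.2.1 y.2.2 y.1) := by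
    unfold mixedDiff; fun_prop
  have hFi : Integrable (Function.uncurry F) (volume.prod (volume.prod volume)) := by
    have h1 : Integrable (fun y : ℝ × ℝ × ℝ => (w y.1 : ℂ) *
        (V y.2.1 * starRingEnd ℂ (V y.2.2))) (volume.prod (volume.prod volume)) :=
      hwi.mul_prod hVV
    have h2 := h1.mul_bdd (c := 1) hmF.aestronglyMeasurable
      (Filter.Eventually.of_forall fun y => (norm_osc _).le)
    refine h2.congr (Filter.Eventually.of_forall fun y => ?_)
    simp only [hF, Function.uncurry]
    ring
  have hgF : ∀ ξ, ((g ξ : ℝ) : ℂ) = ∫ z : ℝ × ℝ, F ξ z ∂(volume.prod volume) := by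
    intro ξ
    have e1 : ∀ z : ℝ × ℝ, F ξ z = (w ξ : ℂ) * ((V z.1 * osc (μ * phaseDiff p ε τ ξ z.1)) *
        starRingEnd ℂ (V z.2 * osc (μ * phaseDiff p ε τ ξ z.2))) := by
      intro z
      simp only [hF, map_mul, conj_osc]
      rw [← phaseDiff_sub, mul_sub, sub_eq_add_neg, osc_add]
      ring
    simp only [e1]
    rw [integral_const_mul, integral_prod_mul (fun η => V η * osc (μ * phaseDiff p ε τ ξ η))
      (fun η => starRingEnd ℂ (V η * osc (μ * phaseDiff p ε τ ξ η))), integral_conj,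
      Complex.mul_conj]
    simp only [hg, hS, Complex.normSq_eq_norm_sq]
    push_cast
    rfl
  have hgi : Integrable g := by
    have h1 := hFi.integral_prod_left
    have h2 : Integrable (fun ξ => ((g ξ : ℝ) : ℂ)) :=
      h1.congr (Filter.Eventually.of_forall fun ξ => (hgF ξ).symm)
    simpa using h2.re
  have hSm : Measurable S := by
    refine (StronglyMeasurable.integral_prod_right (f := fun ξ η =>
      V η * osc (μ * phaseDiff p ε τ ξ η)) ?_).measurable
    refine Measurable.stronglyMeasurable ?_
    exact (hV.comp measurable_snd).mul (measurable_osc.comp (hmp.const_mul μ))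
  have step1 : ∫⁻ ξ in {ξ | ξ ∈ Set.Icc (1 / 2 : ℝ) 2 ∧ ξ + τ ∈ Set.Icc (1 / 2 : ℝ) 2},
      ‖S ξ‖ₑ ^ 2 ≤ ∫⁻ ξ, ENNReal.ofReal (g ξ) := by
    refine le_trans (setLIntegral_mono' ?_ fun ξ hξ => ?_) (setLIntegral_le_lintegral _ _)
    · exact measurableSet_Icc.inter ((measurable_id.add_const τ) measurableSet_Icc)
    · have : w ξ = 1 := by simp [hw, freqBump_eq_one hξ.1, freqBump_eq_one hξ.2]
      simp only [hg, this, one_mul]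
      rw [ENNReal.ofReal_pow (norm_nonneg _), ofReal_norm]
  have step2 : ∫⁻ ξ, ENNReal.ofReal (g ξ) = ‖∫ z : ℝ × ℝ, ∫ ξ, F ξ z‖ₑ := by
    rw [← ofReal_integral_eq_lintegral_ofReal hgi
      (Filter.Eventually.of_forall fun ξ => mul_nonneg (hw0 ξ) (by positivity))]
    rw [Measure.volume_eq_prod, ← integral_integral_swap hFi]
    simp only [← hgF]
    rw [integral_complex_ofReal, ← ofReal_norm, Complex.norm_real, Real.norm_of_nonneg]
    exact integral_nonneg fun ξ => mul_nonneg (hw0 ξ) (by positivity)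
  set k : ℝ → ℝ≥0∞ := fun x => ENNReal.ofReal (C / (1 + (μ * τ * x) ^ 2)) with hk
  have step3 : ‖∫ z : ℝ × ℝ, ∫ ξ, F ξ z‖ₑ ≤
      ∫⁻ z : ℝ × ℝ, ‖V z.1‖ₑ * ‖V z.2‖ₑ * k (z.1 - z.2) := by
    refine (enorm_integral_le_lintegral_enorm _).trans (lintegral_mono fun z => ?_)
    have e : ∫ ξ, F ξ z = (V z.1 * starRingEnd ℂ (V z.2)) * ∫ ξ, (w ξ : ℂ) *
        osc (μ * mixedDiff p (1 - p) ε τ z.1 z.2 ξ) := by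
      rw [← integral_const_mul]
      refine integral_congr_ae (Filter.Eventually.of_forall fun ξ => ?_)
      simp only [hF]
      ring
    simp only [e, enorm_mul, RCLike.enorm_conj]
    by_cases h1 : V z.1 = 0
    · simp [h1]
    by_cases h2 : V z.2 = 0
    · simp [h2]
    gcongr
    rw [← ofReal_norm]
    refine ENNReal.ofReal_le_ofReal ?_
    exact hker hε hμ (hVs _ h1).1 (hVs _ h1).2 (hVs _ h2).1 (hVs _ h2).2
  have step4 := lintegral_prod_mul_kernel_le (V := fun η => ‖V η‖ₑ) (k := k) hV.enorm
    (by fun_prop)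
  rw [hk, lintegral_ofReal_div_one_add_sq hC (mul_ne_zero hμ.ne' hτ)] at step4
  refine (step1.trans (step2.le.trans (step3.trans step4))).trans ?_
  unfold energy
  gcongr
  rw [show (2 : ℝ≥0∞) = ENNReal.ofReal 2 by simp, ← ENNReal.ofReal_mul (by norm_num)]
  refine ENNReal.ofReal_le_ofReal ?_
  rw [abs_mul, abs_of_pos hμ, ← mul_div_assoc]
  gcongr
  linarith

/-! ### The bilinear operator with a symbol -/

/-- The bilinear operator with symbol `M`, on the frequency side: frequencies `ξ` and `η` interact
into the frequency `ζ = εξ + η`. -/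
noncomputable def bilinSymbol (M : ℝ → ℝ → ℂ) (ε : ℝ) (u v : ℝ → ℂ) (ζ : ℝ) : ℂ :=
  ∫ ξ, u ξ * v (ζ - ε * ξ) * M ξ (ζ - ε * ξ)

/-- Functions supported in `[1/2, 2]`. -/
def FreqSupp (u : ℝ → ℂ) : Prop := ∀ x, u x ≠ 0 → x ∈ Set.Icc (1 / 2 : ℝ) 2

/-- Cauchy–Schwarz in ξ on the bounded support of u, then Tonelli and translation invariance in ζ.
No power of ε is lost. -/
theorem lintegral_sq_lintegral_le (ε : ℝ) {u v : ℝ → ℂ} (hu : Measurable u) (hv : Measurable v)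
    (hus : FreqSupp u) :
    ∫⁻ ζ, (∫⁻ ξ, ‖u ξ‖ₑ * ‖v (ζ - ε * ξ)‖ₑ) ^ 2 ≤ 2 * (energy u * energy v) := by
  have h1 : ∀ ζ, (∫⁻ ξ, ‖u ξ‖ₑ * ‖v (ζ - ε * ξ)‖ₑ) ^ 2 ≤
      2 * ∫⁻ ξ, ‖u ξ‖ₑ ^ 2 * ‖v (ζ - ε * ξ)‖ₑ ^ 2 := by
    intro ζ
    have e : ∫⁻ ξ, ‖u ξ‖ₑ * ‖v (ζ - ε * ξ)‖ₑ =
        ∫⁻ ξ in Set.Icc (1 / 2 : ℝ) 2, ‖u ξ‖ₑ * ‖v (ζ - ε * ξ)‖ₑ := by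
      rw [← lintegral_indicator measurableSet_Icc]
      refine lintegral_congr fun x => ?_
      by_cases hx : x ∈ Set.Icc (1 / 2 : ℝ) 2
      · rw [Set.indicator_of_mem hx]
      · have : u x = 0 := by by_contra h; exact hx (hus x h)
        rw [Set.indicator_of_notMem hx, this, enorm_zero, zero_mul]
    rw [e]
    refine (sq_setLIntegral_le (by fun_prop)).trans ?_
    simp only [mul_pow]
    gcongr
    rw [Real.volume_Icc, show (2 : ℝ≥0∞) = ENNReal.ofReal 2 by simp]
    exact ENNReal.ofReal_le_ofReal (by norm_num)
  calc _ ≤ ∫⁻ ζ, 2 * ∫⁻ ξ, ‖u ξ‖ₑ ^ 2 * ‖v (ζ - ε * ξ)‖ₑ ^ 2 := lintegral_mono h1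
    _ = 2 * ∫⁻ ζ, ∫⁻ ξ, ‖u ξ‖ₑ ^ 2 * ‖v (ζ - ε * ξ)‖ₑ ^ 2 := by
        rw [lintegral_const_mul]
        exact Measurable.lintegral_prod_right' (f := fun z : ℝ × ℝ =>
          ‖u z.2‖ₑ ^ 2 * ‖v (z.1 - ε * z.2)‖ₑ ^ 2) (by fun_prop)
    _ = 2 * ∫⁻ ξ, ∫⁻ ζ, ‖u ξ‖ₑ ^ 2 * ‖v (ζ - ε * ξ)‖ₑ ^ 2 := by
        rw [lintegral_lintegral_swap (by fun_prop)]
    _ = 2 * ∫⁻ ξ, ‖u ξ‖ₑ ^ 2 * energy v := by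
        congr 2
        ext ξ
        rw [lintegral_const_mul _ (by fun_prop),
          lintegral_sub_right_eq_self (fun ζ => ‖v ζ‖ₑ ^ 2)]
        rfl
    _ = _ := by rw [lintegral_mul_const _ (by fun_prop)]; rfl

/-- The bound of the bilinear operator by the supremum of its symbol. -/
theorem energy_bilinSymbol_le_of_bounded {M : ℝ → ℝ → ℂ} {ε : ℝ} {K : ℝ≥0∞} {u v : ℝ → ℂ}
    (hu : Measurable u) (hv : Measurable v) (hus : FreqSupp u) (hvs : FreqSupp v)
    (hM : ∀ ξ ∈ Set.Icc (1 / 2 : ℝ) 2, ∀ η ∈ Set.Icc (1 / 2 : ℝ) 2, ‖M ξ η‖ₑ ≤ K) :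
    energy (bilinSymbol M ε u v) ≤ 2 * K ^ 2 * (energy u * energy v) := by
  have h1 : ∀ ζ, ‖bilinSymbol M ε u v ζ‖ₑ ^ 2 ≤
      K ^ 2 * (∫⁻ ξ, ‖u ξ‖ₑ * ‖v (ζ - ε * ξ)‖ₑ) ^ 2 := by
    intro ζ
    rw [← mul_pow]
    gcongr
    rw [← lintegral_const_mul _ (by fun_prop)]
    refine (enorm_integral_le_lintegral_enorm _).trans (lintegral_mono fun ξ => ?_)
    simp only [enorm_mul]
    by_cases h1 : u ξ = 0
    · simp [h1]
    by_cases h2 : v (ζ - ε * ξ) = 0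
    · simp [h2]
    rw [mul_comm K]
    gcongr
    exact hM _ (hus _ h1) _ (hvs _ h2)
  calc _ ≤ ∫⁻ ζ, K ^ 2 * (∫⁻ ξ, ‖u ξ‖ₑ * ‖v (ζ - ε * ξ)‖ₑ) ^ 2 := lintegral_mono h1
    _ = K ^ 2 * ∫⁻ ζ, (∫⁻ ξ, ‖u ξ‖ₑ * ‖v (ζ - ε * ξ)‖ₑ) ^ 2 := by
        rw [lintegral_const_mul]
        exact (Measurable.lintegral_prod_right' (f := fun z : ℝ × ℝ =>
          ‖u z.2‖ₑ * ‖v (z.1 - ε * z.2)‖ₑ) (by fun_prop)).pow_const 2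
    _ ≤ K ^ 2 * (2 * (energy u * energy v)) := by
        gcongr; exact lintegral_sq_lintegral_le ε hu hv hus
    _ = _ := by ring

/-- Expansion of the energy of the bilinear operator with symbol `e^{iμ ξ^p η^(1-p)}`. -/
theorem energy_bilinSymbol_osc_le (p : ℝ) {ε μ : ℝ} {u v : ℝ → ℂ}
    (hu : Measurable u) (hv : Measurable v) (hus : FreqSupp u)
    (hEu : energy u ≠ ⊤) (hEv : energy v ≠ ⊤) :
    energy (bilinSymbol (fun ξ η => osc (μ * (ξ ^ p * η ^ (1 - p)))) ε u v) ≤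
      ∫⁻ τ, ‖∫ ξ, (starRingEnd ℂ (u ξ) * u (ξ + τ)) *
        ∫ η, (starRingEnd ℂ (v η) * v (η - ε * τ)) * osc (μ * phaseDiff p ε τ ξ η)‖ₑ := by
  set X : ℝ → ℝ → ℂ := fun ζ ξ => u ξ * v (ζ - ε * ξ) *
    osc (μ * (ξ ^ p * (ζ - ε * ξ) ^ (1 - p))) with hX
  set T : ℝ → ℂ := fun ζ => ∫ ξ, X ζ ξ with hT
  have hXm : Measurable (Function.uncurry X) := by
    simp only [hX, Function.uncurry_def]
    fun_prop
  set Y : ℝ → ℝ × ℝ → ℂ := fun ζ z => starRingEnd ℂ (X ζ z.1) * X ζ z.2 with hY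
  have hYm : Measurable (Function.uncurry Y) := by
    have h1 : Measurable fun y : ℝ × ℝ × ℝ => X y.1 y.2.1 :=
      hXm.comp (measurable_fst.prodMk (measurable_fst.comp measurable_snd))
    have h2 : Measurable fun y : ℝ × ℝ × ℝ => X y.1 y.2.2 :=
      hXm.comp (measurable_fst.prodMk (measurable_snd.comp measurable_snd))
    exact (Complex.continuous_conj.measurable.comp h1).mul h2
  have hYi : Integrable (Function.uncurry Y) (volume.prod (volume.prod volume)) := by
    refine ⟨hYm.aestronglyMeasurable, ?_⟩
    rw [hasFiniteIntegral_iff_enorm, lintegral_prod _ hYm.enorm.aemeasurable]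
    have h1 : ∀ ζ, ∫⁻ z : ℝ × ℝ, ‖Y ζ z‖ₑ ∂(volume.prod volume) =
        (∫⁻ ξ, ‖u ξ‖ₑ * ‖v (ζ - ε * ξ)‖ₑ) ^ 2 := by
      intro ζ
      have e : ∀ z : ℝ × ℝ, ‖Y ζ z‖ₑ = (‖u z.1‖ₑ * ‖v (ζ - ε * z.1)‖ₑ) *
          (‖u z.2‖ₑ * ‖v (ζ - ε * z.2)‖ₑ) := by
        intro z
        simp only [hY, hX, enorm_mul, RCLike.enorm_conj, enorm_osc, mul_one]
      simp only [e]
      rw [lintegral_prod_mul (f := fun ξ => ‖u ξ‖ₑ * ‖v (ζ - ε * ξ)‖ₑ)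
        (g := fun ξ => ‖u ξ‖ₑ * ‖v (ζ - ε * ξ)‖ₑ) (by fun_prop) (by fun_prop), sq]
    simp only [Function.uncurry, h1]
    refine (lintegral_sq_lintegral_le ε hu hv hus).trans_lt ?_
    exact ENNReal.mul_lt_top (by simp)
      (ENNReal.mul_lt_top (lt_top_iff_ne_top.2 hEu) (lt_top_iff_ne_top.2 hEv))
  have hTY : ∀ ζ, ((‖T ζ‖ ^ 2 : ℝ) : ℂ) = ∫ z, Y ζ z ∂(volume.prod volume) := by
    intro ζ
    simp only [hY]
    rw [integral_prod_mul (fun ξ => starRingEnd ℂ (X ζ ξ)) (X ζ), integral_conj, mul_comm,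
      Complex.mul_conj, Complex.normSq_eq_norm_sq]
  have hTi : Integrable fun ζ => ‖T ζ‖ ^ 2 := by
    have h2 : Integrable (fun ζ => ((‖T ζ‖ ^ 2 : ℝ) : ℂ)) :=
      hYi.integral_prod_left.congr (Filter.Eventually.of_forall fun ζ => (hTY ζ).symm)
    exact h2.re.congr (Filter.Eventually.of_forall fun ζ => Complex.ofReal_re _)
  set K : ℝ × ℝ → ℂ := fun z => ∫ ζ, Y ζ z with hK
  have hKi : Integrable K (volume.prod volume) := hYi.integral_prod_right
  have step1 : energy T = ‖∫ z, K z ∂(volume.prod volume)‖ₑ := by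
    have e1 : energy T = ∫⁻ ζ, ENNReal.ofReal (‖T ζ‖ ^ 2) := by
      refine lintegral_congr fun ζ => ?_
      rw [ENNReal.ofReal_pow (norm_nonneg _), ofReal_norm]
    rw [e1, ← ofReal_integral_eq_lintegral_ofReal hTi
      (Filter.Eventually.of_forall fun ζ => by positivity)]
    simp only [hK]
    rw [← integral_integral_swap hYi]
    simp only [← hTY]
    rw [integral_complex_ofReal, ← ofReal_norm, Complex.norm_real, Real.norm_of_nonneg]
    exact integral_nonneg fun ζ => by positivity
  -- Substitution ξ' = ξ + τ in the double integral, followed below by ζ = η + εξ; then v at ζ - εξ'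
  -- becomes v at η - ετ.
  have hmp : MeasurePreserving (fun z : ℝ × ℝ => (z.1, z.1 + z.2)) (volume.prod volume)
      (volume.prod volume) := measurePreserving_prod_add volume volume
  have hKi' : Integrable (fun z : ℝ × ℝ => K (z.1, z.1 + z.2)) (volume.prod volume) :=
    hmp.integrable_comp_of_integrable hKi
  have step2 : ∫ z, K z ∂(volume.prod volume) = ∫ τ, ∫ ξ, K (ξ, ξ + τ) := by
    rw [integral_prod _ hKi]
    have : ∀ ξ, ∫ ξ', K (ξ, ξ') = ∫ τ, K (ξ, ξ + τ) := fun ξ =>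
      (integral_add_left_eq_self (fun ξ' => K (ξ, ξ')) ξ).symm
    simp only [this]
    exact integral_integral_swap (f := fun ξ τ => K (ξ, ξ + τ)) hKi'
  change energy T ≤ _
  rw [step1, step2]
  refine (enorm_integral_le_lintegral_enorm _).trans (lintegral_mono fun τ => le_of_eq ?_)
  congr 1
  refine integral_congr_ae (Filter.Eventually.of_forall fun ξ => ?_)
  simp only [hK]
  rw [← integral_add_right_eq_self _ (ε * ξ), ← integral_const_mul]
  refine integral_congr_ae (Filter.Eventually.of_forall fun η => ?_)
  simp only [hY, hX, map_mul, conj_osc, phaseDiff]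
  rw [show η + ε * ξ - ε * ξ = η by ring, show η + ε * ξ - ε * (ξ + τ) = η - ε * τ by ring,
    mul_sub, osc_sub]
  ring

theorem lintegral_comp_mul_left {f : ℝ → ℝ≥0∞} (hf : Measurable f) {a : ℝ} (ha : a ≠ 0) :
    ∫⁻ x, f (a * x) = ENNReal.ofReal |a|⁻¹ * ∫⁻ x, f x := by
  rw [← lintegral_map hf (by fun_prop), Real.map_volume_mul_left ha, lintegral_smul_measure,
    abs_inv, smul_eq_mul]

/-- This is the source of the loss in ε: as τ varies, the shift ετ sweeps the line at speed |ε|. -/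
theorem lintegral_lintegral_mul_shift {ε : ℝ} (hε : ε ≠ 0) {f : ℝ → ℝ≥0∞} (hf : Measurable f) :
    ∫⁻ τ, ∫⁻ x, f x * f (x - ε * τ) = ENNReal.ofReal |ε|⁻¹ * (∫⁻ x, f x) ^ 2 := by
  rw [lintegral_lintegral_swap (by fun_prop)]
  have h : ∀ x, ∫⁻ τ, f x * f (x - ε * τ) = f x * (ENNReal.ofReal |ε|⁻¹ * ∫⁻ y, f y) := by
    intro x
    rw [lintegral_const_mul _ (by fun_prop),
      lintegral_comp_mul_left (f := fun y => f (x - y)) (by fun_prop) hε,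
      lintegral_sub_left_eq_self]
  simp only [h]
  rw [lintegral_mul_const _ hf]
  ring

theorem lintegral_mul_shift_le {u : ℝ → ℂ} (hu : Measurable u) (a : ℝ) :
    ∫⁻ x, ‖starRingEnd ℂ (u x) * u (x + a)‖ₑ ≤ energy u := by
  simp only [enorm_mul, RCLike.enorm_conj]
  refine (lintegral_mul_le_sqrt_mul_sqrt (by fun_prop) (by fun_prop)).trans ?_
  rw [lintegral_add_right_eq_self (fun x => ‖u x‖ₑ ^ 2), ← sq, ENNReal.sqrt_sq]
  rfl

/-- The `L² × L² → L²` bound for the bilinear operator with symbol `e^{iμ ξ^p η^(1-p)}`. -/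
theorem exists_energy_bilinSymbol_osc_le {p : ℝ} (hp0 : p ≠ 0) (hp1 : p ≠ 1) :
    ∃ C : ℝ, 0 ≤ C ∧ ∀ {ε μ τ₀ : ℝ} {u v : ℝ → ℂ}, ε ≠ 0 → 12 * (|ε| * |p|) ≤ |p - 1| → 0 < μ →
    0 < τ₀ → Measurable u → Measurable v → FreqSupp u → FreqSupp v →
    energy u ≠ ⊤ → energy v ≠ ⊤ →
    energy (bilinSymbol (fun ξ η => osc (μ * (ξ ^ p * η ^ (1 - p)))) ε u v) ≤
      ENNReal.ofReal (C * (τ₀ + √(1 / (|ε| * μ * τ₀)))) * (energy u * energy v) := by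
  obtain ⟨C, hC, hT⟩ := exists_lintegral_sq_oscillatory_le hp0 hp1
  refine ⟨2 + √C, by positivity, ?_⟩
  intro ε μ τ₀ u v hε hεp hμ hτ₀ hu hv hus hvs hEu hEv
  refine (energy_bilinSymbol_osc_le p hu hv hus hEu hEv).trans ?_
  set U : ℝ → ℝ → ℂ := fun τ ξ => starRingEnd ℂ (u ξ) * u (ξ + τ) with hU
  set V : ℝ → ℝ → ℂ := fun τ η => starRingEnd ℂ (v η) * v (η - ε * τ) with hV
  set J : ℝ → ℝ≥0∞ := fun τ => ‖∫ ξ, U τ ξ * ∫ η, V τ η * osc (μ * phaseDiff p ε τ ξ η)‖ₑ with hJ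
  have hcm : Measurable (starRingEnd ℂ) := Complex.continuous_conj.measurable
  have hUm : ∀ τ, Measurable (U τ) := fun τ => by simp only [hU]; fun_prop
  have hVm : ∀ τ, Measurable (V τ) := fun τ => by simp only [hV]; fun_prop
  -- No oscillation is used here; this bound serves only for |τ| ≤ τ₀.
  have small : ∀ τ, J τ ≤ energy u * energy v := by
    intro τ
    have hV1 : ∫⁻ η, ‖V τ η‖ₑ ≤ energy v := by
      have := lintegral_mul_shift_le hv (-(ε * τ))
      simpa only [← sub_eq_add_neg] using this
    calc J τ ≤ ∫⁻ ξ, ‖U τ ξ‖ₑ * energy v := by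
          refine (enorm_integral_le_lintegral_enorm _).trans (lintegral_mono fun ξ => ?_)
          rw [enorm_mul]
          gcongr
          refine (enorm_integral_le_lintegral_enorm _).trans (le_trans (le_of_eq ?_) hV1)
          simp only [enorm_mul, enorm_osc, mul_one]
      _ = (∫⁻ ξ, ‖U τ ξ‖ₑ) * energy v := lintegral_mul_const _ (hUm τ).enorm
      _ ≤ _ := by gcongr; exact lintegral_mul_shift_le hu τ
  -- Cauchy–Schwarz in ξ on the set where both ξ and ξ + τ are admissible frequencies, then the
  -- oscillatory operator bound for the product V_τ.
  have large : ∀ τ, τ ≠ 0 → J τ ≤ ENNReal.ofReal (C / (μ * |τ|)) ^ (1 / 2 : ℝ) *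
      (energy (U τ) ^ (1 / 2 : ℝ) * energy (V τ) ^ (1 / 2 : ℝ)) := by
    intro τ hτ
    set s : Set ℝ := {ξ | ξ ∈ Set.Icc (1 / 2 : ℝ) 2 ∧ ξ + τ ∈ Set.Icc (1 / 2 : ℝ) 2} with hs
    have hsm : MeasurableSet s :=
      measurableSet_Icc.inter ((measurable_id.add_const τ) measurableSet_Icc)
    set S : ℝ → ℂ := fun ξ => ∫ η, V τ η * osc (μ * phaseDiff p ε τ ξ η) with hS
    have hSm : Measurable S := by
      refine (StronglyMeasurable.integral_prod_right (f := fun ξ η =>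
        V τ η * osc (μ * phaseDiff p ε τ ξ η)) ?_).measurable
      refine Measurable.stronglyMeasurable ?_
      exact ((hVm τ).comp measurable_snd).mul
        (measurable_osc.comp ((measurable_phaseDiff p ε τ).const_mul μ))
    have hUs : ∀ ξ, ξ ∉ s → U τ ξ = 0 := by
      intro ξ hξ
      by_contra h
      have h1 : u ξ ≠ 0 := fun h0 => h (by simp [hU, h0])
      have h2 : u (ξ + τ) ≠ 0 := fun h0 => h (by simp [hU, h0])
      exact hξ ⟨hus _ h1, hus _ h2⟩
    have hVs : ∀ η, V τ η ≠ 0 → η ∈ Set.Icc (1 / 2 : ℝ) 2 ∧ η - ε * τ ∈ Set.Icc (1 / 2 : ℝ) 2 := by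
      intro η h
      have h1 : v η ≠ 0 := fun h0 => h (by simp [hV, h0])
      have h2 : v (η - ε * τ) ≠ 0 := fun h0 => h (by simp [hV, h0])
      exact ⟨hvs _ h1, hvs _ h2⟩
    calc J τ ≤ ∫⁻ ξ, ‖U τ ξ‖ₑ * ‖S ξ‖ₑ := by
          refine (enorm_integral_le_lintegral_enorm _).trans (lintegral_mono fun ξ => ?_)
          rw [enorm_mul]
      _ = ∫⁻ ξ in s, ‖U τ ξ‖ₑ * ‖S ξ‖ₑ := by
          rw [← lintegral_indicator hsm]
          refine lintegral_congr fun ξ => ?_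
          by_cases hξ : ξ ∈ s
          · rw [Set.indicator_of_mem hξ]
          · rw [Set.indicator_of_notMem hξ, hUs ξ hξ, enorm_zero, zero_mul]
      _ ≤ (∫⁻ ξ in s, ‖U τ ξ‖ₑ ^ 2) ^ (1 / 2 : ℝ) * (∫⁻ ξ in s, ‖S ξ‖ₑ ^ 2) ^ (1 / 2 : ℝ) :=
          lintegral_mul_le_sqrt_mul_sqrt (hUm τ).enorm.aemeasurable hSm.enorm.aemeasurable
      _ ≤ energy (U τ) ^ (1 / 2 : ℝ) *
          (ENNReal.ofReal (C / (μ * |τ|)) * energy (V τ)) ^ (1 / 2 : ℝ) := by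
          gcongr
          · exact setLIntegral_le_lintegral _ _
          · exact hT hεp hμ hτ (hVm τ) hVs
      _ = _ := by
          rw [ENNReal.mul_rpow_of_nonneg _ _ (by norm_num)]
          ring
  -- The first frequency is shifted by +τ, which is the case ε = -1 of the shift identity, without
  -- loss.
  have intU : ∫⁻ τ, energy (U τ) = energy u ^ 2 := by
    have := lintegral_lintegral_mul_shift (ε := -1) (by norm_num)
      (f := fun x => ‖u x‖ₑ ^ 2) (by fun_prop)
    simp only [neg_mul, one_mul, sub_neg_eq_add, abs_neg, abs_one, inv_one, ENNReal.ofReal_one] at this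
    rw [energy, ← this]
    simp only [energy, hU, enorm_mul, RCLike.enorm_conj, mul_pow]
  have intV : ∫⁻ τ, energy (V τ) = ENNReal.ofReal |ε|⁻¹ * energy v ^ 2 := by
    rw [energy, ← lintegral_lintegral_mul_shift hε (by fun_prop)]
    simp only [energy, hV, enorm_mul, RCLike.enorm_conj, mul_pow]
  have mU : Measurable fun τ => energy (U τ) := by
    refine Measurable.lintegral_prod_right' (f := fun z : ℝ × ℝ => ‖U z.1 z.2‖ₑ ^ 2) ?_
    simp only [hU]; fun_prop
  have mV : Measurable fun τ => energy (V τ) := by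
    refine Measurable.lintegral_prod_right' (f := fun z : ℝ × ℝ => ‖V z.1 z.2‖ₑ ^ 2) ?_
    simp only [hV]; fun_prop
  change ∫⁻ τ, J τ ≤ _
  rw [← lintegral_add_compl _ (measurableSet_Icc : MeasurableSet (Set.Icc (-τ₀) τ₀))]
  have b1 : ∫⁻ τ in Set.Icc (-τ₀) τ₀, J τ ≤ ENNReal.ofReal (2 * τ₀) * (energy u * energy v) := by
    calc _ ≤ ∫⁻ τ in Set.Icc (-τ₀) τ₀, energy u * energy v := lintegral_mono small
      _ = _ := by
        rw [setLIntegral_const, Real.volume_Icc, mul_comm]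
        congr 2
        ring
  have b2 : ∫⁻ τ in (Set.Icc (-τ₀) τ₀)ᶜ, J τ ≤
      ENNReal.ofReal (√C * √(1 / (|ε| * μ * τ₀))) * (energy u * energy v) := by
    calc _ ≤ ∫⁻ τ in (Set.Icc (-τ₀) τ₀)ᶜ, ENNReal.ofReal (C / (μ * τ₀)) ^ (1 / 2 : ℝ) *
          (energy (U τ) ^ (1 / 2 : ℝ) * energy (V τ) ^ (1 / 2 : ℝ)) := by
          refine setLIntegral_mono' measurableSet_Icc.compl fun τ hτ => ?_
          have hτ1 : τ₀ < |τ| := by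
            by_contra h
            exact hτ (abs_le.1 (not_lt.1 h))
          refine (large τ (abs_pos.1 (hτ₀.trans hτ1))).trans ?_
          gcongr
      _ ≤ ∫⁻ τ, ENNReal.ofReal (C / (μ * τ₀)) ^ (1 / 2 : ℝ) *
          (energy (U τ) ^ (1 / 2 : ℝ) * energy (V τ) ^ (1 / 2 : ℝ)) :=
          setLIntegral_le_lintegral _ _
      _ ≤ ENNReal.ofReal (C / (μ * τ₀)) ^ (1 / 2 : ℝ) *
          ((∫⁻ τ, energy (U τ)) ^ (1 / 2 : ℝ) * (∫⁻ τ, energy (V τ)) ^ (1 / 2 : ℝ)) := by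
          rw [lintegral_const_mul _ (by fun_prop)]
          gcongr
          refine (lintegral_mul_le_sqrt_mul_sqrt (mU.pow_const _).aemeasurable
            (mV.pow_const _).aemeasurable).trans (le_of_eq ?_)
          simp only [ENNReal.sqrt_sq]
      _ = (ENNReal.ofReal (C / (μ * τ₀)) * ENNReal.ofReal |ε|⁻¹) ^ (1 / 2 : ℝ) *
          (energy u * energy v) := by
          rw [intU, intV, ENNReal.mul_rpow_of_nonneg _ _ (by norm_num), ENNReal.sqrt_of_sq,
            ENNReal.sqrt_of_sq, ENNReal.mul_rpow_of_nonneg _ _ (by norm_num)]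
          ring
      _ = _ := by
          rw [← ENNReal.ofReal_mul (by positivity), ENNReal.ofReal_rpow_of_nonneg (by positivity)
            (by norm_num), ← Real.sqrt_eq_rpow, ← Real.sqrt_mul hC]
          congr 3
          field_simp
  refine (add_le_add b1 b2).trans ?_
  rw [← add_mul, ← ENNReal.ofReal_add (by positivity) (by positivity)]
  gcongr
  have h1 : 0 ≤ √(1 / (|ε| * μ * τ₀)) := by positivity
  have h2 : 0 ≤ √C * τ₀ := by positivity
  linarith

/-! ### The symbol: stationary phase -/

/-- The quotient `(t ^ n - c ^ n) / (t - c)`. -/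
noncomputable def powQuot (n : ℕ) (c t : ℝ) : ℝ := ∑ i ∈ Finset.range n, t ^ i * c ^ (n - 1 - i)

/-- The first derivative of `powQuot` in its last variable. -/
noncomputable def powQuot' (n : ℕ) (c t : ℝ) : ℝ :=
  ∑ i ∈ Finset.range n, (i * t ^ (i - 1)) * c ^ (n - 1 - i)

/-- The second derivative of `powQuot` in its last variable. -/
noncomputable def powQuot'' (n : ℕ) (c t : ℝ) : ℝ :=
  ∑ i ∈ Finset.range n, (i * ((i - 1 : ℕ) * t ^ (i - 1 - 1))) * c ^ (n - 1 - i)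

theorem hasDerivAt_powQuot (n : ℕ) (c t : ℝ) : HasDerivAt (powQuot n c) (powQuot' n c t) t :=
  HasDerivAt.fun_sum fun i _ => (hasDerivAt_pow i t).mul_const _

theorem hasDerivAt_powQuot' (n : ℕ) (c t : ℝ) : HasDerivAt (powQuot' n c) (powQuot'' n c t) t :=
  HasDerivAt.fun_sum fun i _ => ((hasDerivAt_pow (i - 1) t).const_mul (i : ℝ)).mul_const _

@[fun_prop]
theorem continuous_powQuot (n : ℕ) : Continuous fun z : ℝ × ℝ => powQuot n z.1 z.2 := by
  unfold powQuot; fun_prop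

@[fun_prop]
theorem continuous_powQuot' (n : ℕ) : Continuous fun z : ℝ × ℝ => powQuot' n z.1 z.2 := by
  unfold powQuot'; fun_prop

@[fun_prop]
theorem continuous_powQuot'' (n : ℕ) : Continuous fun z : ℝ × ℝ => powQuot'' n z.1 z.2 := by
  unfold powQuot''; fun_prop

theorem sub_mul_powQuot (n : ℕ) (c t : ℝ) : (t - c) * powQuot n c t = t ^ n - c ^ n := by
  rw [mul_comm]; exact geom_sum₂_mul t c n

/-- Keeping only the term t^(n-1) gives a bound uniform in c. It is the nondegeneracy of the
critical point. -/
theorem le_powQuot {n : ℕ} (hn : 1 ≤ n) {c t : ℝ} (hc : 0 ≤ c) (ht : 1 / 4 ≤ t) :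
    (1 / 4 : ℝ) ^ (n - 1) ≤ powQuot n c t := by
  have h1 : t ^ (n - 1) * c ^ (n - 1 - (n - 1)) ≤ powQuot n c t :=
    Finset.single_le_sum (f := fun i => t ^ i * c ^ (n - 1 - i))
      (fun i _ => by positivity) (Finset.mem_range.2 (by omega))
  rw [Nat.sub_self, pow_zero, mul_one] at h1
  exact (pow_le_pow_left₀ (by norm_num) ht _).trans h1

/-- The critical point of `t ↦ r * t ^ (n + 1) - p * t`. -/
noncomputable def critPoint (n : ℕ) (p r : ℝ) : ℝ := (p / ((n + 1) * r)) ^ ((n : ℝ)⁻¹)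

/-- The constant in the Legendre transform of `t ^ (n + 1)`. -/
noncomputable def legendreConst (n : ℕ) : ℝ := (1 + (n : ℝ)⁻¹)⁻¹ * ((n : ℝ) + 1) ^ (-(n : ℝ)⁻¹)

theorem legendreConst_pos (n : ℕ) : 0 < legendreConst n := by
  unfold legendreConst; positivity

/-- Minus the critical value of `t ↦ r * t ^ (n + 1) - p * t`. -/
noncomputable def critPhase (n : ℕ) (p r : ℝ) : ℝ :=
  legendreConst n * (p ^ (1 + (n : ℝ)⁻¹) * r ^ (-(n : ℝ)⁻¹))

theorem critPoint_pow {n : ℕ} (hn : 1 ≤ n) {p r : ℝ} (hp : 0 < p) (hr : 0 < r) :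
    critPoint n p r ^ n = p / ((n + 1) * r) :=
  Real.rpow_inv_natCast_pow (by positivity) (by omega)

theorem critPoint_mem {n : ℕ} (hn : 1 ≤ n) {p r : ℝ} (hp : p ∈ Set.Icc (1 / 2 : ℝ) 2)
    (hr : r ∈ Set.Icc (1 / 2 : ℝ) 2) : critPoint n p r ∈ Set.Icc (0 : ℝ) 4 := by
  have hp0 : 0 < p := by linarith [hp.1]
  have hr0 : 0 < r := by linarith [hr.1]
  have h0 : 0 ≤ critPoint n p r := by unfold critPoint; positivity
  refine ⟨h0, ?_⟩
  by_contra h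
  push Not at h
  have h1 := critPoint_pow hn hp0 hr0
  have h2 : (4 : ℝ) ^ 1 < critPoint n p r ^ n := by
    calc (4 : ℝ) ^ 1 ≤ 4 ^ n := pow_le_pow_right₀ (by norm_num) hn
      _ < _ := pow_lt_pow_left₀ h (by norm_num) (by omega)
  rw [h1, lt_div_iff₀ (by positivity)] at h2
  have hn' : (1 : ℝ) ≤ n := by exact_mod_cast hn
  nlinarith [hp.2, hr.1]

/-- Envelope identity for the Legendre transform. It makes the p-derivative of `symbolPhase` equal
to c - t, a factor that vanishes at the critical point. -/
theorem hasDerivAt_critPhase {n : ℕ} {p r : ℝ} (hp : 0 < p) (hr : 0 < r) :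
    HasDerivAt (fun p => critPhase n p r) (critPoint n p r) p := by
  unfold critPhase
  have h := (((hasDerivAt_id p).rpow_const (p := 1 + (n : ℝ)⁻¹)
    (Or.inl (by simpa using hp.ne'))).mul_const (r ^ (-(n : ℝ)⁻¹))).const_mul (legendreConst n)
  refine h.congr_deriv ?_
  simp only [id, one_mul, add_sub_cancel_left, critPoint, legendreConst]
  rw [Real.div_rpow hp.le (by positivity), Real.mul_rpow (by positivity) hr.le,
    Real.rpow_neg (by positivity), Real.rpow_neg hr.le]
  have : (1 + (n : ℝ)⁻¹) ≠ 0 := by positivity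
  field_simp

theorem measurable_critPhase (n : ℕ) : Measurable fun z : ℝ × ℝ => critPhase n z.1 z.2 := by
  unfold critPhase; fun_prop

/-- The phase of the symbol, normalized to vanish at its critical point. -/
noncomputable def symbolPhase (n : ℕ) (p r t : ℝ) : ℝ := r * t ^ (n + 1) - p * t + critPhase n p r

/-- Since c^n = p/((n + 1)r), the derivative is (n + 1)r(t^n - c^n), and t - c can be factored out.
-/
theorem hasDerivAt_symbolPhase {n : ℕ} (hn : 1 ≤ n) {p r : ℝ} (hp : 0 < p) (hr : 0 < r) (t : ℝ) :
    HasDerivAt (symbolPhase n p r)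
      ((t - critPoint n p r) * (((n + 1) * r) * powQuot n (critPoint n p r) t)) t := by
  have h := (((hasDerivAt_pow (n + 1) t).const_mul r).sub
    ((hasDerivAt_id t).const_mul p)).add_const (critPhase n p r)
  refine h.congr_deriv ?_
  have h1 := sub_mul_powQuot n (critPoint n p r) t
  rw [critPoint_pow hn hp hr] at h1
  have h2 : (t - critPoint n p r) * (((n + 1) * r) * powQuot n (critPoint n p r) t) =
      ((n + 1) * r) * (t ^ n - p / ((n + 1) * r)) := by rw [← h1]; ring
  rw [h2, mul_sub, mul_div_cancel₀ _ (by positivity)]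
  simp
  ring

/-! ### Size of the amplitude and of its derivative. -/

/-- The amplitude of the symbol. -/
noncomputable def amplitude (ρ₁ : ℝ → ℝ) (n : ℕ) (N p r : ℝ) : ℂ :=
  ∫ t in (1 / 4 : ℝ)..3, (ρ₁ t : ℂ) * osc (-(N * symbolPhase n p r t))

/-- The derivative of the amplitude in `p`. -/
noncomputable def amplitudeDeriv (ρ₁ : ℝ → ℝ) (n : ℕ) (N p r : ℝ) : ℂ :=
  ∫ t in (1 / 4 : ℝ)..3, (ρ₁ t : ℂ) *
    (((-(N * (critPoint n p r - t)) : ℝ) : ℂ) * Complex.I * osc (-(N * symbolPhase n p r t)))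

theorem eq_zero_of_support_subset {f : ℝ → ℝ} {s : Set ℝ} (hf : Function.support f ⊆ s) {x : ℝ}
    (hx : x ∉ s) : f x = 0 := by
  by_contra h; exact hx (hf h)

theorem support_deriv_subset_Icc {f : ℝ → ℝ} {a b : ℝ} (hf : Function.support f ⊆ Set.Icc a b) :
    Function.support (deriv f) ⊆ Set.Icc a b :=
  support_deriv_subset.trans (closure_minimal hf isClosed_Icc)

/-- The constants in the stationary phase bound are uniform because c stays in the compact set [0,
4] and the quotient of the phase derivative by t - c is bounded below on [1/4, 3]. It does not
matter whether c itself lies in [1/4, 3]. -/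
theorem exists_norm_integral_symbolPhase_le {n : ℕ} (hn : 1 ≤ n) {K : ℝ} (hK0 : 0 ≤ K) :
    ∃ C : ℝ, 0 ≤ C ∧ ∀ {N p r : ℝ} {h h' : ℝ → ℝ}, 0 < N → p ∈ Set.Icc (1 / 2 : ℝ) 2 →
      r ∈ Set.Icc (1 / 2 : ℝ) 2 → (∀ t ∈ Set.Icc (1 / 4 : ℝ) 3, HasDerivAt h (h' t) t) →
      ContinuousOn h' (Set.Icc (1 / 4 : ℝ) 3) → h (1 / 4) = 0 → h 3 = 0 →
      (∀ t ∈ Set.Icc (1 / 4 : ℝ) 3, |h t| ≤ K) → (∀ t ∈ Set.Icc (1 / 4 : ℝ) 3, |h' t| ≤ K) →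
      ‖∫ t in (1 / 4 : ℝ)..3, (h t : ℂ) * osc (-(N * symbolPhase n p r t))‖ ≤ C / √N := by
  have hcomp : IsCompact (Set.Icc (0 : ℝ) 4 ×ˢ Set.Icc (1 / 4 : ℝ) 3) :=
    isCompact_Icc.prod isCompact_Icc
  obtain ⟨K5, hK5⟩ := hcomp.exists_bound_of_continuousOn
    (f := fun z : ℝ × ℝ => ((n + 1) * 2) * powQuot' n z.1 z.2) (by fun_prop)
  set L : ℝ := max K K5 with hL
  have hL0 : 0 ≤ L := hK0.trans (le_max_left _ _)
  set r₀ : ℝ := (n + 1) * (1 / 2) * (1 / 4) ^ (n - 1) with hr₀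
  have hr₀pos : 0 < r₀ := by positivity
  refine ⟨L * Real.pi * (1 + 1 / r₀) + (L / (2 * r₀) + L ^ 2 / (2 * r₀ ^ 2)) * (3 - 1 / 4), ?_, ?_⟩
  · have : (0 : ℝ) ≤ 3 - 1 / 4 := by norm_num
    positivity
  intro N p r h h' hN hp hr hd hc' ha hb hhK hh'K
  have hp0 : 0 < p := by linarith [hp.1]
  have hr0 : 0 < r := by linarith [hr.1]
  set c := critPoint n p r with hc
  have hcm : c ∈ Set.Icc (0 : ℝ) 4 := critPoint_mem hn hp hr
  have hcs : Continuous fun t : ℝ => ((c, t) : ℝ × ℝ) := by fun_prop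
  exact norm_integral_mul_osc_le_of_stationary (by norm_num) hr₀pos hN
    (h := fun t => (h t : ℂ)) (h' := fun t => (h' t : ℂ)) (c := c)
    (R := fun t => ((n + 1) * r) * powQuot n c t)
    (R' := fun t => ((n + 1) * r) * powQuot' n c t)
    (fun t ht => (hd t ht).ofReal_comp) (Complex.continuous_ofReal.comp_continuousOn hc')
    (by simp only [ha, Complex.ofReal_zero]) (by simp only [hb, Complex.ofReal_zero])
    (fun t _ => hasDerivAt_symbolPhase hn hp0 hr0 t)
    (fun t _ => (hasDerivAt_powQuot n c t).const_mul _)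
    ((continuous_const.mul ((continuous_powQuot' n).comp hcs)).continuousOn)
    (fun t ht => by
      have := le_powQuot hn hcm.1 ht.1
      have := hr.1
      rw [hr₀]
      gcongr)
    (fun t ht => by
      refine le_trans ?_ ((hK5 (c, t) ⟨hcm, ht⟩).trans (le_max_right _ _))
      rw [Real.norm_eq_abs, abs_mul, abs_mul (((n : ℝ) + 1) * 2)]
      refine mul_le_mul_of_nonneg_right ?_ (abs_nonneg _)
      rw [abs_of_pos (by positivity), abs_of_pos (by positivity)]
      have := hr.2
      gcongr)
    (fun t ht => by rw [Complex.norm_real]; exact (hhK t ht).trans (le_max_left _ _))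
    (fun t ht => by rw [Complex.norm_real]; exact (hh'K t ht).trans (le_max_left _ _))

/-- Two derivatives of `ρ₁ / powQuot n c`, uniformly in `c`. -/
theorem exists_derivatives_div_powQuot {ρ₁ : ℝ → ℝ} (hρ : ContDiff ℝ ∞ ρ₁)
    (hs : Function.support ρ₁ ⊆ Set.Icc (1 / 2) 2) {n : ℕ} (hn : 1 ≤ n) :
    ∃ (k' k'' : ℝ → ℝ → ℝ) (K : ℝ), 0 ≤ K ∧ ∀ c ∈ Set.Icc (0 : ℝ) 4,
      (∀ t ∈ Set.Icc (1 / 4 : ℝ) 3, HasDerivAt (fun t => ρ₁ t / powQuot n c t) (k' c t) t) ∧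
      (∀ t ∈ Set.Icc (1 / 4 : ℝ) 3, HasDerivAt (k' c) (k'' c t) t) ∧
      ContinuousOn (k'' c) (Set.Icc (1 / 4 : ℝ) 3) ∧ k' c (1 / 4) = 0 ∧ k' c 3 = 0 ∧
      (∀ t ∈ Set.Icc (1 / 4 : ℝ) 3, |k' c t| ≤ K) ∧
      (∀ t ∈ Set.Icc (1 / 4 : ℝ) 3, |k'' c t| ≤ K) := by
  have h1 : ContDiff ℝ ∞ (deriv ρ₁) := (contDiff_infty_iff_deriv.1 hρ).2
  have h2 : ContDiff ℝ ∞ (deriv (deriv ρ₁)) := (contDiff_infty_iff_deriv.1 h1).2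
  have d0 : ∀ t, HasDerivAt ρ₁ (deriv ρ₁ t) t := fun t =>
    (hρ.differentiable (by simp) t).hasDerivAt
  have d1 : ∀ t, HasDerivAt (deriv ρ₁) (deriv (deriv ρ₁) t) t := fun t =>
    (h1.differentiable (by simp) t).hasDerivAt
  have hs1 := support_deriv_subset_Icc hs
  have c0 := hρ.continuous
  have c1 := h1.continuous
  have c2 := h2.continuous
  have hcomp : IsCompact (Set.Icc (0 : ℝ) 4 ×ˢ Set.Icc (1 / 4 : ℝ) 3) :=
    isCompact_Icc.prod isCompact_Icc
  have hSpos : ∀ z ∈ Set.Icc (0 : ℝ) 4 ×ˢ Set.Icc (1 / 4 : ℝ) 3, powQuot n z.1 z.2 ≠ 0 :=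
    fun z hz => (lt_of_lt_of_le (by positivity) (le_powQuot hn hz.1.1 hz.2.1)).ne'
  obtain ⟨k', hk'⟩ : ∃ k' : ℝ → ℝ → ℝ, ∀ c t, k' c t =
    (deriv ρ₁ t * powQuot n c t - ρ₁ t * powQuot' n c t) / powQuot n c t ^ 2 := ⟨_, fun _ _ => rfl⟩
  obtain ⟨k'', hk''⟩ : ∃ k'' : ℝ → ℝ → ℝ, ∀ c t, k'' c t = ((deriv (deriv ρ₁) t * powQuot n c t -
    ρ₁ t * powQuot'' n c t) * powQuot n c t ^ 2 - (deriv ρ₁ t * powQuot n c t -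
    ρ₁ t * powQuot' n c t) * (2 * powQuot n c t * powQuot' n c t)) / (powQuot n c t ^ 2) ^ 2 :=
    ⟨_, fun _ _ => rfl⟩
  have kc' : ContinuousOn (fun z : ℝ × ℝ => k' z.1 z.2) (Set.Icc (0 : ℝ) 4 ×ˢ Set.Icc (1 / 4 : ℝ) 3) := by
    simp only [hk']
    exact ContinuousOn.div (by fun_prop) (by fun_prop) fun z hz => pow_ne_zero 2 (hSpos z hz)
  have kc'' : ContinuousOn (fun z : ℝ × ℝ => k'' z.1 z.2) (Set.Icc (0 : ℝ) 4 ×ˢ Set.Icc (1 / 4 : ℝ) 3) := by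
    simp only [hk'']
    exact ContinuousOn.div (by fun_prop) (by fun_prop)
      fun z hz => pow_ne_zero 2 (pow_ne_zero 2 (hSpos z hz))
  obtain ⟨K1, hK1⟩ := hcomp.exists_bound_of_continuousOn kc'
  obtain ⟨K2, hK2⟩ := hcomp.exists_bound_of_continuousOn kc''
  have n1 : (1 / 4 : ℝ) ∉ Set.Icc (1 / 2 : ℝ) 2 := fun h => by linarith [h.1]
  have n2 : (3 : ℝ) ∉ Set.Icc (1 / 2 : ℝ) 2 := fun h => by linarith [h.2]
  refine ⟨k', k'', max 0 (max K1 K2), le_max_left _ _, fun c hc => ⟨fun t ht => ?_, fun t ht => ?_,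
    ?_, ?_, ?_, fun t ht => (hK1 (c, t) ⟨hc, ht⟩).trans (by simp),
    fun t ht => (hK2 (c, t) ⟨hc, ht⟩).trans (by simp)⟩⟩
  · rw [hk']
    exact (d0 t).div (hasDerivAt_powQuot n c t) (hSpos (c, t) ⟨hc, ht⟩)
  · have := (((d1 t).mul (hasDerivAt_powQuot n c t)).sub ((d0 t).mul
      (hasDerivAt_powQuot' n c t))).div ((hasDerivAt_powQuot n c t).pow 2)
      (pow_ne_zero 2 (hSpos (c, t) ⟨hc, ht⟩))
    rw [show k' c = fun t => (deriv ρ₁ t * powQuot n c t - ρ₁ t * powQuot' n c t) /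
      powQuot n c t ^ 2 from funext fun t => hk' c t]
    refine this.congr_deriv ?_
    simp only [hk'', Pi.mul_apply, Pi.sub_apply, Pi.pow_apply]
    congr 1
    rw [show (2 - 1 : ℕ) = 1 from rfl]
    push_cast
    ring
  · exact ContinuousOn.comp (g := fun z : ℝ × ℝ => k'' z.1 z.2) (f := fun t => (c, t)) kc''
      (by fun_prop) fun t ht => ⟨hc, ht⟩
  · rw [hk', eq_zero_of_support_subset hs n1, eq_zero_of_support_subset hs1 n1]; simp
  · rw [hk', eq_zero_of_support_subset hs n2, eq_zero_of_support_subset hs1 n2]; simp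

theorem exists_norm_amplitude_le {ρ₁ : ℝ → ℝ} (hρ : ContDiff ℝ ∞ ρ₁)
    (hs : Function.support ρ₁ ⊆ Set.Icc (1 / 2) 2) {n : ℕ} (hn : 1 ≤ n) :
    ∃ C : ℝ, 0 ≤ C ∧ ∀ {N p r : ℝ}, 0 < N → p ∈ Set.Icc (1 / 2 : ℝ) 2 →
      r ∈ Set.Icc (1 / 2 : ℝ) 2 → ‖amplitude ρ₁ n N p r‖ ≤ C / √N := by
  have h1 : ContDiff ℝ ∞ (deriv ρ₁) := (contDiff_infty_iff_deriv.1 hρ).2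
  have hs1 := support_deriv_subset_Icc hs
  obtain ⟨K1, hK1⟩ := isCompact_Icc.exists_bound_of_continuousOn
    (s := Set.Icc (1 / 4 : ℝ) 3) hρ.continuous.continuousOn
  obtain ⟨K2, hK2⟩ := isCompact_Icc.exists_bound_of_continuousOn
    (s := Set.Icc (1 / 4 : ℝ) 3) h1.continuous.continuousOn
  obtain ⟨C, hC, h⟩ := exists_norm_integral_symbolPhase_le hn (K := max 0 (max K1 K2))
    (le_max_left _ _)
  have n1 : (1 / 4 : ℝ) ∉ Set.Icc (1 / 2 : ℝ) 2 := fun h => by linarith [h.1]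
  have n2 : (3 : ℝ) ∉ Set.Icc (1 / 2 : ℝ) 2 := fun h => by linarith [h.2]
  exact ⟨C, hC, fun hN hp hr => h hN hp hr
    (fun t _ => (hρ.differentiable (by simp) t).hasDerivAt) h1.continuous.continuousOn
    (eq_zero_of_support_subset hs n1) (eq_zero_of_support_subset hs n2)
    (fun t ht => (hK1 t ht).trans (by simp)) (fun t ht => (hK2 t ht).trans (by simp))⟩

/-- Differentiating in p brings down N(t - c), which is the t-derivative of the phase up to the
factor (n + 1)r`powQuot`. One integration by parts in t therefore removes the factor N and leaves an
integral of the same type as the amplitude, now with the derivative of ρ₁/`powQuot`. -/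
theorem exists_norm_amplitudeDeriv_le {ρ₁ : ℝ → ℝ} (hρ : ContDiff ℝ ∞ ρ₁)
    (hs : Function.support ρ₁ ⊆ Set.Icc (1 / 2) 2) {n : ℕ} (hn : 1 ≤ n) :
    ∃ C : ℝ, 0 ≤ C ∧ ∀ {N p r : ℝ}, 0 < N → p ∈ Set.Icc (1 / 2 : ℝ) 2 →
      r ∈ Set.Icc (1 / 2 : ℝ) 2 → ‖amplitudeDeriv ρ₁ n N p r‖ ≤ C / √N := by
  obtain ⟨k', k'', K, hK, hkk⟩ := exists_derivatives_div_powQuot hρ hs hn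
  obtain ⟨C, hC, key⟩ := exists_norm_integral_symbolPhase_le hn hK
  refine ⟨C, hC, ?_⟩
  intro N p r hN hp hr
  have hp0 : 0 < p := by linarith [hp.1]
  have hr0 : 0 < r := by linarith [hr.1]
  have n1 : (1 / 4 : ℝ) ∉ Set.Icc (1 / 2 : ℝ) 2 := fun h => by linarith [h.1]
  have n2 : (3 : ℝ) ∉ Set.Icc (1 / 2 : ℝ) 2 := fun h => by linarith [h.2]
  have z1 := eq_zero_of_support_subset hs n1
  have z2 := eq_zero_of_support_subset hs n2
  set c := critPoint n p r with hc
  have hcm : c ∈ Set.Icc (0 : ℝ) 4 := critPoint_mem hn hp hr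
  obtain ⟨kd, kd', kc'', k1, k2, kb', kb''⟩ := hkk c hcm
  have kc' : ContinuousOn (k' c) (Set.Icc (1 / 4 : ℝ) 3) := fun t ht =>
    (kd' t ht).continuousAt.continuousWithinAt
  have hb := key hN hp hr kd' kc'' k1 k2 kb' kb''
  set g : ℝ → ℂ := fun t => osc (-(N * symbolPhase n p r t)) with hg
  set q : ℝ → ℝ := fun t => (t - c) * (((n + 1) * r) * powQuot n c t) with hq
  have gd : ∀ t, HasDerivAt g (((-(N * q t) : ℝ) : ℂ) * Complex.I * g t) t := fun t =>
    ((hasDerivAt_symbolPhase hn hp0 hr0 t).const_mul N).neg.osc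
  have gc : Continuous g := continuous_iff_continuousAt.2 fun t => (gd t).continuousAt
  have qc : Continuous q := by
    have : Continuous fun t => powQuot n c t :=
      (continuous_powQuot n).comp (by fun_prop : Continuous fun t : ℝ => ((c, t) : ℝ × ℝ))
    simp only [hq]
    fun_prop
  have hu : Set.uIcc (1 / 4 : ℝ) 3 = Set.Icc (1 / 4) 3 := Set.uIcc_of_le (by norm_num)
  have ibp := intervalIntegral.integral_mul_deriv_eq_deriv_mul (a := 1 / 4) (b := 3)
    (u := fun t => ((ρ₁ t / powQuot n c t : ℝ) : ℂ)) (u' := fun t => (k' c t : ℂ)) (v := g)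
    (v' := fun t => ((-(N * q t) : ℝ) : ℂ) * Complex.I * g t)
    (fun t ht => (kd t (hu ▸ ht)).ofReal_comp) (fun t _ => gd t)
    (ContinuousOn.intervalIntegrable (by
      rw [hu]
      exact Complex.continuous_ofReal.comp_continuousOn kc'))
    (Continuous.intervalIntegrable (by fun_prop) _ _)
  have e : amplitudeDeriv ρ₁ n N p r = -(((((n + 1) * r)⁻¹ : ℝ) : ℂ) *
      ∫ t in (1 / 4 : ℝ)..3, ((ρ₁ t / powQuot n c t : ℝ) : ℂ) *
        (((-(N * q t) : ℝ) : ℂ) * Complex.I * g t)) := by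
    rw [← intervalIntegral.integral_const_mul, ← intervalIntegral.integral_neg]
    refine intervalIntegral.integral_congr fun t ht => ?_
    rw [hu] at ht
    have hS0 : 0 < powQuot n c t := lt_of_lt_of_le (by positivity) (le_powQuot hn hcm.1 ht.1)
    have hS : ((powQuot n c t : ℝ) : ℂ) ≠ 0 := by exact_mod_cast hS0.ne'
    have hr' : ((r : ℝ) : ℂ) ≠ 0 := by exact_mod_cast hr0.ne'
    have hn' : ((n : ℂ) + 1) ≠ 0 := by exact_mod_cast n.succ_ne_zero
    simp only [hq, hg]
    push_cast
    field_simp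
    ring
  rw [e, ibp]
  simp only [z1, z2, zero_div, Complex.ofReal_zero, zero_mul, zero_sub, sub_zero, mul_neg, neg_neg]
  rw [norm_mul, Complex.norm_real, Real.norm_of_nonneg (by positivity)]
  have hle : ((n + 1) * r)⁻¹ ≤ 1 := by
    apply inv_le_one_of_one_le₀
    have : (1 : ℝ) ≤ n := by exact_mod_cast hn
    nlinarith [hr.1]
  calc _ ≤ 1 * (C / √N) := by gcongr
    _ = _ := one_mul _

/-! ### Operations on symbols -/

/-- The bilinear operator with symbol `M` is bounded on functions supported in `[1/2, 2]`, with
squared norm at most `K`. -/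
def BilinBound (M : ℝ → ℝ → ℂ) (ε : ℝ) (K : ℝ≥0∞) : Prop :=
  ∀ u v : ℝ → ℂ, Measurable u → Measurable v → FreqSupp u → FreqSupp v →
    energy u ≠ ⊤ → energy v ≠ ⊤ → energy (bilinSymbol M ε u v) ≤ K * (energy u * energy v)

theorem BilinBound.mono {M : ℝ → ℝ → ℂ} {ε : ℝ} {K K' : ℝ≥0∞} (h : BilinBound M ε K)
    (hK : K ≤ K') : BilinBound M ε K' := fun u v hu hv hus hvs hEu hEv =>
  (h u v hu hv hus hvs hEu hEv).trans (by gcongr)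

theorem bilinBound_of_bounded {M : ℝ → ℝ → ℂ} (ε : ℝ) {K : ℝ≥0∞}
    (hM : ∀ ξ ∈ Set.Icc (1 / 2 : ℝ) 2, ∀ η ∈ Set.Icc (1 / 2 : ℝ) 2, ‖M ξ η‖ₑ ≤ K) :
    BilinBound M ε (2 * K ^ 2) := fun _ _ hu hv hus hvs _ _ =>
  energy_bilinSymbol_le_of_bounded hu hv hus hvs hM

theorem bilinSymbol_congr {M M' : ℝ → ℝ → ℂ} {ε : ℝ} {u v : ℝ → ℂ} (hus : FreqSupp u)
    (hvs : FreqSupp v)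
    (h : ∀ ξ ∈ Set.Icc (1 / 2 : ℝ) 2, ∀ η ∈ Set.Icc (1 / 2 : ℝ) 2, M ξ η = M' ξ η) :
    bilinSymbol M ε u v = bilinSymbol M' ε u v := by
  funext ζ
  refine integral_congr_ae (Filter.Eventually.of_forall fun ξ => ?_)
  by_cases h1 : u ξ = 0
  · simp [h1]
  by_cases h2 : v (ζ - ε * ξ) = 0
  · simp [h2]
  simp only [h _ (hus _ h1) _ (hvs _ h2)]

theorem BilinBound.congr {M M' : ℝ → ℝ → ℂ} {ε : ℝ} {K : ℝ≥0∞} (hM : BilinBound M ε K)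
    (h : ∀ ξ ∈ Set.Icc (1 / 2 : ℝ) 2, ∀ η ∈ Set.Icc (1 / 2 : ℝ) 2, M ξ η = M' ξ η) :
    BilinBound M' ε K := fun u v hu hv hus hvs hEu hEv => by
  rw [← bilinSymbol_congr hus hvs h]
  exact hM u v hu hv hus hvs hEu hEv

theorem ae_integrable_mul_shift (ε : ℝ) {u v : ℝ → ℂ} (hu : Measurable u) (hv : Measurable v)
    (hus : FreqSupp u) (hEu : energy u ≠ ⊤) (hEv : energy v ≠ ⊤) :
    ∀ᵐ ζ : ℝ, Integrable fun ξ => u ξ * v (ζ - ε * ξ) := by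
  have hm : Measurable fun ζ => (∫⁻ ξ, ‖u ξ‖ₑ * ‖v (ζ - ε * ξ)‖ₑ) ^ 2 :=
    (Measurable.lintegral_prod_right' (f := fun z : ℝ × ℝ =>
      ‖u z.2‖ₑ * ‖v (z.1 - ε * z.2)‖ₑ) (by fun_prop)).pow_const 2
  have hfin : ∫⁻ ζ, (∫⁻ ξ, ‖u ξ‖ₑ * ‖v (ζ - ε * ξ)‖ₑ) ^ 2 ≠ ⊤ :=
    ((lintegral_sq_lintegral_le ε hu hv hus).trans_lt (ENNReal.mul_lt_top (by simp)
      (ENNReal.mul_lt_top (lt_top_iff_ne_top.2 hEu) (lt_top_iff_ne_top.2 hEv)))).ne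
  filter_upwards [ae_lt_top hm hfin] with ζ hζ
  refine ⟨by fun_prop, ?_⟩
  rw [hasFiniteIntegral_iff_enorm]
  simp only [enorm_mul]
  simpa using hζ

theorem measurable_bilinSymbol {M : ℝ → ℝ → ℂ} (hM : Measurable (Function.uncurry M)) (ε : ℝ)
    {u v : ℝ → ℂ} (hu : Measurable u) (hv : Measurable v) : Measurable (bilinSymbol M ε u v) := by
  refine (StronglyMeasurable.integral_prod_right (f := fun ζ ξ =>
    u ξ * v (ζ - ε * ξ) * M ξ (ζ - ε * ξ)) ?_).measurable
  refine Measurable.stronglyMeasurable ?_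
  have h1 : Measurable fun z : ℝ × ℝ => M z.2 (z.1 - ε * z.2) :=
    hM.comp (by fun_prop : Measurable fun z : ℝ × ℝ => (z.2, z.1 - ε * z.2))
  simp only [Function.uncurry_def]
  fun_prop

theorem enorm_add_sq_le (x y : ℂ) : ‖x + y‖ₑ ^ 2 ≤ 2 * ‖x‖ₑ ^ 2 + 2 * ‖y‖ₑ ^ 2 := by
  have h : (‖x + y‖₊ : ℝ≥0∞) ^ 2 ≤ 2 * (‖x‖₊ : ℝ≥0∞) ^ 2 + 2 * (‖y‖₊ : ℝ≥0∞) ^ 2 := by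
    norm_cast
    rw [← NNReal.coe_le_coe]
    push_cast
    have := norm_add_le x y
    nlinarith [sq_nonneg (‖x‖ - ‖y‖), norm_nonneg (x + y), norm_nonneg x, norm_nonneg y]
  exact h

theorem energy_add_le {f g : ℝ → ℂ} (hf : Measurable f) :
    energy (f + g) ≤ 2 * energy f + 2 * energy g := by
  calc energy (f + g) ≤ ∫⁻ x, (2 * ‖f x‖ₑ ^ 2 + 2 * ‖g x‖ₑ ^ 2) :=
        lintegral_mono fun x => enorm_add_sq_le _ _
    _ = _ := by
        rw [lintegral_add_left (by fun_prop), lintegral_const_mul _ (by fun_prop),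
          lintegral_const_mul' _ _ (by simp)]
        rfl

theorem energy_congr_ae {f g : ℝ → ℂ} (h : f =ᵐ[volume] g) : energy f = energy g :=
  lintegral_congr_ae (h.mono fun x hx => by simp only [hx])

theorem integrable_mul_symbol {M : ℝ → ℝ → ℂ} (hM : Measurable (Function.uncurry M)) {B ε ζ : ℝ}
    {u v : ℝ → ℂ} (hus : FreqSupp u) (hvs : FreqSupp v)
    (hB : ∀ ξ ∈ Set.Icc (1 / 2 : ℝ) 2, ∀ η ∈ Set.Icc (1 / 2 : ℝ) 2, ‖M ξ η‖ ≤ B)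
    (hi : Integrable fun ξ => u ξ * v (ζ - ε * ξ)) :
    Integrable fun ξ => u ξ * v (ζ - ε * ξ) * M ξ (ζ - ε * ξ) := by
  have hMm : Measurable fun ξ => M ξ (ζ - ε * ξ) :=
    hM.comp (by fun_prop : Measurable fun ξ : ℝ => (ξ, ζ - ε * ξ))
  refine (hi.norm.const_mul B).mono' (hi.1.mul hMm.aestronglyMeasurable)
    (Filter.Eventually.of_forall fun ξ => ?_)
  by_cases h1 : u ξ = 0
  · simp [h1]
  by_cases h2 : v (ζ - ε * ξ) = 0
  · simp [h2]
  rw [norm_mul, mul_comm]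
  gcongr
  exact hB _ (hus _ h1) _ (hvs _ h2)

/-- Measurable bounded symbols keep the integrands integrable for almost every ζ, so that the
integral defining the operator is additive in the symbol. The size of the bounds does not enter the
result. -/
theorem BilinBound.add {M M' : ℝ → ℝ → ℂ} {ε B B' : ℝ} {K K' : ℝ≥0∞} (h : BilinBound M ε K)
    (h' : BilinBound M' ε K') (hM : Measurable (Function.uncurry M))
    (hM' : Measurable (Function.uncurry M'))
    (hB : ∀ ξ ∈ Set.Icc (1 / 2 : ℝ) 2, ∀ η ∈ Set.Icc (1 / 2 : ℝ) 2, ‖M ξ η‖ ≤ B)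
    (hB' : ∀ ξ ∈ Set.Icc (1 / 2 : ℝ) 2, ∀ η ∈ Set.Icc (1 / 2 : ℝ) 2, ‖M' ξ η‖ ≤ B') :
    BilinBound (fun ξ η => M ξ η + M' ξ η) ε (2 * K + 2 * K') := by
  intro u v hu hv hus hvs hEu hEv
  have e : bilinSymbol (fun ξ η => M ξ η + M' ξ η) ε u v =ᵐ[volume]
      bilinSymbol M ε u v + bilinSymbol M' ε u v := by
    filter_upwards [ae_integrable_mul_shift ε hu hv hus hEu hEv] with ζ hζ
    simp only [bilinSymbol, Pi.add_apply, mul_add]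
    exact integral_add (integrable_mul_symbol hM hus hvs hB hζ)
      (integrable_mul_symbol hM' hus hvs hB' hζ)
  rw [energy_congr_ae e]
  refine (energy_add_le (measurable_bilinSymbol hM ε hu hv)).trans ?_
  calc _ ≤ 2 * (K * (energy u * energy v)) + 2 * (K' * (energy u * energy v)) := by
        gcongr
        · exact h u v hu hv hus hvs hEu hEv
        · exact h' u v hu hv hus hvs hEu hEv
    _ = _ := by ring

theorem energy_conj (u : ℝ → ℂ) : energy (fun x => starRingEnd ℂ (u x)) = energy u := by
  simp only [energy, RCLike.enorm_conj]

theorem BilinBound.conj {M : ℝ → ℝ → ℂ} {ε : ℝ} {K : ℝ≥0∞} (h : BilinBound M ε K) :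
    BilinBound (fun ξ η => starRingEnd ℂ (M ξ η)) ε K := by
  intro u v hu hv hus hvs hEu hEv
  have hcm : Measurable (starRingEnd ℂ) := Complex.continuous_conj.measurable
  have e : bilinSymbol (fun ξ η => starRingEnd ℂ (M ξ η)) ε u v = fun ζ => starRingEnd ℂ
      (bilinSymbol M ε (fun x => starRingEnd ℂ (u x)) (fun x => starRingEnd ℂ (v x)) ζ) := by
    funext ζ
    simp only [bilinSymbol]
    rw [← integral_conj]
    simp
  rw [e, energy_conj]
  have := h (fun x => starRingEnd ℂ (u x)) (fun x => starRingEnd ℂ (v x)) (by fun_prop)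
    (by fun_prop) (fun x hx => hus x fun h0 => hx (by simp [h0]))
    (fun x hx => hvs x fun h0 => hx (by simp [h0])) (by rwa [energy_conj]) (by rwa [energy_conj])
  rwa [energy_conj, energy_conj] at this

theorem energy_mul_le {w g : ℝ → ℂ} {A : ℝ} (hg : ∀ x, ‖g x‖ ≤ A) :
    energy (fun x => w x * g x) ≤ ENNReal.ofReal A ^ 2 * energy w := by
  unfold energy
  rw [← lintegral_const_mul' _ _ (by simp)]
  refine lintegral_mono fun x => ?_
  rw [enorm_mul, mul_pow, mul_comm]
  gcongr
  rw [← ofReal_norm]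
  exact ENNReal.ofReal_le_ofReal (hg x)

set_option maxHeartbeats 1000000 in
/-- Superposition: a factor that is an average of products of functions of `ξ` and of `η` can be
absorbed by the arguments of the bilinear operator. -/
theorem BilinBound.superpose {M : ℝ → ℝ → ℂ} {ε B : ℝ} {K : ℝ≥0∞} (h : BilinBound M ε K)
    (hM : Measurable (Function.uncurry M))
    (hB : ∀ ξ ∈ Set.Icc (1 / 2 : ℝ) 2, ∀ η ∈ Set.Icc (1 / 2 : ℝ) 2, ‖M ξ η‖ ≤ B)
    {k l : ℝ → ℝ → ℂ} (hk : Measurable (Function.uncurry k)) (hl : Measurable (Function.uncurry l))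
    {A₁ A₂ : ℝ} (hkA : ∀ s ξ, ‖k s ξ‖ ≤ A₁) (hlA : ∀ s η, ‖l s η‖ ≤ A₂) :
    BilinBound (fun ξ η => M ξ η * ∫ s in Set.Icc (1 / 2 : ℝ) 2, k s ξ * l s η) ε
      (4 * ENNReal.ofReal (A₁ * A₂) ^ 2 * K) := by
  intro u v hu hv hus hvs hEu hEv
  set I : Set ℝ := Set.Icc (1 / 2 : ℝ) 2 with hI
  have hA₁ : 0 ≤ A₁ := (norm_nonneg _).trans (hkA 0 0)
  have hA₂ : 0 ≤ A₂ := (norm_nonneg _).trans (hlA 0 0)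
  have hkm : ∀ s, Measurable (k s) := fun s => hk.comp (by fun_prop : Measurable fun ξ => (s, ξ))
  have hlm : ∀ s, Measurable (l s) := fun s => hl.comp (by fun_prop : Measurable fun ξ => (s, ξ))
  set G : ℝ → ℝ → ℂ := fun s ζ =>
    bilinSymbol M ε (fun ξ => u ξ * k s ξ) (fun η => v η * l s η) ζ with hG
  have hGm : Measurable (Function.uncurry G) := by
    have hz : Measurable fun y : (ℝ × ℝ) × ℝ => (u y.2 * k y.1.1 y.2) *
        (v (y.1.2 - ε * y.2) * l y.1.1 (y.1.2 - ε * y.2)) * M y.2 (y.1.2 - ε * y.2) := by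
      have m1 : Measurable fun y : (ℝ × ℝ) × ℝ => k y.1.1 y.2 :=
        hk.comp (by fun_prop : Measurable fun y : (ℝ × ℝ) × ℝ => (y.1.1, y.2))
      have m2 : Measurable fun y : (ℝ × ℝ) × ℝ => l y.1.1 (y.1.2 - ε * y.2) :=
        hl.comp (by fun_prop : Measurable fun y : (ℝ × ℝ) × ℝ => (y.1.1, y.1.2 - ε * y.2))
      have m3 : Measurable fun y : (ℝ × ℝ) × ℝ => M y.2 (y.1.2 - ε * y.2) :=
        hM.comp (by fun_prop : Measurable fun y : (ℝ × ℝ) × ℝ => (y.2, y.1.2 - ε * y.2))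
      fun_prop
    exact (hz.stronglyMeasurable.integral_prod_right').measurable
  have e : bilinSymbol (fun ξ η => M ξ η * ∫ s in I, k s ξ * l s η) ε u v =ᵐ[volume]
      fun ζ => ∫ s in I, G s ζ := by
    filter_upwards [ae_integrable_mul_shift ε hu hv hus hEu hEv] with ζ hζ
    have hi := integrable_mul_symbol hM hus hvs hB hζ
    have hi2 : Integrable (Function.uncurry fun ξ s => u ξ * v (ζ - ε * ξ) * M ξ (ζ - ε * ξ) *
        (k s ξ * l s (ζ - ε * ξ))) (volume.prod (volume.restrict I)) := by
      have h1 : Integrable (fun z : ℝ × ℝ => u z.1 * v (ζ - ε * z.1) * M z.1 (ζ - ε * z.1))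
          (volume.prod (volume.restrict I)) := hi.comp_fst _
      refine h1.mul_bdd (c := A₁ * A₂) ?_ (Filter.Eventually.of_forall fun z => ?_)
      · have m1 : Measurable fun y : ℝ × ℝ => k y.2 y.1 :=
          hk.comp (by fun_prop : Measurable fun y : ℝ × ℝ => (y.2, y.1))
        have m2 : Measurable fun y : ℝ × ℝ => l y.2 (ζ - ε * y.1) :=
          hl.comp (by fun_prop : Measurable fun y : ℝ × ℝ => (y.2, ζ - ε * y.1))
        exact (m1.mul m2).aestronglyMeasurable
      · rw [norm_mul]
        exact mul_le_mul (hkA _ _) (hlA _ _) (norm_nonneg _) hA₁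
    have h2 := integral_integral_swap hi2
    simp only [hG, bilinSymbol]
    calc _ = ∫ ξ, ∫ s in I, u ξ * v (ζ - ε * ξ) * M ξ (ζ - ε * ξ) *
          (k s ξ * l s (ζ - ε * ξ)) := by
          refine integral_congr_ae (Filter.Eventually.of_forall fun ξ => ?_)
          simp only
          rw [integral_const_mul]
          ring
      _ = _ := h2
      _ = _ := by
          refine integral_congr_ae (Filter.Eventually.of_forall fun s => ?_)
          refine integral_congr_ae (Filter.Eventually.of_forall fun ξ => ?_)
          simp only
          ring
  have hI2 : (volume I : ℝ≥0∞) ≤ 2 := by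
    rw [hI, Real.volume_Icc, show (2 : ℝ≥0∞) = ENNReal.ofReal 2 by simp]
    exact ENNReal.ofReal_le_ofReal (by norm_num)
  have hGs : ∀ s, energy (G s) ≤ ENNReal.ofReal (A₁ * A₂) ^ 2 * K * (energy u * energy v) := by
    intro s
    have b1 := energy_mul_le (w := u) (hkA s)
    have b2 := energy_mul_le (w := v) (hlA s)
    refine (h (fun ξ => u ξ * k s ξ) (fun η => v η * l s η) (hu.mul (hkm s)) (hv.mul (hlm s))
      (fun x hx => hus x (left_ne_zero_of_mul hx)) (fun x hx => hvs x (left_ne_zero_of_mul hx))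
      (b1.trans_lt (ENNReal.mul_lt_top (by simp) (lt_top_iff_ne_top.2 hEu))).ne
      (b2.trans_lt (ENNReal.mul_lt_top (by simp) (lt_top_iff_ne_top.2 hEv))).ne).trans ?_
    calc _ ≤ K * (ENNReal.ofReal A₁ ^ 2 * energy u * (ENNReal.ofReal A₂ ^ 2 * energy v)) := by
          gcongr
      _ = _ := by rw [ENNReal.ofReal_mul hA₁]; ring
  rw [energy_congr_ae e]
  -- Cauchy–Schwarz in s costs the length of the interval, and integrating the uniform bound in s
  -- costs it again. The length 3/2 is rounded up to 2, hence the factor 4.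
  calc energy (fun ζ => ∫ s in I, G s ζ) ≤ ∫⁻ ζ, 2 * ∫⁻ s in I, ‖G s ζ‖ₑ ^ 2 := by
        refine lintegral_mono fun ζ => ?_
        have hm : Measurable fun s => G s ζ :=
          hGm.comp (by fun_prop : Measurable fun s : ℝ => (s, ζ))
        calc ‖∫ s in I, G s ζ‖ₑ ^ 2 ≤ (∫⁻ s in I, ‖G s ζ‖ₑ) ^ 2 := by
              gcongr; exact enorm_integral_le_lintegral_enorm _
          _ = (∫⁻ s in I, ‖G s ζ‖ₑ ∂(volume.restrict I)) ^ 2 := by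
              rw [Measure.restrict_restrict measurableSet_Icc, Set.inter_self]
          _ ≤ _ := by
              refine (sq_setLIntegral_le (s := I) hm.enorm.aemeasurable).trans ?_
              gcongr
              rw [Measure.restrict_apply_self]
              exact hI2
    _ = 2 * ∫⁻ s in I, energy (G s) := by
        have hm2 : Measurable fun z : ℝ × ℝ => ‖G z.2 z.1‖ₑ ^ 2 :=
          ((hGm.comp measurable_swap).enorm).pow_const 2
        rw [lintegral_const_mul _ hm2.lintegral_prod_right']
        congr 1
        exact lintegral_lintegral_swap (f := fun ζ s => ‖G s ζ‖ₑ ^ 2) hm2.aemeasurable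
    _ ≤ 2 * ∫⁻ s in I, ENNReal.ofReal (A₁ * A₂) ^ 2 * K * (energy u * energy v) := by
        gcongr with s
        exact hGs s
    _ = 2 * (ENNReal.ofReal (A₁ * A₂) ^ 2 * K * (energy u * energy v) * volume I) := by
        rw [setLIntegral_const]
    _ ≤ 2 * (ENNReal.ofReal (A₁ * A₂) ^ 2 * K * (energy u * energy v) * 2) := by gcongr
    _ = _ := by ring

/-! ### Bounds for the symbol -/

/-- Fundamental theorem of calculus in p for each fixed t, then Fubini; no differentiation under the
integral sign is needed. -/
theorem amplitude_eq_add_integral {ρ₁ : ℝ → ℝ} (hρ : Continuous ρ₁) (n : ℕ) (N : ℝ) {p r : ℝ}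
    (hp : p ∈ Set.Icc (1 / 2 : ℝ) 2) (hr : 0 < r) :
    amplitude ρ₁ n N p r =
      amplitude ρ₁ n N (1 / 2) r + ∫ s in (1 / 2)..p, amplitudeDeriv ρ₁ n N s r := by
  set F : ℝ → ℝ → ℂ := fun s t => (ρ₁ t : ℂ) *
    (((-(N * (critPoint n s r - t)) : ℝ) : ℂ) * Complex.I * osc (-(N * symbolPhase n s r t))) with hF
  set R : Set (ℝ × ℝ) := Set.Icc (1 / 2 : ℝ) p ×ˢ Set.Icc (1 / 4 : ℝ) 3 with hR
  have hpos : ∀ z ∈ R, z.1 ≠ 0 := fun z hz => by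
    have := hz.1.1
    linarith
  have c1 : ContinuousOn (fun z : ℝ × ℝ => critPoint n z.1 r) R := by
    unfold critPoint
    refine ContinuousOn.rpow_const (by fun_prop) fun z hz => Or.inl ?_
    have := hpos z hz
    positivity
  have c2 : ContinuousOn (fun z : ℝ × ℝ => symbolPhase n z.1 r z.2) R := by
    unfold symbolPhase critPhase
    have : ContinuousOn (fun z : ℝ × ℝ => z.1 ^ (1 + (n : ℝ)⁻¹)) R :=
      ContinuousOn.rpow_const (by fun_prop) fun z hz => Or.inl (hpos z hz)
    fun_prop
  have cF : ContinuousOn (Function.uncurry F) R := by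
    have c3 : ContinuousOn (fun z : ℝ × ℝ => osc (-(N * symbolPhase n z.1 r z.2))) R :=
      continuous_osc.comp_continuousOn (by fun_prop)
    have c4 : ContinuousOn
        (fun z : ℝ × ℝ => ((-(N * (critPoint n z.1 r - z.2)) : ℝ) : ℂ)) R :=
      Complex.continuous_ofReal.comp_continuousOn (by fun_prop)
    have c5 : Continuous fun z : ℝ × ℝ => (ρ₁ z.2 : ℂ) := by fun_prop
    exact c5.continuousOn.mul ((c4.mul continuousOn_const).mul c3)
  have hFi : IntegrableOn (Function.uncurry F)
      (Set.uIoc (1 / 2 : ℝ) p ×ˢ Set.uIoc (1 / 4 : ℝ) 3) := by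
    have h1 : IntegrableOn (Function.uncurry F) R :=
      cF.integrableOn_compact (isCompact_Icc.prod isCompact_Icc)
    refine h1.mono_set ?_
    rw [Set.uIoc_of_le hp.1, Set.uIoc_of_le (by norm_num)]
    exact Set.prod_mono Set.Ioc_subset_Icc_self Set.Ioc_subset_Icc_self
  have hosc : ∀ s : ℝ, Continuous fun t => (ρ₁ t : ℂ) * osc (-(N * symbolPhase n s r t)) := by
    intro s
    unfold symbolPhase
    fun_prop
  have swap := intervalIntegral_intervalIntegral_swap hFi
  change ∫ s in (1 / 2)..p, amplitudeDeriv ρ₁ n N s r = _ at swap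
  rw [swap, ← sub_eq_iff_eq_add']
  unfold amplitude
  rw [← intervalIntegral.integral_sub ((hosc _).intervalIntegrable _ _)
    ((hosc _).intervalIntegrable _ _)]
  refine intervalIntegral.integral_congr fun t ht => ?_
  rw [Set.uIcc_of_le (by norm_num)] at ht
  have hd : ∀ s ∈ Set.uIcc (1 / 2 : ℝ) p,
      HasDerivAt (fun s => (ρ₁ t : ℂ) * osc (-(N * symbolPhase n s r t))) (F s t) s := by
    intro s hs
    rw [Set.uIcc_of_le hp.1] at hs
    have hs0 : 0 < s := by linarith [hs.1]
    have h1 : HasDerivAt (fun s => symbolPhase n s r t) (critPoint n s r - t) s := by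
      have := (((hasDerivAt_id s).mul_const t).const_sub (r * t ^ (n + 1))).add
        (hasDerivAt_critPhase (n := n) hs0 hr)
      refine this.congr_deriv ?_
      simp; ring
    exact ((h1.const_mul N).neg.osc).const_mul _
  have hFt : IntervalIntegrable (fun s => F s t) volume (1 / 2) p := by
    refine ContinuousOn.intervalIntegrable ?_
    rw [Set.uIcc_of_le hp.1]
    exact ContinuousOn.comp (g := Function.uncurry F) (f := fun s => (s, t)) cF
      (by fun_prop) fun s hs => ⟨hs, ht⟩
  exact (intervalIntegral.integral_eq_sub_of_hasDerivAt hd hFt).symm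

theorem measurable_amplitude {ρ₁ : ℝ → ℝ} (hρ : Continuous ρ₁) (n : ℕ) (N : ℝ) :
    Measurable fun z : ℝ × ℝ => amplitude ρ₁ n N z.1 z.2 := by
  have h : Measurable fun y : (ℝ × ℝ) × ℝ => (ρ₁ y.2 : ℂ) *
      osc (-(N * symbolPhase n y.1.1 y.1.2 y.2)) := by
    unfold symbolPhase critPhase
    have := hρ.measurable
    fun_prop
  unfold amplitude
  simp only [intervalIntegral.integral_of_le (show (1 / 4 : ℝ) ≤ 3 by norm_num)]
  exact (h.stronglyMeasurable.integral_prod_right').measurable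

theorem measurable_amplitudeDeriv {ρ₁ : ℝ → ℝ} (hρ : Continuous ρ₁) (n : ℕ) (N : ℝ) :
    Measurable fun z : ℝ × ℝ => amplitudeDeriv ρ₁ n N z.1 z.2 := by
  have h : Measurable fun y : (ℝ × ℝ) × ℝ => (ρ₁ y.2 : ℂ) *
      (((-(N * (critPoint n y.1.1 y.1.2 - y.2)) : ℝ) : ℂ) * Complex.I *
        osc (-(N * symbolPhase n y.1.1 y.1.2 y.2))) := by
    unfold symbolPhase critPhase critPoint
    have := hρ.measurable
    fun_prop
  unfold amplitudeDeriv
  simp only [intervalIntegral.integral_of_le (show (1 / 4 : ℝ) ≤ 3 by norm_num)]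
  exact (h.stronglyMeasurable.integral_prod_right').measurable

/-- The symbol `∫ ρ₁(t) e^{-iN(r t^(n+1) - p t)} dt`, whose phase has a critical point. -/
noncomputable def symbolStat (ρ₁ : ℝ → ℝ) (n : ℕ) (N p r : ℝ) : ℂ :=
  ∫ t in (1 / 4 : ℝ)..3, (ρ₁ t : ℂ) * osc (-(N * (r * t ^ (n + 1) - p * t)))

/-- The symbol `∫ ρ₁(t) e^{-iN(r t^(n+1) + p t)} dt`, whose phase has no critical point. -/
noncomputable def symbolNonstat (ρ₁ : ℝ → ℝ) (n : ℕ) (N p r : ℝ) : ℂ :=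
  ∫ t in (1 / 4 : ℝ)..3, (ρ₁ t : ℂ) * osc (-(N * (r * t ^ (n + 1) + p * t)))

theorem measurable_symbolNonstat {ρ₁ : ℝ → ℝ} (hρ : Continuous ρ₁) (n : ℕ) (N : ℝ) :
    Measurable fun z : ℝ × ℝ => symbolNonstat ρ₁ n N z.1 z.2 := by
  have h : Measurable fun y : (ℝ × ℝ) × ℝ => (ρ₁ y.2 : ℂ) *
      osc (-(N * (y.1.2 * y.2 ^ (n + 1) + y.1.1 * y.2))) := by
    have := hρ.measurable
    fun_prop
  unfold symbolNonstat
  simp only [intervalIntegral.integral_of_le (show (1 / 4 : ℝ) ≤ 3 by norm_num)]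
  exact (h.stronglyMeasurable.integral_prod_right').measurable

theorem symbolStat_eq (ρ₁ : ℝ → ℝ) (n : ℕ) (N p r : ℝ) :
    symbolStat ρ₁ n N p r = osc (N * critPhase n p r) * amplitude ρ₁ n N p r := by
  unfold symbolStat amplitude
  rw [← intervalIntegral.integral_const_mul]
  refine intervalIntegral.integral_congr fun t _ => ?_
  simp only [symbolPhase]
  rw [show -(N * (r * t ^ (n + 1) - p * t)) = N * critPhase n p r +
    -(N * (r * t ^ (n + 1) - p * t + critPhase n p r)) by ring, osc_add]
  ring

/-- For positive p and r both terms of the phase increase, so its derivative is at least p ≥ 1/2 and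
one integration by parts gains 1/N. -/
theorem exists_norm_symbolNonstat_le {ρ₁ : ℝ → ℝ} (hρ : ContDiff ℝ ∞ ρ₁)
    (hs : Function.support ρ₁ ⊆ Set.Icc (1 / 2) 2) (n : ℕ) :
    ∃ C : ℝ, 0 ≤ C ∧ ∀ {N p r : ℝ}, 0 < N → p ∈ Set.Icc (1 / 2 : ℝ) 2 →
      r ∈ Set.Icc (1 / 2 : ℝ) 2 → ‖symbolNonstat ρ₁ n N p r‖ ≤ C / N := by
  have h1 : ContDiff ℝ ∞ (deriv ρ₁) := (contDiff_infty_iff_deriv.1 hρ).2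
  have c0 := hρ.continuous
  have c1 := h1.continuous
  have hcomp : IsCompact ((Set.Icc (1 / 2 : ℝ) 2 ×ˢ Set.Icc (1 / 2 : ℝ) 2) ×ˢ
      Set.Icc (1 / 4 : ℝ) 3) := (isCompact_Icc.prod isCompact_Icc).prod isCompact_Icc
  have hq : ∀ {p r t : ℝ}, p ∈ Set.Icc (1 / 2 : ℝ) 2 → r ∈ Set.Icc (1 / 2 : ℝ) 2 →
      t ∈ Set.Icc (1 / 4 : ℝ) 3 → 1 / 2 ≤ r * ((n + 1 : ℕ) * t ^ n) + p := by
    intro p r t hp hr ht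
    have := hr.1
    have := ht.1
    have : 0 ≤ r * ((n + 1 : ℕ) * t ^ n) := by positivity
    linarith [hp.1]
  obtain ⟨K, hK⟩ := hcomp.exists_bound_of_continuousOn
    (f := fun z : (ℝ × ℝ) × ℝ => (((deriv ρ₁ z.2 : ℝ) : ℂ) *
      ((z.1.2 * ((n + 1 : ℕ) * z.2 ^ n) + z.1.1 : ℝ) : ℂ) - (ρ₁ z.2 : ℂ) *
      ((z.1.2 * ((n + 1 : ℕ) * (n * z.2 ^ (n - 1))) : ℝ) : ℂ)) /
      ((z.1.2 * ((n + 1 : ℕ) * z.2 ^ n) + z.1.1 : ℝ) : ℂ) ^ 2) (by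
    refine ContinuousOn.div (by fun_prop) (by fun_prop) fun z hz => pow_ne_zero 2 ?_
    have := hq hz.1.1 hz.1.2 hz.2
    exact_mod_cast (by linarith : (0 : ℝ) < z.1.2 * ((n + 1 : ℕ) * z.2 ^ n) + z.1.1).ne')
  refine ⟨max K 0 * (3 - 1 / 4), by norm_num, ?_⟩
  intro N p r hN hp hr
  have n1 : (1 / 4 : ℝ) ∉ Set.Icc (1 / 2 : ℝ) 2 := fun h => by linarith [h.1]
  have n2 : (3 : ℝ) ∉ Set.Icc (1 / 2 : ℝ) 2 := fun h => by linarith [h.2]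
  have main := (norm_integral_mul_osc_le_of_nonstationary (a := 1 / 4) (b := 3) (B := 1 / 2)
    (K := max K 0) (N := N) (h := fun t => (ρ₁ t : ℂ)) (h' := fun t => ((deriv ρ₁ t : ℝ) : ℂ))
    (Q := fun t => -(r * t ^ (n + 1) + p * t))
    (q := fun t => -(r * ((n + 1 : ℕ) * t ^ n) + p))
    (q' := fun t => -(r * ((n + 1 : ℕ) * (n * t ^ (n - 1)))))
    (by norm_num) (by norm_num) hN
    (fun t _ => (hρ.differentiable (by simp) t).hasDerivAt.ofReal_comp)
    (by fun_prop) (by simp only [eq_zero_of_support_subset hs n1, Complex.ofReal_zero])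
    (by simp only [eq_zero_of_support_subset hs n2, Complex.ofReal_zero])
    (fun t _ => by
      have := (((hasDerivAt_pow (n + 1) t).const_mul r).add ((hasDerivAt_id t).const_mul p)).neg
      refine this.congr_deriv ?_
      simp)
    (fun t _ => ((((hasDerivAt_pow n t).const_mul ((n + 1 : ℕ) : ℝ)).const_mul r).add_const p).neg)
    (by fun_prop)
    (fun t ht => by
      rw [abs_neg]
      exact (hq hp hr ht).trans (le_abs_self _))
    (fun t ht => by
      refine le_trans (le_of_eq ?_) ((hK ((p, r), t) ⟨⟨hp, hr⟩, ht⟩).trans (le_max_left _ _))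
      rw [← norm_neg]
      congr 1
      simp only [Complex.ofReal_neg, neg_sq]
      ring)).2
  unfold symbolNonstat
  refine le_trans (le_of_eq ?_) main
  simp only [mul_neg]

/-- The part of the amplitude that is constant in `p`, spread over `s ∈ [1/2, 2]`. -/
noncomputable def ampConst (ρ₁ : ℝ → ℝ) (n : ℕ) (N : ℝ) (_s r : ℝ) : ℂ :=
  (Set.Icc (1 / 2 : ℝ) 2).indicator (fun r => (2 / 3 : ℂ) * amplitude ρ₁ n N (1 / 2) r) r

/-- The derivative of the amplitude, truncated to the square `[1/2, 2]²`. -/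
noncomputable def ampDeriv (ρ₁ : ℝ → ℝ) (n : ℕ) (N : ℝ) (s r : ℝ) : ℂ :=
  (Set.Icc (1 / 2 : ℝ) 2 ×ˢ Set.Icc (1 / 2 : ℝ) 2).indicator
    (fun z => amplitudeDeriv ρ₁ n N z.1 z.2) (s, r)

/-- The kernel `1_{s ≤ ξ}`. -/
noncomputable def stepKernel (s ξ : ℝ) : ℂ := (Set.Iic ξ).indicator 1 s

theorem measurable_stepKernel : Measurable (Function.uncurry stepKernel) := by
  have : Function.uncurry stepKernel = ({z : ℝ × ℝ | z.1 ≤ z.2}).indicator 1 := by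
    funext z
    simp [Function.uncurry, stepKernel, Set.indicator_apply]
  rw [this]
  exact measurable_one.indicator (measurableSet_le measurable_fst measurable_snd)

theorem norm_stepKernel_le (s ξ : ℝ) : ‖stepKernel s ξ‖ ≤ 1 := by
  unfold stepKernel
  exact (norm_indicator_le_norm_self _ _).trans (by simp)

theorem measurable_ampConst {ρ₁ : ℝ → ℝ} (hρ : Continuous ρ₁) (n : ℕ) (N : ℝ) :
    Measurable (Function.uncurry (ampConst ρ₁ n N)) := by
  have h1 : Measurable fun r => (2 / 3 : ℂ) * amplitude ρ₁ n N (1 / 2) r :=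
    ((measurable_amplitude hρ n N).comp
      (by fun_prop : Measurable fun r : ℝ => ((1 / 2 : ℝ), r))).const_mul _
  exact (h1.indicator measurableSet_Icc).comp measurable_snd

theorem measurable_ampDeriv {ρ₁ : ℝ → ℝ} (hρ : Continuous ρ₁) (n : ℕ) (N : ℝ) :
    Measurable (Function.uncurry (ampDeriv ρ₁ n N)) :=
  (measurable_amplitudeDeriv hρ n N).indicator (measurableSet_Icc.prod measurableSet_Icc)

/-- This separates the variables of the amplitude: in the integral of its derivative over s from 1/2
to p, the upper limit becomes the factor 1_{s ≤ p}, and what remains depends on s and r only. -/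
theorem symbolStat_eq_superposition {ρ₁ : ℝ → ℝ} (hρ : Continuous ρ₁) (n : ℕ) (N : ℝ) {p r : ℝ}
    (hp : p ∈ Set.Icc (1 / 2 : ℝ) 2) (hr : r ∈ Set.Icc (1 / 2 : ℝ) 2) :
    symbolStat ρ₁ n N p r =
      osc (N * critPhase n p r) * (∫ s in Set.Icc (1 / 2 : ℝ) 2, 1 * ampConst ρ₁ n N s r) +
      osc (N * critPhase n p r) *
        ∫ s in Set.Icc (1 / 2 : ℝ) 2, stepKernel s p * ampDeriv ρ₁ n N s r := by
  -- The factor 2/3 in `ampConst` is the reciprocal of the length of [1/2, 2].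
  have e1 : ∫ s in Set.Icc (1 / 2 : ℝ) 2, (1 : ℂ) * ampConst ρ₁ n N s r =
      amplitude ρ₁ n N (1 / 2) r := by
    simp only [ampConst, Set.indicator_of_mem hr, one_mul]
    rw [setIntegral_const, Measure.real, Real.volume_Icc, ENNReal.toReal_ofReal (by norm_num),
      Complex.real_smul]
    push_cast
    ring
  have e2 : ∫ s in Set.Icc (1 / 2 : ℝ) 2, stepKernel s p * ampDeriv ρ₁ n N s r =
      ∫ s in (1 / 2)..p, amplitudeDeriv ρ₁ n N s r := by
    rw [intervalIntegral.integral_of_le hp.1, ← integral_Icc_eq_integral_Ioc,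
      ← integral_indicator measurableSet_Icc, ← integral_indicator measurableSet_Icc]
    congr 1
    funext s
    by_cases hs : s ∈ Set.Icc (1 / 2 : ℝ) p
    · have hs2 : s ∈ Set.Icc (1 / 2 : ℝ) 2 := ⟨hs.1, hs.2.trans hp.2⟩
      rw [Set.indicator_of_mem hs, Set.indicator_of_mem hs2]
      have hm : ((s, r) : ℝ × ℝ) ∈ Set.Icc (1 / 2 : ℝ) 2 ×ˢ Set.Icc (1 / 2 : ℝ) 2 := ⟨hs2, hr⟩
      unfold stepKernel ampDeriv
      rw [Set.indicator_of_mem hm, Set.indicator_of_mem (Set.mem_Iic.2 hs.2)]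
      simp
    · rw [Set.indicator_of_notMem hs]
      by_cases hs2 : s ∈ Set.Icc (1 / 2 : ℝ) 2
      · have hsp : s ∉ Set.Iic p := fun h => hs ⟨hs2.1, h⟩
        rw [Set.indicator_of_mem hs2, stepKernel, Set.indicator_of_notMem hsp, zero_mul]
      · rw [Set.indicator_of_notMem hs2]
  have hr0 : 0 < r := by linarith [hr.1]
  rw [e1, e2, symbolStat_eq, amplitude_eq_add_integral hρ n N hp hr0]
  ring

theorem norm_setIntegral_le_two_mul {f : ℝ → ℂ} {A : ℝ} (hf : ∀ s, ‖f s‖ ≤ A) :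
    ‖∫ s in Set.Icc (1 / 2 : ℝ) 2, f s‖ ≤ 2 * A := by
  have hA : 0 ≤ A := (norm_nonneg _).trans (hf 0)
  refine (norm_setIntegral_le_of_norm_le_const (by simp) fun s _ => hf s).trans ?_
  rw [Measure.real, Real.volume_Icc, ENNReal.toReal_ofReal (by norm_num)]
  linarith

set_option maxHeartbeats 1000000 in
/-- Symbols `e^{iNφ}` times an amplitude inherit the bounds of `e^{iNφ}`, in both orders of the
variables. -/
theorem exists_bilinBound_symbolStat_of_osc {ρ₁ : ℝ → ℝ} (hρ : ContDiff ℝ ∞ ρ₁)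
    (hs : Function.support ρ₁ ⊆ Set.Icc (1 / 2) 2) {n : ℕ} (hn : 1 ≤ n) :
    ∃ C : ℝ, 0 ≤ C ∧ ∀ {N ε : ℝ} {K : ℝ≥0∞}, 0 < N →
      (BilinBound (fun ξ η => osc (N * critPhase n ξ η)) ε K →
        BilinBound (symbolStat ρ₁ n N) ε (ENNReal.ofReal (C / N) * K)) ∧
      (BilinBound (fun ξ η => osc (N * critPhase n η ξ)) ε K →
        BilinBound (fun ξ η => symbolStat ρ₁ n N η ξ) ε (ENNReal.ofReal (C / N) * K)) := by
  obtain ⟨C₁, hC₁, hb₁⟩ := exists_norm_amplitude_le hρ hs hn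
  obtain ⟨C₂, hC₂, hb₂⟩ := exists_norm_amplitudeDeriv_le hρ hs hn
  set C := max C₁ C₂ with hC
  have hC0 : 0 ≤ C := hC₁.trans (le_max_left _ _)
  refine ⟨16 * C ^ 2, by positivity, ?_⟩
  intro N ε K hN
  have hsN : 0 < √N := Real.sqrt_pos.2 hN
  set A : ℝ := C / √N with hA
  have hA0 : 0 ≤ A := by positivity
  have half : (1 / 2 : ℝ) ∈ Set.Icc (1 / 2 : ℝ) 2 := by norm_num
  have hc : ∀ s r, ‖ampConst ρ₁ n N s r‖ ≤ A := by
    intro s r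
    unfold ampConst
    by_cases hr : r ∈ Set.Icc (1 / 2 : ℝ) 2
    · rw [Set.indicator_of_mem hr, norm_mul]
      have h1 : ‖amplitude ρ₁ n N (1 / 2) r‖ ≤ A :=
        (hb₁ hN half hr).trans (by rw [hA]; gcongr; exact le_max_left _ _)
      have h2 : ‖(2 / 3 : ℂ)‖ ≤ 1 := by norm_num
      calc _ ≤ 1 * A := by gcongr
        _ = A := one_mul _
    · rw [Set.indicator_of_notMem hr, norm_zero]; exact hA0
  have hd : ∀ s r, ‖ampDeriv ρ₁ n N s r‖ ≤ A := by
    intro s r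
    unfold ampDeriv
    by_cases hr : ((s, r) : ℝ × ℝ) ∈ Set.Icc (1 / 2 : ℝ) 2 ×ˢ Set.Icc (1 / 2 : ℝ) 2
    · rw [Set.indicator_of_mem hr]
      exact (hb₂ hN hr.1 hr.2).trans (by rw [hA]; gcongr; exact le_max_right _ _)
    · rw [Set.indicator_of_notMem hr, norm_zero]; exact hA0
  -- Two superpositions, each costing 4A², added with a factor 2 each. As A² = C²/N, this is where
  -- the squared norm gains 1/N.
  have hKeq : 2 * (4 * ENNReal.ofReal A ^ 2 * K) + 2 * (4 * ENNReal.ofReal A ^ 2 * K) =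
      ENNReal.ofReal (16 * C ^ 2 / N) * K := by
    have : 16 * C ^ 2 / N = 16 * A ^ 2 := by
      rw [hA, div_pow, Real.sq_sqrt hN.le, mul_div_assoc]
    rw [this, ENNReal.ofReal_mul (by norm_num), ENNReal.ofReal_pow hA0]
    rw [show ENNReal.ofReal 16 = 16 by simp]
    ring
  have mc := measurable_ampConst hρ.continuous n N
  have md := measurable_ampDeriv hρ.continuous n N
  have m1 : Measurable (Function.uncurry fun (_ _ : ℝ) => (1 : ℂ)) := measurable_const
  have mO := measurable_critPhase n
  have mM : Measurable (Function.uncurry fun ξ η => osc (N * critPhase n ξ η)) :=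
    measurable_osc.comp (mO.const_mul N)
  have mMt : Measurable (Function.uncurry fun ξ η => osc (N * critPhase n η ξ)) :=
    mM.comp measurable_swap
  have mint : ∀ {k l : ℝ → ℝ → ℂ}, Measurable (Function.uncurry k) →
      Measurable (Function.uncurry l) → Measurable (Function.uncurry fun ξ η =>
        ∫ s in Set.Icc (1 / 2 : ℝ) 2, k s ξ * l s η) := by
    intro k l hk hl
    have h : Measurable fun y : (ℝ × ℝ) × ℝ => k y.2 y.1.1 * l y.2 y.1.2 :=
      (hk.comp (by fun_prop : Measurable fun y : (ℝ × ℝ) × ℝ => (y.2, y.1.1))).mul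
        (hl.comp (by fun_prop : Measurable fun y : (ℝ × ℝ) × ℝ => (y.2, y.1.2)))
    exact (h.stronglyMeasurable.integral_prod_right').measurable
  have nb : ∀ {x A' : ℝ} {f : ℝ → ℂ}, (∀ s, ‖f s‖ ≤ A') →
      ‖osc x * ∫ s in Set.Icc (1 / 2 : ℝ) 2, f s‖ ≤ 2 * A' := by
    intro x A' f hf
    rw [norm_mul, norm_osc, one_mul]
    exact norm_setIntegral_le_two_mul hf
  have p1 : ∀ s ξ r, ‖(1 : ℂ) * ampConst ρ₁ n N s r‖ ≤ A ∧
      ‖stepKernel s ξ * ampDeriv ρ₁ n N s r‖ ≤ A := fun s ξ r =>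
    ⟨by rw [one_mul]; exact hc s r, by
      rw [norm_mul]
      calc _ ≤ 1 * A := by
            gcongr
            · exact norm_stepKernel_le s ξ
            · exact hd s r
        _ = A := one_mul _⟩
  constructor
  · intro h
    have s1 := h.superpose mM (B := 1) (fun ξ _ η _ => (norm_osc _).le) m1 mc (A₁ := 1)
      (by simp) hc
    have s2 := h.superpose mM (B := 1) (fun ξ _ η _ => (norm_osc _).le) measurable_stepKernel md
      norm_stepKernel_le hd
    rw [one_mul] at s1 s2
    have s3 := s1.add s2 (mM.mul (mint m1 mc)) (mM.mul (mint measurable_stepKernel md))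
      (B := 2 * A) (B' := 2 * A) (fun ξ _ η _ => nb fun s => (p1 s ξ η).1)
      (fun ξ _ η _ => nb fun s => (p1 s ξ η).2)
    rw [hKeq] at s3
    exact s3.congr fun ξ hξ η hη => (symbolStat_eq_superposition hρ.continuous n N hξ hη).symm
  · intro h
    have s1 := h.superpose mMt (B := 1) (fun ξ _ η _ => (norm_osc _).le) mc m1 (A₂ := 1)
      hc (by simp)
    have s2 := h.superpose mMt (B := 1) (fun ξ _ η _ => (norm_osc _).le) md measurable_stepKernel
      hd norm_stepKernel_le
    rw [mul_one] at s1 s2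
    have s3 := s1.add s2 (mMt.mul (mint mc m1)) (mMt.mul (mint md measurable_stepKernel))
      (B := 2 * A) (B' := 2 * A)
      (fun ξ _ η _ => nb fun s => by rw [mul_comm]; exact (p1 s η ξ).1)
      (fun ξ _ η _ => nb fun s => by rw [mul_comm]; exact (p1 s η ξ).2)
    rw [hKeq] at s3
    refine s3.congr fun ξ hξ η hη => ?_
    rw [symbolStat_eq_superposition hρ.continuous n N hη hξ]
    simp only [mul_comm]

/-- Both orders of the variables in the bound for the symbol with a critical point. -/
theorem exists_bilinBound_symbolStat {ρ₁ : ℝ → ℝ} (hρ : ContDiff ℝ ∞ ρ₁)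
    (hs : Function.support ρ₁ ⊆ Set.Icc (1 / 2) 2) {n : ℕ} (hn : 1 ≤ n) :
    ∃ C : ℝ, 0 ≤ C ∧ ∀ {N ε : ℝ}, 0 < N → ε ≠ 0 → 12 * (n + 1) * |ε| ≤ 1 → 1 ≤ |ε| * N →
      BilinBound (symbolStat ρ₁ n N) ε
        (ENNReal.ofReal (C / N * (1 / (|ε| * N)) ^ (1 / 4 : ℝ))) ∧
      BilinBound (fun ξ η => symbolStat ρ₁ n N η ξ) ε
        (ENNReal.ofReal (C / N * (1 / (|ε| * N)) ^ (1 / 4 : ℝ))) := by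
  have hn' : (1 : ℝ) ≤ n := by exact_mod_cast hn
  have hn0 : (0 : ℝ) < n := by linarith
  have hni : 0 < (n : ℝ)⁻¹ := by positivity
  obtain ⟨C, hC, hsup⟩ := exists_bilinBound_symbolStat_of_osc hρ hs hn
  obtain ⟨C₁, hC₁, hosc₁⟩ := exists_energy_bilinSymbol_osc_le (p := 1 + (n : ℝ)⁻¹)
    (by positivity) (by simpa using hn0.ne')
  obtain ⟨C₂, hC₂, hosc₂⟩ := exists_energy_bilinSymbol_osc_le (p := -(n : ℝ)⁻¹)
    (by simpa using hn0.ne') (by linarith)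
  set κ := legendreConst n with hκ
  have hκ0 : 0 < κ := legendreConst_pos n
  refine ⟨C * ((C₁ + C₂) * (1 + √(1 / κ))), by positivity, ?_⟩
  intro N ε hN hε hεn hεN
  have hε0 : 0 < |ε| := abs_pos.2 hε
  set x : ℝ := 1 / (|ε| * N) with hx
  have hx0 : 0 < x := by positivity
  have hx1 : x ≤ 1 := by rw [hx, div_le_one (by positivity)]; exact hεN
  -- Choice τ₀ = √x with x = 1/(|ε|N): the second term is then a multiple of x^(1/4), and it
  -- dominates the first because x ≤ 1.
  have hτ : √x + √(1 / (|ε| * (N * κ) * √x)) ≤ (1 + √(1 / κ)) * x ^ (1 / 4 : ℝ) := by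
    have e1 : √x ≤ x ^ (1 / 4 : ℝ) := by
      rw [Real.sqrt_eq_rpow]
      exact Real.rpow_le_rpow_of_exponent_ge hx0 hx1 (by norm_num)
    have e2 : √(1 / (|ε| * (N * κ) * √x)) = √(1 / κ) * x ^ (1 / 4 : ℝ) := by
      have h1 : x ^ (1 / 4 : ℝ) = √(√x) := by
        rw [Real.sqrt_eq_rpow, Real.sqrt_eq_rpow, ← Real.rpow_mul hx0.le]; norm_num
      have h2 : √x * √x = x := Real.mul_self_sqrt hx0.le
      have h3 : 0 < √x := Real.sqrt_pos.2 hx0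
      rw [h1, ← Real.sqrt_mul (by positivity)]
      congr 1
      have h4 : |ε| * N * x = 1 := by rw [hx]; field_simp
      rw [div_mul_eq_mul_div, one_mul, div_eq_div_iff (by positivity) (by positivity)]
      calc 1 * κ = κ * (|ε| * N * x) := by rw [h4]; ring
        _ = _ := by linear_combination (-(κ * |ε| * N)) * h2
    rw [e2, add_mul, one_mul]
    gcongr
  have hKle : ∀ {C' : ℝ}, 0 ≤ C' → C' ≤ C₁ + C₂ →
      ENNReal.ofReal (C / N) * ENNReal.ofReal (C' * (√x + √(1 / (|ε| * (N * κ) * √x)))) ≤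
      ENNReal.ofReal (C * ((C₁ + C₂) * (1 + √(1 / κ))) / N * x ^ (1 / 4 : ℝ)) := by
    intro C' h0 h1
    rw [← ENNReal.ofReal_mul (by positivity)]
    refine ENNReal.ofReal_le_ofReal ?_
    calc C / N * (C' * (√x + √(1 / (|ε| * (N * κ) * √x)))) ≤
        C / N * ((C₁ + C₂) * ((1 + √(1 / κ)) * x ^ (1 / 4 : ℝ))) := by gcongr
      _ = _ := by ring
  have hτ0 : 0 < √x := Real.sqrt_pos.2 hx0
  constructor
  · refine ((hsup (K := ENNReal.ofReal (C₁ * (√x + √(1 / (|ε| * (N * κ) * √x))))) hN).1 ?_).mono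
      (hKle hC₁ (by linarith))
    intro u v hu hv hus hvs hEu hEv
    -- For p = 1 + 1/n the smallness condition 12|ε||p| ≤ |p - 1| is exactly 12(n + 1)|ε| ≤ 1. The
    -- transposed phase below has exponent -1/n, where the condition is weaker.
    have := hosc₁ (ε := ε) (μ := N * κ) (τ₀ := √x) hε (by
      rw [add_sub_cancel_left, abs_of_pos hni,
        abs_of_pos (show (0 : ℝ) < 1 + (n : ℝ)⁻¹ by positivity)]
      have e : 12 * (|ε| * (1 + (n : ℝ)⁻¹)) = 12 * (n + 1) * |ε| * (n : ℝ)⁻¹ := by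
        field_simp
      rw [e]
      exact mul_le_of_le_one_left hni.le hεn) (by positivity) hτ0 hu hv hus hvs hEu hEv
    have e : (fun ξ η => osc (N * critPhase n ξ η)) =
        fun ξ η => osc (N * κ * (ξ ^ (1 + (n : ℝ)⁻¹) * η ^ (1 - (1 + (n : ℝ)⁻¹)))) := by
      funext ξ η
      rw [critPhase, ← mul_assoc, show 1 - (1 + (n : ℝ)⁻¹) = -(n : ℝ)⁻¹ by ring]
    rw [e]
    exact this
  · refine ((hsup (K := ENNReal.ofReal (C₂ * (√x + √(1 / (|ε| * (N * κ) * √x))))) hN).2 ?_).mono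
      (hKle hC₂ (by linarith))
    intro u v hu hv hus hvs hEu hEv
    have := hosc₂ (ε := ε) (μ := N * κ) (τ₀ := √x) hε (by
      rw [abs_neg, abs_of_pos hni, show -(n : ℝ)⁻¹ - 1 = -(1 + (n : ℝ)⁻¹) by ring, abs_neg,
        abs_of_pos (show (0 : ℝ) < 1 + (n : ℝ)⁻¹ by positivity)]
      have h1 : (n : ℝ)⁻¹ ≤ 1 := inv_le_one_of_one_le₀ hn'
      have h2 : 12 * |ε| ≤ 1 := by nlinarith
      nlinarith) (by positivity) hτ0 hu hv hus hvs hEu hEv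
    have e : (fun ξ η => osc (N * critPhase n η ξ)) =
        fun ξ η => osc (N * κ * (ξ ^ (-(n : ℝ)⁻¹) * η ^ (1 - -(n : ℝ)⁻¹))) := by
      funext ξ η
      rw [critPhase, ← mul_assoc, show 1 - -(n : ℝ)⁻¹ = 1 + (n : ℝ)⁻¹ by ring]
      congr 1
      ring
    rw [e]
    exact this

/-! ### Frequencies of both signs -/

/-- Functions supported in the annulus `1/2 ≤ |x| ≤ 2`. -/
def AnnulusSupp (u : ℝ → ℂ) : Prop := ∀ x, u x ≠ 0 → |x| ∈ Set.Icc (1 / 2 : ℝ) 2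

theorem AnnulusSupp.integrable {u : ℝ → ℂ} (hs : AnnulusSupp u) (hu : Measurable u)
    (hE : energy u ≠ ⊤) : Integrable u :=
  integrable_of_energy hu hE fun x hx => abs_le.1 (hs x hx).2

theorem lintegral_lintegral_mul_comp_sub (ε : ℝ) {u v : ℝ → ℂ} (hu : Measurable u)
    (hv : Measurable v) :
    ∫⁻ ζ, ∫⁻ ξ, ‖u ξ * v (ζ - ε * ξ)‖ₑ = (∫⁻ ξ, ‖u ξ‖ₑ) * ∫⁻ η, ‖v η‖ₑ := by
  rw [lintegral_lintegral_swap (by fun_prop)]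
  simp only [enorm_mul]
  rw [← lintegral_mul_const _ (by fun_prop)]
  refine lintegral_congr fun ξ => ?_
  rw [lintegral_const_mul _ (by fun_prop), lintegral_sub_right_eq_self (fun x => ‖v x‖ₑ)]

theorem ae_integrable_mul_comp_sub (ε : ℝ) {u v : ℝ → ℂ} (hu : Measurable u) (hv : Measurable v)
    (hui : Integrable u) (hvi : Integrable v) :
    ∀ᵐ ζ : ℝ, Integrable fun ξ => u ξ * v (ζ - ε * ξ) := by
  have hm : Measurable fun ζ => ∫⁻ ξ, ‖u ξ * v (ζ - ε * ξ)‖ₑ :=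
    Measurable.lintegral_prod_right' (f := fun z : ℝ × ℝ => ‖u z.2 * v (z.1 - ε * z.2)‖ₑ)
      (by fun_prop)
  have hfin : ∫⁻ ζ, ∫⁻ ξ, ‖u ξ * v (ζ - ε * ξ)‖ₑ ≠ ⊤ := by
    rw [lintegral_lintegral_mul_comp_sub ε hu hv]
    exact (ENNReal.mul_lt_top hui.2 hvi.2).ne
  filter_upwards [ae_lt_top hm hfin] with ζ hζ
  exact ⟨by fun_prop, hζ⟩

theorem ae_integrable_symbol {M : ℝ → ℝ → ℂ} (hM : Measurable (Function.uncurry M)) {B : ℝ}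
    (hB : ∀ ξ η, ‖M ξ η‖ ≤ B) (ε : ℝ) {u v : ℝ → ℂ} (hu : Measurable u) (hv : Measurable v)
    (hui : Integrable u) (hvi : Integrable v) :
    ∀ᵐ ζ : ℝ, Integrable fun ξ => u ξ * v (ζ - ε * ξ) * M ξ (ζ - ε * ξ) := by
  filter_upwards [ae_integrable_mul_comp_sub ε hu hv hui hvi] with ζ hζ
  refine hζ.mul_bdd (c := B) ?_ (Filter.Eventually.of_forall fun ξ => hB _ _)
  exact (hM.comp (g := Function.uncurry M) (f := fun ξ : ℝ => (ξ, ζ - ε * ξ))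
    (by fun_prop)).aestronglyMeasurable

/-- Reflecting the two frequencies separately changes ε into σ₁σ₂ε in the relation ζ = εξ + η. This
is why the earlier bounds allow negative ε. -/
theorem bilinSymbol_reflect (M : ℝ → ℝ → ℂ) (ε : ℝ) (u v : ℝ → ℂ) {σ₁ σ₂ : ℝ}
    (h₁ : σ₁ = 1 ∨ σ₁ = -1) (h₂ : σ₂ = 1 ∨ σ₂ = -1) (ζ : ℝ) :
    bilinSymbol M ε (fun x => u (σ₁ * x)) (fun x => v (σ₂ * x)) ζ =
      bilinSymbol (fun ξ η => M (σ₁ * ξ) (σ₂ * η)) (σ₁ * σ₂ * ε) u v (σ₂ * ζ) := by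
  have hσ : σ₂ * σ₂ = 1 := by rcases h₂ with rfl | rfl <;> norm_num
  unfold bilinSymbol
  rcases h₁ with rfl | rfl
  · refine integral_congr_ae (Filter.Eventually.of_forall fun ξ => ?_)
    have e1 : σ₂ * ζ - 1 * σ₂ * ε * ξ = σ₂ * (ζ - ε * ξ) := by ring
    have e2 : σ₂ * (σ₂ * (ζ - ε * ξ)) = ζ - ε * ξ := by rw [← mul_assoc, hσ, one_mul]
    dsimp only
    rw [e1, e2, one_mul]
  · rw [← integral_neg_eq_self]
    refine integral_congr_ae (Filter.Eventually.of_forall fun ξ => ?_)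
    have e1 : σ₂ * ζ - -1 * σ₂ * ε * ξ = σ₂ * (ζ - ε * -ξ) := by ring
    have e2 : σ₂ * (σ₂ * (ζ - ε * -ξ)) = ζ - ε * -ξ := by rw [← mul_assoc, hσ, one_mul]
    dsimp only
    rw [e1, e2]
    simp only [neg_mul, one_mul, neg_neg]

theorem energy_comp_sign {σ : ℝ} (h : σ = 1 ∨ σ = -1) (w : ℝ → ℂ) :
    energy (fun x => w (σ * x)) = energy w := by
  unfold energy
  rcases h with rfl | rfl
  · simp
  · simp only [neg_mul, one_mul]
    exact lintegral_neg_eq_self (fun x => ‖w x‖ₑ ^ 2)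

/-- The part of `u` on the half line of sign `σ`, moved to the positive half line. -/
noncomputable def signPart (σ : ℝ) (u : ℝ → ℂ) : ℝ → ℂ :=
  (Set.Ioi (0 : ℝ)).indicator fun p => u (σ * p)

theorem signPart_add_signPart {u : ℝ → ℂ} (hs : AnnulusSupp u) (x : ℝ) :
    signPart 1 u (1 * x) + signPart (-1) u (-1 * x) = u x := by
  unfold signPart
  rcases lt_trichotomy x 0 with h | h | h
  · have h2 : -1 * x ∈ Set.Ioi (0 : ℝ) := by simpa using h
    rw [Set.indicator_of_notMem (by simpa using h.le), Set.indicator_of_mem h2]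
    simp
  · have : u x = 0 := by
      by_contra h0
      have := (hs x h0).1
      rw [h, abs_zero] at this
      norm_num at this
    rw [this, h]
    simp
  · rw [Set.indicator_of_mem (by simpa using h), Set.indicator_of_notMem (by simpa using h.le)]
    simp

theorem measurable_signPart (σ : ℝ) {u : ℝ → ℂ} (hu : Measurable u) : Measurable (signPart σ u) :=
  (hu.comp (by fun_prop : Measurable fun p : ℝ => σ * p)).indicator measurableSet_Ioi

theorem freqSupp_signPart {σ : ℝ} (h : σ = 1 ∨ σ = -1) {u : ℝ → ℂ} (hs : AnnulusSupp u) :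
    FreqSupp (signPart σ u) := by
  intro x hx
  have hx0 : x ∈ Set.Ioi (0 : ℝ) := Set.mem_of_indicator_ne_zero hx
  rw [signPart, Set.indicator_of_mem hx0] at hx
  have := hs _ hx
  have hσ : |σ| = 1 := by rcases h with rfl | rfl <;> norm_num
  rwa [abs_mul, hσ, one_mul, abs_of_pos hx0] at this

theorem energy_signPart_le {σ : ℝ} (h : σ = 1 ∨ σ = -1) (u : ℝ → ℂ) :
    energy (signPart σ u) ≤ energy u := by
  rw [← energy_comp_sign h u]
  refine lintegral_mono fun x => ?_
  gcongr
  exact enorm_indicator_le_enorm_self _ _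

/-- The four quadrant bounds give the bound on the annulus. -/
theorem energy_bilinSymbol_le_of_quadrants {M : ℝ → ℝ → ℂ} (hM : Measurable (Function.uncurry M))
    {B : ℝ} (hB : ∀ ξ η, ‖M ξ η‖ ≤ B) {ε : ℝ} {K : ℝ≥0∞}
    (hq : ∀ σ₁ σ₂ : ℝ, (σ₁ = 1 ∨ σ₁ = -1) → (σ₂ = 1 ∨ σ₂ = -1) →
      BilinBound (fun ξ η => M (σ₁ * ξ) (σ₂ * η)) (σ₁ * σ₂ * ε) K)
    {u v : ℝ → ℂ} (hu : Measurable u) (hv : Measurable v) (hus : AnnulusSupp u)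
    (hvs : AnnulusSupp v) (hEu : energy u ≠ ⊤) (hEv : energy v ≠ ⊤) :
    energy (bilinSymbol M ε u v) ≤ 16 * K * (energy u * energy v) := by
  have o1 : (1 : ℝ) = 1 ∨ (1 : ℝ) = -1 := Or.inl rfl
  have o2 : (-1 : ℝ) = 1 ∨ (-1 : ℝ) = -1 := Or.inr rfl
  obtain ⟨U, hU⟩ : ∃ U : ℝ → ℝ → ℂ, ∀ σ, U σ = fun x => signPart σ u (σ * x) := ⟨_, fun _ => rfl⟩
  obtain ⟨V, hV⟩ : ∃ V : ℝ → ℝ → ℂ, ∀ σ, V σ = fun x => signPart σ v (σ * x) := ⟨_, fun _ => rfl⟩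
  have hUm : ∀ σ, Measurable (U σ) := fun σ => by
    rw [hU]; exact (measurable_signPart σ hu).comp (by fun_prop)
  have hVm : ∀ σ, Measurable (V σ) := fun σ => by
    rw [hV]; exact (measurable_signPart σ hv).comp (by fun_prop)
  have fin : ∀ {w : ℝ → ℂ}, energy w ≠ ⊤ → ∀ {σ : ℝ}, (σ = 1 ∨ σ = -1) →
      energy (signPart σ w) ≠ ⊤ := fun hw σ hσ => ne_top_of_le_ne_top hw (energy_signPart_le hσ _)
  have hint : ∀ {w : ℝ → ℂ}, Measurable w → AnnulusSupp w → energy w ≠ ⊤ → ∀ {σ : ℝ},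
      (σ = 1 ∨ σ = -1) → Integrable (fun x => signPart σ w (σ * x)) := by
    intro w hw hws hwE σ hσ
    refine integrable_of_energy (a := -2) (b := 2) ((measurable_signPart σ hw).comp (by fun_prop))
      (by rw [energy_comp_sign hσ]; exact fin hwE hσ) fun x hx => ?_
    have h1 := (freqSupp_signPart hσ hws _ hx)
    rcases hσ with rfl | rfl
    · constructor <;> linarith [h1.1, h1.2]
    · constructor <;> linarith [h1.1, h1.2]
  have hUi : ∀ σ : ℝ, (σ = 1 ∨ σ = -1) → Integrable (U σ) := fun σ hσ => by
    rw [hU]; exact hint hu hus hEu hσ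
  have hVi : ∀ σ : ℝ, (σ = 1 ∨ σ = -1) → Integrable (V σ) := fun σ hσ => by
    rw [hV]; exact hint hv hvs hEv hσ
  have hterm : ∀ σ₁ σ₂ : ℝ, (σ₁ = 1 ∨ σ₁ = -1) → (σ₂ = 1 ∨ σ₂ = -1) →
      energy (bilinSymbol M ε (U σ₁) (V σ₂)) ≤ K * (energy u * energy v) := by
    intro σ₁ σ₂ h₁ h₂
    have e : bilinSymbol M ε (U σ₁) (V σ₂) = fun ζ =>
        bilinSymbol (fun ξ η => M (σ₁ * ξ) (σ₂ * η)) (σ₁ * σ₂ * ε) (signPart σ₁ u) (signPart σ₂ v)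
          (σ₂ * ζ) := by
      funext ζ
      rw [hU, hV, bilinSymbol_reflect M ε _ _ h₁ h₂]
    rw [e, energy_comp_sign h₂]
    refine (hq σ₁ σ₂ h₁ h₂ _ _ (measurable_signPart _ hu) (measurable_signPart _ hv)
      (freqSupp_signPart h₁ hus) (freqSupp_signPart h₂ hvs) (fin hEu h₁) (fin hEv h₂)).trans ?_
    gcongr
    · exact energy_signPart_le h₁ u
    · exact energy_signPart_le h₂ v
  have hae : bilinSymbol M ε u v =ᵐ[volume]
      (bilinSymbol M ε (U 1) (V 1) + bilinSymbol M ε (U 1) (V (-1))) +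
      (bilinSymbol M ε (U (-1)) (V 1) + bilinSymbol M ε (U (-1)) (V (-1))) := by
    filter_upwards [ae_integrable_symbol hM hB ε (hUm 1) (hVm 1) (hUi 1 o1) (hVi 1 o1),
      ae_integrable_symbol hM hB ε (hUm 1) (hVm (-1)) (hUi 1 o1) (hVi (-1) o2),
      ae_integrable_symbol hM hB ε (hUm (-1)) (hVm 1) (hUi (-1) o2) (hVi 1 o1),
      ae_integrable_symbol hM hB ε (hUm (-1)) (hVm (-1)) (hUi (-1) o2) (hVi (-1) o2)]
      with ζ i1 i2 i3 i4
    simp only [bilinSymbol, Pi.add_apply]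
    rw [← integral_add i1 i2, ← integral_add i3 i4]
    refine Eq.trans ?_ (integral_add (i1.add i2) (i3.add i4))
    refine integral_congr_ae (Filter.Eventually.of_forall fun ξ => ?_)
    have a1 : u ξ = U 1 ξ + U (-1) ξ := by rw [hU, hU]; exact (signPart_add_signPart hus ξ).symm
    have a2 : v (ζ - ε * ξ) = V 1 (ζ - ε * ξ) + V (-1) (ζ - ε * ξ) := by
      rw [hV, hV]; exact (signPart_add_signPart hvs _).symm
    simp only [a1, a2]
    ring
  have hm : ∀ σ₁ σ₂, Measurable (bilinSymbol M ε (U σ₁) (V σ₂)) := fun σ₁ σ₂ =>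
    measurable_bilinSymbol hM ε (hUm _) (hVm _)
  rw [energy_congr_ae hae]
  refine (energy_add_le ((hm _ _).add (hm _ _))).trans ?_
  -- Two nested uses of |a + b|² ≤ 2|a|² + 2|b|² give each of the four quadrants the weight 4, hence
  -- 16 in total.
  refine (add_le_add (mul_le_mul_right (energy_add_le (hm _ _)) _)
    (mul_le_mul_right (energy_add_le (hm _ _)) _)).trans ?_
  have := hterm 1 1 o1 o1
  have := hterm 1 (-1) o1 o2
  have := hterm (-1) 1 o2 o1
  have := hterm (-1) (-1) o2 o2
  calc _ ≤ 2 * (2 * (K * (energy u * energy v)) + 2 * (K * (energy u * energy v))) +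
        2 * (2 * (K * (energy u * energy v)) + 2 * (K * (energy u * energy v))) := by gcongr
    _ = _ := by ring

/-! ### The symbol of the curve -/

theorem BilinBound.neg {M : ℝ → ℝ → ℂ} {ε : ℝ} {K : ℝ≥0∞} (h : BilinBound M ε K) :
    BilinBound (fun ξ η => -M ξ η) ε K := by
  intro u v hu hv hus hvs hEu hEv
  have e : energy (bilinSymbol (fun ξ η => -M ξ η) ε u v) = energy (bilinSymbol M ε u v) := by
    simp only [energy, bilinSymbol, mul_neg, integral_neg, enorm_neg]
  rw [e]
  exact h u v hu hv hus hvs hEu hEv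

theorem symbolStat_eq_symbolNonstat (ρ₁ : ℝ → ℝ) (n : ℕ) (N p r : ℝ) :
    symbolStat ρ₁ n N p r = symbolNonstat ρ₁ n N (-p) r := by
  simp only [symbolStat, symbolNonstat, neg_mul, sub_eq_add_neg]

theorem conj_symbolNonstat (ρ₁ : ℝ → ℝ) (n : ℕ) (N p r : ℝ) :
    starRingEnd ℂ (symbolNonstat ρ₁ n N p r) = symbolNonstat ρ₁ n N (-p) (-r) := by
  unfold symbolNonstat
  rw [intervalIntegral.integral_of_le (by norm_num), intervalIntegral.integral_of_le (by norm_num),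
    ← integral_conj]
  refine integral_congr_ae (Filter.Eventually.of_forall fun t => ?_)
  simp only [map_mul, Complex.conj_ofReal, conj_osc]
  congr 2
  ring

theorem exists_norm_symbolNonstat_le_const {ρ₁ : ℝ → ℝ} (hρ : Continuous ρ₁) :
    ∃ B : ℝ, ∀ n N p r, ‖symbolNonstat ρ₁ n N p r‖ ≤ B := by
  obtain ⟨A, hA⟩ := isCompact_Icc.exists_bound_of_continuousOn (s := Set.Icc (1 / 4 : ℝ) 3)
    hρ.continuousOn
  refine ⟨A * |3 - 1 / 4|, fun n N p r => ?_⟩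
  refine intervalIntegral.norm_integral_le_of_norm_le_const fun t ht => ?_
  rw [norm_mul, norm_osc, mul_one, Complex.norm_real]
  rw [Set.uIoc_of_le (by norm_num)] at ht
  exact hA t ⟨ht.1.le, ht.2⟩

/-- Equal signs give the symbol without critical point or its complex conjugate; opposite signs give
`symbolStat` or its conjugate. -/
theorem exists_bilinBound_symbolNonstat {ρ₁ : ℝ → ℝ} (hρ : ContDiff ℝ ∞ ρ₁)
    (hs : Function.support ρ₁ ⊆ Set.Icc (1 / 2) 2) {n : ℕ} (hn : 1 ≤ n) :
    ∃ C : ℝ, 0 ≤ C ∧ ∀ {N ε : ℝ}, 1 ≤ N → ε ≠ 0 → 12 * (n + 1) * |ε| ≤ 1 → 1 ≤ |ε| * N →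
      ∀ σ₁ σ₂ : ℝ, (σ₁ = 1 ∨ σ₁ = -1) → (σ₂ = 1 ∨ σ₂ = -1) →
      BilinBound (fun ξ η => symbolNonstat ρ₁ n N (σ₁ * ξ) (σ₂ * η)) ε
        (ENNReal.ofReal (C / N * (1 / (|ε| * N)) ^ (1 / 4 : ℝ))) ∧
      BilinBound (fun ξ η => symbolNonstat ρ₁ n N (σ₁ * η) (σ₂ * ξ)) ε
        (ENNReal.ofReal (C / N * (1 / (|ε| * N)) ^ (1 / 4 : ℝ))) := by
  obtain ⟨C₁, hC₁, h₁⟩ := exists_bilinBound_symbolStat hρ hs hn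
  obtain ⟨C₂, hC₂, h₂⟩ := exists_norm_symbolNonstat_le hρ hs n
  refine ⟨max C₁ (2 * C₂ ^ 2), le_max_of_le_left hC₁, ?_⟩
  intro N ε hN hε hεn hεN
  have hN0 : 0 < N := by linarith
  have hε0 : 0 < |ε| := abs_pos.2 hε
  have hn' : (1 : ℝ) ≤ n := by exact_mod_cast hn
  have hε1 : |ε| ≤ 1 := by nlinarith
  obtain ⟨b1, b2⟩ := h₁ hN0 hε hεn hεN
  obtain ⟨K, hK⟩ : ∃ K, K = ENNReal.ofReal
    (max C₁ (2 * C₂ ^ 2) / N * (1 / (|ε| * N)) ^ (1 / 4 : ℝ)) := ⟨_, rfl⟩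
  have hle : ENNReal.ofReal (C₁ / N * (1 / (|ε| * N)) ^ (1 / 4 : ℝ)) ≤ K := by
    rw [hK]
    refine ENNReal.ofReal_le_ofReal ?_
    gcongr
    exact le_max_left _ _
  have hle2 : 2 * ENNReal.ofReal (C₂ / N) ^ 2 ≤ K := by
    rw [hK, ← ENNReal.ofReal_pow (by positivity), show (2 : ℝ≥0∞) = ENNReal.ofReal 2 by simp,
      ← ENNReal.ofReal_mul (by norm_num)]
    refine ENNReal.ofReal_le_ofReal ?_
    -- The supremum bound C₂/N gives a squared norm of order N⁻², which is smaller than the target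
    -- N⁻¹(|ε|N)^(-1/4).
    have hx : 1 / N ≤ (1 / (|ε| * N)) ^ (1 / 4 : ℝ) := by
      have h0 : 1 / (|ε| * N) ≤ 1 := by rw [div_le_one (by positivity)]; exact hεN
      calc 1 / N ≤ 1 / (|ε| * N) := by
            apply one_div_le_one_div_of_le (by positivity)
            exact mul_le_of_le_one_left hN0.le hε1
        _ = (1 / (|ε| * N)) ^ (1 : ℝ) := (Real.rpow_one _).symm
        _ ≤ _ := Real.rpow_le_rpow_of_exponent_ge (by positivity) h0 (by norm_num)
    calc 2 * (C₂ / N) ^ 2 = 2 * C₂ ^ 2 / N * (1 / N) := by field_simp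
      _ ≤ _ := by gcongr; exact le_max_right _ _
  rw [← hK]
  replace b1 := b1.mono hle
  replace b2 := b2.mono hle
  have bd : ∀ ξ ∈ Set.Icc (1 / 2 : ℝ) 2, ∀ η ∈ Set.Icc (1 / 2 : ℝ) 2,
      ‖symbolNonstat ρ₁ n N ξ η‖ₑ ≤ ENNReal.ofReal (C₂ / N) := fun ξ hξ η hη => by
    rw [← ofReal_norm]
    exact ENNReal.ofReal_le_ofReal (h₂ hN0 hξ hη)
  have b3 : BilinBound (symbolNonstat ρ₁ n N) ε K := (bilinBound_of_bounded ε bd).mono hle2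
  have b4 : BilinBound (fun ξ η => symbolNonstat ρ₁ n N η ξ) ε K :=
    (bilinBound_of_bounded ε fun ξ hξ η hη => bd η hη ξ hξ).mono hle2
  intro σ₁ σ₂ h₁ h₂
  rcases h₁ with rfl | rfl <;> rcases h₂ with rfl | rfl
  · simp only [one_mul]
    exact ⟨b3, b4⟩
  · have c1 := b1.conj
    have c2 := b2.conj
    simp only [symbolStat_eq_symbolNonstat, conj_symbolNonstat, neg_neg] at c1 c2
    simp only [one_mul, neg_mul]
    exact ⟨c1, c2⟩
  · simp only [symbolStat_eq_symbolNonstat] at b1 b2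
    simp only [one_mul, neg_mul]
    refine ⟨?_, b2⟩
    intro u v
    have := b1 u v
    have e : symbolStat ρ₁ n N = fun ξ η => symbolNonstat ρ₁ n N (-ξ) η := by
      funext ξ η; exact symbolStat_eq_symbolNonstat _ _ _ _ _
    rwa [e] at this
  · have c1 := b3.conj
    have c2 := b4.conj
    simp only [conj_symbolNonstat] at c1 c2
    simp only [one_mul, neg_mul]
    exact ⟨c1, c2⟩

/-- The symbol of the measure carried by the curve `(t, t^(n+1))` with odd density. -/
noncomputable def curveSymbol (ρ₁ : ℝ → ℝ) (n : ℕ) (N ξ η : ℝ) : ℂ :=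
  symbolNonstat ρ₁ n N ξ η + -symbolNonstat ρ₁ n N (-ξ) ((-1) ^ (n + 1) * η)

theorem measurable_curveSymbol {ρ₁ : ℝ → ℝ} (hρ : Continuous ρ₁) (n : ℕ) (N : ℝ) :
    Measurable (Function.uncurry (curveSymbol ρ₁ n N)) := by
  have h := measurable_symbolNonstat hρ n N
  exact h.add (h.comp (f := fun z : ℝ × ℝ => (-z.1, (-1) ^ (n + 1) * z.2)) (by fun_prop)).neg

theorem exists_norm_curveSymbol_le {ρ₁ : ℝ → ℝ} (hρ : Continuous ρ₁) :
    ∃ B : ℝ, ∀ n N ξ η, ‖curveSymbol ρ₁ n N ξ η‖ ≤ B := by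
  obtain ⟨B, hB⟩ := exists_norm_symbolNonstat_le_const hρ
  refine ⟨B + B, fun n N ξ η => (norm_add_le _ _).trans ?_⟩
  rw [norm_neg]
  exact add_le_add (hB _ _ _ _) (hB _ _ _ _)

/-- The quadrant bounds for the symbol of the curve and for its transpose. -/
theorem exists_bilinBound_curveSymbol {ρ₁ : ℝ → ℝ} (hρ : ContDiff ℝ ∞ ρ₁)
    (hs : Function.support ρ₁ ⊆ Set.Icc (1 / 2) 2) {n : ℕ} (hn : 1 ≤ n) :
    ∃ C : ℝ, 0 ≤ C ∧ ∀ {N ε : ℝ}, 1 ≤ N → ε ≠ 0 → 12 * (n + 1) * |ε| ≤ 1 → 1 ≤ |ε| * N →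
      ∀ σ₁ σ₂ : ℝ, (σ₁ = 1 ∨ σ₁ = -1) → (σ₂ = 1 ∨ σ₂ = -1) →
      BilinBound (fun ξ η => curveSymbol ρ₁ n N (σ₁ * ξ) (σ₂ * η)) (σ₁ * σ₂ * ε)
        (ENNReal.ofReal (C / N * (1 / (|ε| * N)) ^ (1 / 4 : ℝ))) ∧
      BilinBound (fun ξ η => curveSymbol ρ₁ n N (σ₂ * η) (σ₁ * ξ)) (σ₁ * σ₂ * ε)
        (ENNReal.ofReal (C / N * (1 / (|ε| * N)) ^ (1 / 4 : ℝ))) := by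
  obtain ⟨C, hC, h⟩ := exists_bilinBound_symbolNonstat hρ hs hn
  obtain ⟨B₀, hB₀⟩ := exists_norm_symbolNonstat_le_const hρ.continuous
  refine ⟨4 * C, by positivity, ?_⟩
  intro N ε hN hε hεn hεN σ₁ σ₂ h₁ h₂
  have hε0 : 0 < |ε| := abs_pos.2 hε
  obtain ⟨K, hK⟩ : ∃ K, K = ENNReal.ofReal (C / N * (1 / (|ε| * N)) ^ (1 / 4 : ℝ)) := ⟨_, rfl⟩
  have hK' : ENNReal.ofReal (4 * C / N * (1 / (|ε| * N)) ^ (1 / 4 : ℝ)) = 2 * K + 2 * K := by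
    rw [hK, show 4 * C / N * (1 / (|ε| * N)) ^ (1 / 4 : ℝ) =
      4 * (C / N * (1 / (|ε| * N)) ^ (1 / 4 : ℝ)) by ring, ENNReal.ofReal_mul (by norm_num),
      show ENNReal.ofReal 4 = 4 by simp]
    ring
  rw [hK']
  have sg : ∀ {a b : ℝ}, (a = 1 ∨ a = -1) → (b = 1 ∨ b = -1) → (a * b = 1 ∨ a * b = -1) := by
    rintro a b (rfl | rfl) (rfl | rfl) <;> norm_num
  have sp : ((-1 : ℝ) ^ (n + 1) = 1 ∨ (-1 : ℝ) ^ (n + 1) = -1) := neg_one_pow_eq_or ℝ (n + 1)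
  have hsym := measurable_symbolNonstat hρ.continuous n N
  have hab : |σ₁ * σ₂ * ε| = |ε| := by
    rcases h₁ with rfl | rfl <;> rcases h₂ with rfl | rfl <;> simp
  have h' := h (N := N) (ε := σ₁ * σ₂ * ε) hN (by rw [← abs_pos, hab]; exact hε0)
    (by rw [hab]; exact hεn) (by rw [hab]; exact hεN)
  rw [hab, ← hK] at h'
  have o2 : (-1 : ℝ) = 1 ∨ (-1 : ℝ) = -1 := Or.inr rfl
  have a1 := (h' σ₁ σ₂ h₁ h₂).1
  have a2 := (h' _ _ (sg o2 h₁) (sg sp h₂)).1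
  have a3 := (h' σ₂ σ₁ h₂ h₁).2
  have a4 := (h' _ _ (sg o2 h₂) (sg sp h₁)).2
  have mm : ∀ a b : ℝ, Measurable
      (Function.uncurry fun ξ η => symbolNonstat ρ₁ n N (a * ξ) (b * η)) := fun a b =>
    hsym.comp (f := fun z : ℝ × ℝ => (a * z.1, b * z.2)) (by fun_prop)
  have mt : ∀ a b : ℝ, Measurable
      (Function.uncurry fun ξ η => symbolNonstat ρ₁ n N (a * η) (b * ξ)) := fun a b =>
    hsym.comp (f := fun z : ℝ × ℝ => (a * z.2, b * z.1)) (by fun_prop)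
  have e : ∀ σ x : ℝ, -1 * σ * x = -(σ * x) := fun σ x => by ring
  constructor
  · have := a1.add a2.neg (mm _ _) (mm _ _).neg (B := B₀) (B' := B₀)
      (fun _ _ _ _ => hB₀ _ _ _ _) (fun _ _ _ _ => by rw [norm_neg]; exact hB₀ _ _ _ _)
    refine this.congr fun ξ _ η _ => ?_
    rw [curveSymbol, e, mul_assoc]
  · have := a3.add a4.neg (mt _ _) (mt _ _).neg (B := B₀) (B' := B₀)
      (fun _ _ _ _ => hB₀ _ _ _ _) (fun _ _ _ _ => by rw [norm_neg]; exact hB₀ _ _ _ _)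
    refine this.congr fun ξ _ η _ => ?_
    rw [curveSymbol, e, mul_assoc]

/-- The `L² × L² → L²` bounds for the symbol of the curve and for its transpose, for functions
with frequencies in the annulus. -/
theorem exists_energy_bilinSymbol_curveSymbol_le {ρ₁ : ℝ → ℝ} (hρ : ContDiff ℝ ∞ ρ₁)
    (hs : Function.support ρ₁ ⊆ Set.Icc (1 / 2) 2) {n : ℕ} (hn : 1 ≤ n) :
    ∃ C : ℝ, 0 ≤ C ∧ ∀ {N ε : ℝ}, 1 ≤ N → ε ≠ 0 → 12 * (n + 1) * |ε| ≤ 1 → 1 ≤ |ε| * N →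
      ∀ {u v : ℝ → ℂ}, Measurable u → Measurable v → AnnulusSupp u → AnnulusSupp v →
      energy u ≠ ⊤ → energy v ≠ ⊤ →
      energy (bilinSymbol (curveSymbol ρ₁ n N) ε u v) ≤
        ENNReal.ofReal (C / N * (1 / (|ε| * N)) ^ (1 / 4 : ℝ)) * (energy u * energy v) ∧
      energy (bilinSymbol (fun ξ η => curveSymbol ρ₁ n N η ξ) ε u v) ≤
        ENNReal.ofReal (C / N * (1 / (|ε| * N)) ^ (1 / 4 : ℝ)) * (energy u * energy v) := by
  obtain ⟨C, hC, h⟩ := exists_bilinBound_curveSymbol hρ hs hn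
  obtain ⟨B, hB⟩ := exists_norm_curveSymbol_le hρ.continuous
  refine ⟨16 * C, by positivity, ?_⟩
  intro N ε hN hε hεn hεN u v hu hv hus hvs hEu hEv
  have key := h hN hε hεn hεN
  have hm := measurable_curveSymbol hρ.continuous n N
  have hm' : Measurable (Function.uncurry fun ξ η => curveSymbol ρ₁ n N η ξ) :=
    hm.comp (f := fun z : ℝ × ℝ => (z.2, z.1)) (by fun_prop)
  obtain ⟨K, hK⟩ : ∃ K, K = ENNReal.ofReal (C / N * (1 / (|ε| * N)) ^ (1 / 4 : ℝ)) := ⟨_, rfl⟩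
  have hK' : ENNReal.ofReal (16 * C / N * (1 / (|ε| * N)) ^ (1 / 4 : ℝ)) = 16 * K := by
    rw [hK, show 16 * C / N * (1 / (|ε| * N)) ^ (1 / 4 : ℝ) =
      16 * (C / N * (1 / (|ε| * N)) ^ (1 / 4 : ℝ)) by ring, ENNReal.ofReal_mul (by norm_num),
      show ENNReal.ofReal 16 = 16 by simp]
  rw [hK']
  rw [← hK] at key
  constructor
  · exact energy_bilinSymbol_le_of_quadrants hm (fun _ _ => hB _ _ _ _)
      (fun σ₁ σ₂ h₁ h₂ => (key σ₁ σ₂ h₁ h₂).1) hu hv hus hvs hEu hEv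
  · exact energy_bilinSymbol_le_of_quadrants hm' (fun _ _ => hB _ _ _ _)
      (fun σ₁ σ₂ h₁ h₂ => (key σ₁ σ₂ h₁ h₂).2) hu hv hus hvs hEu hEv

/-! ### Passing to the frequency side -/

theorem osc_two_pi_eq (x ξ : ℝ) :
    Complex.exp (((2 * Real.pi * inner ℝ ξ x : ℝ) : ℂ) * Complex.I) =
      osc (2 * Real.pi * (x * ξ)) := by
  simp [osc, mul_comm]

theorem fourierInv_eq_integral_osc (u : ℝ → ℂ) (x : ℝ) :
    𝓕⁻ u x = ∫ ξ, osc (2 * Real.pi * (x * ξ)) * u ξ := by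
  rw [Real.fourierInv_eq']
  refine integral_congr_ae (Filter.Eventually.of_forall fun ξ => ?_)
  simp only [smul_eq_mul]
  rw [← osc_two_pi_eq]

theorem integrable_osc_mul {α : Type*} [MeasurableSpace α] {ν : Measure α} {φ : α → ℝ}
    (hφ : Measurable φ) {f : α → ℂ} (hf : Integrable f ν) :
    Integrable (fun x => osc (φ x) * f x) ν :=
  hf.bdd_mul (c := 1) (measurable_osc.comp hφ).aestronglyMeasurable
    (Filter.Eventually.of_forall fun _ => (norm_osc _).le)

theorem integral_fourierInv_mul {u v : ℝ → ℂ} (hu : Integrable u) (hv : Integrable v) :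
    ∫ x, 𝓕⁻ u x * v x = ∫ x, u x * 𝓕⁻ v x := by
  simp only [fourierInv_eq_integral_osc, ← integral_const_mul, ← integral_mul_const]
  rw [integral_integral_swap]
  · refine integral_congr_ae (Filter.Eventually.of_forall fun x => ?_)
    refine integral_congr_ae (Filter.Eventually.of_forall fun y => ?_)
    simp only
    rw [mul_comm y x]
    ring
  · have h := integrable_osc_mul (φ := fun z : ℝ × ℝ => 2 * Real.pi * (z.1 * z.2)) (by fun_prop)
      (hv.mul_prod hu)
    refine h.congr (Filter.Eventually.of_forall fun z => ?_)
    simp only [Function.uncurry]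
    ring

theorem continuous_fourierInv {u : ℝ → ℂ} (hu : Integrable u) : Continuous (𝓕⁻ u) := by
  have h : (𝓕⁻ u) = fun x => ∫ ξ, osc (2 * Real.pi * (x * ξ)) * u ξ := by
    funext x; exact fourierInv_eq_integral_osc u x
  rw [h]
  refine continuous_of_dominated (bound := fun ξ => ‖u ξ‖)
    (fun x => (integrable_osc_mul (by fun_prop) hu).aestronglyMeasurable)
    (fun x => Filter.Eventually.of_forall fun ξ => by rw [norm_mul, norm_osc, one_mul]) hu.norm
    (Filter.Eventually.of_forall fun ξ => ?_)
  have := continuous_osc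
  fun_prop

theorem energy_eq_enorm_sq (h : Lp ℂ 2 (volume : Measure ℝ)) : energy h = ‖h‖ₑ ^ 2 := by
  rw [Lp.enorm_def, eLpNorm_eq_lintegral_rpow_enorm_toReal (by norm_num) (by norm_num)]
  simp only [ENNReal.toReal_ofNat, ENNReal.rpow_ofNat, one_div]
  rw [← ENNReal.rpow_natCast, ← ENNReal.rpow_mul]
  norm_num
  rfl

/-- Plancherel's theorem for the inverse Fourier integral. -/
theorem energy_fourierInv {H : ℝ → ℂ} (hH : Integrable H) (hE : MemLp H 2) :
    energy (𝓕⁻ H) = energy H := by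
  -- The L² transform and the integral agree almost everywhere, because both pair in the same way
  -- with smooth compactly supported functions. Plancherel's identity for the former then applies to
  -- the latter.
  have hae : (𝓕⁻ (hE.toLp H) : Lp ℂ 2 (volume : Measure ℝ)) =ᵐ[volume] 𝓕⁻ H := by
    refine ae_eq_of_integral_contDiff_smul_eq
      ((Lp.memLp _).locallyIntegrable (by norm_num))
      (continuous_fourierInv hH).locallyIntegrable fun g hg hgc => ?_
    obtain ⟨s, hs⟩ : ∃ s : 𝓢(ℝ, ℂ), ∀ x, s x = (g x : ℂ) :=
      ⟨HasCompactSupport.toSchwartzMap (f := fun x => (g x : ℂ))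
        (hgc.comp_left (g := fun x : ℝ => (x : ℂ)) (by simp))
        (Complex.ofRealCLM.contDiff.comp hg), fun x => rfl⟩
    have h1 : ∫ x, s x • (𝓕⁻ (hE.toLp H) : Lp ℂ 2 (volume : Measure ℝ)) x =
        ∫ x, (𝓕⁻ s : 𝓢(ℝ, ℂ)) x • (hE.toLp H : Lp ℂ 2 (volume : Measure ℝ)) x := by
      rw [← Lp.toTemperedDistribution_apply, ← Lp.toTemperedDistribution_apply,
        ← Lp.fourierInv_toTemperedDistribution_eq, TemperedDistribution.fourierInv_apply]
    calc ∫ x, g x • (𝓕⁻ (hE.toLp H) : Lp ℂ 2 (volume : Measure ℝ)) x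
        = ∫ x, s x • (𝓕⁻ (hE.toLp H) : Lp ℂ 2 (volume : Measure ℝ)) x := by
          simp only [hs, Complex.real_smul, smul_eq_mul]
      _ = ∫ x, (𝓕⁻ (s : ℝ → ℂ)) x * H x := by
          rw [h1, SchwartzMap.fourierInv_coe]
          refine integral_congr_ae ?_
          filter_upwards [hE.coeFn_toLp] with x hx
          rw [hx, smul_eq_mul]
      _ = ∫ x, s x * 𝓕⁻ H x := integral_fourierInv_mul s.integrable hH
      _ = _ := by simp only [hs, Complex.real_smul]
  rw [← energy_congr_ae hae, energy_eq_enorm_sq, ← energy_congr_ae hE.coeFn_toLp, energy_eq_enorm_sq]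
  congr 1
  have h3 := Lp.norm_fourier_eq (𝓕⁻ (hE.toLp H) : Lp ℂ 2 (volume : Measure ℝ))
  rw [FourierTransform.fourier_fourierInv_eq] at h3
  rw [← ofReal_norm, ← ofReal_norm, h3]

/-- Insert both inversion integrals and carry out the t-integral first, which produces M(ξ, η). The
remaining exponential depends only on εξ + η, and this combination is taken as the new variable ζ.
-/
theorem integral_fourierInv_curve {u v : ℝ → ℂ} (hu : Measurable u) (hv : Measurable v)
    (hui : Integrable u) (hvi : Integrable v) {ρ : ℝ → ℝ} (hρ : Integrable ρ) {X Y : ℝ → ℝ}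
    (hX : Measurable X) (hY : Measurable Y) {M : ℝ → ℝ → ℂ}
    (hM : Measurable (Function.uncurry M)) {B : ℝ} (hB : ∀ ξ η, ‖M ξ η‖ ≤ B)
    (hMρ : ∀ ξ η, M ξ η = ∫ t, (ρ t : ℂ) * osc (-(2 * Real.pi * (ξ * X t + η * Y t)))) (ε x : ℝ) :
    ∫ t, 𝓕⁻ u (ε * x - X t) * 𝓕⁻ v (x - Y t) * (ρ t : ℂ) =
      𝓕⁻ (bilinSymbol M ε u v) x := by
  have h1 : ∀ t, 𝓕⁻ u (ε * x - X t) * 𝓕⁻ v (x - Y t) * (ρ t : ℂ) =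
      ∫ z : ℝ × ℝ, osc (2 * Real.pi * ((ε * x - X t) * z.1 + (x - Y t) * z.2)) *
        ((ρ t : ℂ) * (u z.1 * v z.2)) := by
    intro t
    rw [fourierInv_eq_integral_osc, fourierInv_eq_integral_osc, ← integral_prod_mul,
      ← integral_mul_const]
    refine integral_congr_ae (Filter.Eventually.of_forall fun z => ?_)
    simp only
    rw [mul_add, osc_add]
    ring
  simp only [h1]
  have hint : Integrable (fun y : ℝ × ℝ × ℝ =>
      osc (2 * Real.pi * ((ε * x - X y.1) * y.2.1 + (x - Y y.1) * y.2.2)) *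
        ((ρ y.1 : ℂ) * (u y.2.1 * v y.2.2))) :=
    integrable_osc_mul (by fun_prop) (hρ.ofReal.mul_prod (hui.mul_prod hvi))
  have h2 : ∀ z : ℝ × ℝ, ∫ t, osc (2 * Real.pi * ((ε * x - X t) * z.1 + (x - Y t) * z.2)) *
        ((ρ t : ℂ) * (u z.1 * v z.2)) =
      osc (2 * Real.pi * (x * (z.2 + ε * z.1))) * (u z.1 * v z.2 * M z.1 z.2) := by
    intro z
    rw [hMρ, ← integral_const_mul, ← integral_const_mul]
    refine integral_congr_ae (Filter.Eventually.of_forall fun t => ?_)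
    simp only
    rw [show 2 * Real.pi * ((ε * x - X t) * z.1 + (x - Y t) * z.2) =
      2 * Real.pi * (x * (z.2 + ε * z.1)) + -(2 * Real.pi * (z.1 * X t + z.2 * Y t)) by ring,
      osc_add]
    ring
  rw [integral_integral_swap hint]
  simp only [h2]
  have hsm : Measurable fun z : ℝ × ℝ => M z.1 z.2 := hM
  have h3 : Integrable (fun z : ℝ × ℝ =>
      osc (2 * Real.pi * (x * (z.2 + ε * z.1))) * (u z.1 * v z.2 * M z.1 z.2)) :=
    integrable_osc_mul (by fun_prop) ((hui.mul_prod hvi).mul_bdd hsm.aestronglyMeasurable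
      (Filter.Eventually.of_forall fun _ => hB _ _))
  have hprod : Integrable (fun z : ℝ × ℝ => u z.1 * v (z.2 - ε * z.1)) := by
    refine ⟨by fun_prop, ?_⟩
    rw [hasFiniteIntegral_iff_enorm, Measure.volume_eq_prod, lintegral_prod _ (by fun_prop),
      lintegral_lintegral_swap (by fun_prop), lintegral_lintegral_mul_comp_sub ε hu hv]
    exact ENNReal.mul_lt_top hui.2 hvi.2
  have h4 : Integrable (fun z : ℝ × ℝ =>
      osc (2 * Real.pi * (x * z.2)) *
        (u z.1 * v (z.2 - ε * z.1) * M z.1 (z.2 - ε * z.1))) :=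
    integrable_osc_mul (by fun_prop) (hprod.mul_bdd (hsm.comp (f := fun z : ℝ × ℝ =>
      (z.1, z.2 - ε * z.1)) (by fun_prop)).aestronglyMeasurable
      (Filter.Eventually.of_forall fun _ => hB _ _))
  rw [Measure.volume_eq_prod] at h3 ⊢
  rw [integral_prod _ h3, fourierInv_eq_integral_osc]
  simp only [bilinSymbol, ← integral_const_mul]
  refine Eq.trans ?_ (integral_integral_swap (f := fun ξ ζ => osc (2 * Real.pi * (x * ζ)) *
    (u ξ * v (ζ - ε * ξ) * M ξ (ζ - ε * ξ))) h4)
  refine integral_congr_ae (Filter.Eventually.of_forall fun ξ => ?_)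
  simp only
  rw [← integral_sub_right_eq_self _ (ε * ξ)]
  simp only [sub_add_cancel]

theorem integrable_bilinSymbol {M : ℝ → ℝ → ℂ} (hM : Measurable (Function.uncurry M)) {B : ℝ}
    (hB : ∀ ξ η, ‖M ξ η‖ ≤ B) (ε : ℝ) {u v : ℝ → ℂ} (hu : Measurable u) (hv : Measurable v)
    (hui : Integrable u) (hvi : Integrable v) : Integrable (bilinSymbol M ε u v) := by
  refine ⟨(measurable_bilinSymbol hM ε hu hv).aestronglyMeasurable, ?_⟩
  rw [hasFiniteIntegral_iff_enorm]
  calc ∫⁻ ζ, ‖bilinSymbol M ε u v ζ‖ₑ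
      ≤ ∫⁻ ζ, ENNReal.ofReal B * ∫⁻ ξ, ‖u ξ * v (ζ - ε * ξ)‖ₑ := by
        refine lintegral_mono fun ζ => ?_
        rw [← lintegral_const_mul _ (by fun_prop)]
        refine (enorm_integral_le_lintegral_enorm _).trans (lintegral_mono fun ξ => ?_)
        rw [enorm_mul, mul_comm]
        gcongr
        rw [← ofReal_norm]
        exact ENNReal.ofReal_le_ofReal (hB _ _)
    _ = ENNReal.ofReal B * ((∫⁻ ξ, ‖u ξ‖ₑ) * ∫⁻ η, ‖v η‖ₑ) := by
        rw [lintegral_const_mul', lintegral_lintegral_mul_comp_sub ε hu hv]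
        exact ENNReal.ofReal_ne_top
    _ < ⊤ := ENNReal.mul_lt_top ENNReal.ofReal_lt_top (ENNReal.mul_lt_top hui.2 hvi.2)

theorem memLp_two_of_energy {H : ℝ → ℂ} (hH : Measurable H) (hE : energy H ≠ ⊤) : MemLp H 2 := by
  refine ⟨hH.aestronglyMeasurable, ?_⟩
  rw [eLpNorm_lt_top_iff_lintegral_rpow_enorm_lt_top (by norm_num) (by norm_num)]
  unfold energy at hE
  simpa using lt_top_iff_ne_top.2 hE

theorem energy_integral_fourierInv_curve_le {u v : ℝ → ℂ} (hu : Measurable u) (hv : Measurable v)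
    (hui : Integrable u) (hvi : Integrable v) {ρ : ℝ → ℝ} (hρ : Integrable ρ) {X Y : ℝ → ℝ}
    (hX : Measurable X) (hY : Measurable Y) {M : ℝ → ℝ → ℂ}
    (hM : Measurable (Function.uncurry M)) {B : ℝ} (hB : ∀ ξ η, ‖M ξ η‖ ≤ B)
    (hMρ : ∀ ξ η, M ξ η = ∫ t, (ρ t : ℂ) * osc (-(2 * Real.pi * (ξ * X t + η * Y t)))) (ε : ℝ) :
    energy (fun x => ∫ t, 𝓕⁻ u (ε * x - X t) * 𝓕⁻ v (x - Y t) * (ρ t : ℂ)) ≤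
      energy (bilinSymbol M ε u v) := by
  by_cases hE : energy (bilinSymbol M ε u v) = ⊤
  · rw [hE]; exact le_top
  have e : (fun x => ∫ t, 𝓕⁻ u (ε * x - X t) * 𝓕⁻ v (x - Y t) * (ρ t : ℂ)) =
      𝓕⁻ (bilinSymbol M ε u v) := by
    funext x
    exact integral_fourierInv_curve hu hv hui hvi hρ hX hY hM hB hMρ ε x
  rw [e, energy_fourierInv (integrable_bilinSymbol hM hB ε hu hv hui hvi)
    (memLp_two_of_energy (measurable_bilinSymbol hM ε hu hv) hE)]

/-! ### The restriction operator and the curve -/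

/-- As ρ₁ vanishes on the closed negative half line, the case distinction disappears and regularity
is inherited from ρ₁. -/
theorem oddBump_eq {ρ₁ : ℝ → ℝ} (hs : Function.support ρ₁ ⊆ Set.Icc (1 / 2) 2) (t : ℝ) :
    oddBump ρ₁ t = ρ₁ t - ρ₁ (-t) := by
  have h0 : ∀ s, s ≤ 0 → ρ₁ s = 0 := fun s h => by
    by_contra hne
    have := (hs hne).1
    linarith
  unfold oddBump
  split_ifs with h1 h2
  · rw [h0 (-t) (by linarith), sub_zero]
  · rw [h0 t h2.le, zero_sub]
  · rw [h0 t (not_lt.1 h1), h0 (-t) (by linarith), sub_zero]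

theorem integrable_bump {ρ₁ : ℝ → ℝ} (hρ : Continuous ρ₁)
    (hs : Function.support ρ₁ ⊆ Set.Icc (1 / 2) 2) : Integrable ρ₁ :=
  hρ.integrable_of_hasCompactSupport (HasCompactSupport.of_support_subset_isCompact isCompact_Icc hs)

theorem integrable_oddBump {ρ₁ : ℝ → ℝ} (hρ : Continuous ρ₁)
    (hs : Function.support ρ₁ ⊆ Set.Icc (1 / 2) 2) : Integrable (oddBump ρ₁) := by
  have e : oddBump ρ₁ = fun t => ρ₁ t - ρ₁ (-t) := funext (oddBump_eq hs)
  rw [e]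
  exact (integrable_bump hρ hs).sub (integrable_bump hρ hs).comp_neg

theorem measurable_oddBump {ρ₁ : ℝ → ℝ} (hρ : Continuous ρ₁)
    (hs : Function.support ρ₁ ⊆ Set.Icc (1 / 2) 2) : Measurable (oddBump ρ₁) := by
  have e : oddBump ρ₁ = fun t => ρ₁ t - ρ₁ (-t) := funext (oddBump_eq hs)
  rw [e]
  have := hρ.measurable
  fun_prop

theorem oddBump_eq_zero {ρ₁ : ℝ → ℝ} (hs : Function.support ρ₁ ⊆ Set.Icc (1 / 2) 2) {t : ℝ}
    (ht : 2 < |t|) : oddBump ρ₁ t = 0 := by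
  have h0 : ∀ s, 2 < |s| → ρ₁ s = 0 := fun s h => by
    by_contra hne
    have h2 := hs hne
    rw [abs_of_pos (by linarith [h2.1])] at h
    linarith [h2.2]
  rw [oddBump_eq hs, h0 t ht, h0 (-t) (by rwa [abs_neg]), sub_zero]

theorem symbolNonstat_eq_integral {ρ₁ : ℝ → ℝ} (hs : Function.support ρ₁ ⊆ Set.Icc (1 / 2) 2)
    (n : ℕ) (N p r : ℝ) :
    symbolNonstat ρ₁ n N p r = ∫ t, (ρ₁ t : ℂ) * osc (-(N * (r * t ^ (n + 1) + p * t))) := by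
  refine intervalIntegral.integral_eq_integral_of_support_subset fun t ht => ?_
  have h : ρ₁ t ≠ 0 := fun h0 => ht (by simp [h0])
  have := hs h
  constructor <;> linarith [this.1, this.2]

/-- The negative half of the density becomes, under t ↦ -t, the same integral at (-ξ, (-1)^(n+1)η),
with a minus sign from oddness. The factor 2π passes from the Fourier convention to `osc`. -/
theorem curveSymbol_eq_integral {ρ₁ : ℝ → ℝ} (hρ : Continuous ρ₁)
    (hs : Function.support ρ₁ ⊆ Set.Icc (1 / 2) 2) (n : ℕ) (N ξ η : ℝ) :
    curveSymbol ρ₁ n (2 * Real.pi * N) ξ η = ∫ t, (oddBump ρ₁ t : ℂ) *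
      osc (-(2 * Real.pi * (ξ * (N * t) + η * (N * t ^ (n + 1))))) := by
  have hi : ∀ φ : ℝ → ℝ, Measurable φ → Integrable fun t => (ρ₁ t : ℂ) * osc (φ t) :=
    fun φ hφ => by
      exact (integrable_osc_mul hφ (integrable_bump hρ hs).ofReal).congr
        (Filter.Eventually.of_forall fun t => mul_comm _ _)
  have h1 : symbolNonstat ρ₁ n (2 * Real.pi * N) (-ξ) ((-1) ^ (n + 1) * η) =
      ∫ t, (ρ₁ (-t) : ℂ) * osc (-(2 * Real.pi * (ξ * (N * t) + η * (N * t ^ (n + 1))))) := by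
    rw [symbolNonstat_eq_integral hs, ← integral_neg_eq_self]
    refine integral_congr_ae (Filter.Eventually.of_forall fun t => ?_)
    simp only
    congr 2
    have e : (-1 : ℝ) ^ (n + 1) * (-t) ^ (n + 1) = t ^ (n + 1) := by
      rw [← mul_pow]; simp
    linear_combination (-(2 * Real.pi * N * η)) * e
  have h2 : symbolNonstat ρ₁ n (2 * Real.pi * N) ξ η =
      ∫ t, (ρ₁ t : ℂ) * osc (-(2 * Real.pi * (ξ * (N * t) + η * (N * t ^ (n + 1))))) := by
    rw [symbolNonstat_eq_integral hs]
    refine integral_congr_ae (Filter.Eventually.of_forall fun t => ?_)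
    simp only
    congr 2
    ring
  rw [curveSymbol, ← sub_eq_add_neg, h1, h2, ← integral_sub (hi _ (by fun_prop))]
  · refine integral_congr_ae (Filter.Eventually.of_forall fun t => ?_)
    simp only [oddBump_eq hs]
    push_cast
    ring
  · have := (hi (fun t => -(2 * Real.pi * (ξ * (N * -t) + η * (N * (-t) ^ (n + 1)))))
      (by fun_prop)).comp_neg
    simpa only [neg_neg] using this

/-- The frequency side of the restriction operator. -/
noncomputable def restrictionFreq (Φ : 𝓢(ℝ, ℂ)) (f : Lp ℂ 2 (volume : Measure ℝ)) (ξ : ℝ) : ℂ :=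
  (𝓕 f : Lp ℂ 2 (volume : Measure ℝ)) ξ * (𝓕 Φ : 𝓢(ℝ, ℂ)) ξ

theorem measurable_restrictionFreq (Φ : 𝓢(ℝ, ℂ)) (f : Lp ℂ 2 (volume : Measure ℝ)) :
    Measurable (restrictionFreq Φ f) :=
  (Lp.stronglyMeasurable _).measurable.mul (𝓕 Φ : 𝓢(ℝ, ℂ)).continuous.measurable

theorem annulusSupp_restrictionFreq {Θ Φ : 𝓢(ℝ, ℂ)}
    (hΘsupp : Function.support Θ ⊆ Set.Ioo (-1) 1) (hΘone : ∀ ξ : ℝ, |ξ| ≤ 1 / 2 → Θ ξ = 1)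
    (hΦ : ∀ ξ : ℝ, (𝓕 Φ : 𝓢(ℝ, ℂ)) ξ = Θ (ξ / 2) - Θ ξ) (f : Lp ℂ 2 (volume : Measure ℝ)) :
    AnnulusSupp (restrictionFreq Φ f) := by
  intro ξ h
  have h1 : Θ (ξ / 2) - Θ ξ ≠ 0 := by
    rw [← hΦ]
    exact fun h0 => h (by rw [restrictionFreq, h0, mul_zero])
  have h0 : ∀ x : ℝ, 1 ≤ |x| → Θ x = 0 := fun x hx => by
    by_contra hne
    have := hΘsupp hne
    exact absurd (abs_lt.2 this) (not_lt.2 hx)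
  constructor
  · by_contra hlt
    push Not at hlt
    refine h1 ?_
    rw [hΘone ξ hlt.le, hΘone (ξ / 2) (by rw [abs_div, abs_two]; linarith [abs_nonneg ξ]), sub_self]
  · by_contra hlt
    push Not at hlt
    refine h1 ?_
    rw [h0 ξ (by linarith), h0 (ξ / 2) (by rw [abs_div, abs_two]; linarith), sub_self]

theorem exists_energy_restrictionFreq_le (Φ : 𝓢(ℝ, ℂ)) :
    ∃ A : ℝ, 0 ≤ A ∧ ∀ f : Lp ℂ 2 (volume : Measure ℝ),
      energy (restrictionFreq Φ f) ≤ ENNReal.ofReal A * ‖f‖ₑ ^ 2 := by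
  obtain ⟨A, hA⟩ : ∃ A : ℝ, ∀ ξ, ‖(𝓕 Φ : 𝓢(ℝ, ℂ)) ξ‖ ≤ A :=
    ⟨_, fun ξ => SchwartzMap.norm_le_seminorm ℝ (𝓕 Φ : 𝓢(ℝ, ℂ)) ξ⟩
  have hA0 : 0 ≤ A := (norm_nonneg _).trans (hA 0)
  refine ⟨A ^ 2, by positivity, fun f => ?_⟩
  refine (energy_mul_le hA).trans ?_
  rw [energy_eq_enorm_sq, ENNReal.ofReal_pow hA0, ← ofReal_norm, Lp.norm_fourier_eq, ofReal_norm]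

/-- The restriction operator is convolution with `Φ`. -/
theorem smoothRestriction_eq_integral (Φ : 𝓢(ℝ, ℂ)) (f : Lp ℂ 2 (volume : Measure ℝ)) (x : ℝ) :
    smoothRestriction Φ f x = ∫ y, Φ (x - y) * f y := by
  -- The inverse transform of `w` is e^{2πixξ}Φ̂(ξ), so the inversion integral at x is the pairing
  -- of f̂ with 𝓕⁻w, that is, of f with w.
  obtain ⟨w, hw⟩ : ∃ w : 𝓢(ℝ, ℂ), ∀ y, w y = Φ (x - y) := by
    refine ⟨SchwartzMap.compCLMOfAntilipschitz ℝ (K := 1) (g := fun y : ℝ => x - y)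
      (by fun_prop) (fun a b => ?_) Φ, fun y => rfl⟩
    rw [ENNReal.coe_one, one_mul, edist_sub_left]
  have h1 : ∀ ξ, (𝓕⁻ w : 𝓢(ℝ, ℂ)) ξ = osc (2 * Real.pi * (x * ξ)) * (𝓕 Φ : 𝓢(ℝ, ℂ)) ξ := by
    intro ξ
    rw [SchwartzMap.fourierInv_coe, SchwartzMap.fourier_coe, fourierInv_eq_integral_osc,
      Real.fourier_eq', ← integral_const_mul, ← integral_sub_left_eq_self _ volume x]
    refine integral_congr_ae (Filter.Eventually.of_forall fun y => ?_)
    simp only [hw, sub_sub_cancel, smul_eq_mul]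
    rw [← mul_assoc (osc (2 * Real.pi * (x * ξ)))]
    congr 1
    have : Complex.exp (((-2 * Real.pi * inner ℝ y ξ : ℝ) : ℂ) * Complex.I) =
        osc (-(2 * Real.pi * (ξ * y))) := by
      simp [osc]
    rw [this, ← osc_add]
    congr 1
    ring
  have h2 : smoothRestriction Φ f x =
      ∫ ξ, (𝓕⁻ w : 𝓢(ℝ, ℂ)) ξ • (𝓕 f : Lp ℂ 2 (volume : Measure ℝ)) ξ := by
    rw [smoothRestriction, fourierInv_eq_integral_osc]
    refine integral_congr_ae (Filter.Eventually.of_forall fun ξ => ?_)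
    simp only [h1, smul_eq_mul]
    ring
  rw [h2, ← Lp.toTemperedDistribution_apply, ← Lp.fourier_toTemperedDistribution_eq,
    TemperedDistribution.fourier_apply, FourierTransform.fourier_fourierInv_eq,
    Lp.toTemperedDistribution_apply]
  simp only [hw, smul_eq_mul]

/-- The `L² × L² → L²` bounds for the bilinear operators along the curve. -/
theorem exists_energy_curve_le {ρ₁ : ℝ → ℝ} (hρ : ContDiff ℝ ∞ ρ₁)
    (hs : Function.support ρ₁ ⊆ Set.Icc (1 / 2) 2) {n : ℕ} (hn : 1 ≤ n) {Θ Φ : 𝓢(ℝ, ℂ)}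
    (hΘsupp : Function.support Θ ⊆ Set.Ioo (-1) 1) (hΘone : ∀ ξ : ℝ, |ξ| ≤ 1 / 2 → Θ ξ = 1)
    (hΦ : ∀ ξ : ℝ, (𝓕 Φ : 𝓢(ℝ, ℂ)) ξ = Θ (ξ / 2) - Θ ξ) :
    ∃ C : ℝ, 0 ≤ C ∧ ∀ {N ε : ℝ}, 1 ≤ N → 0 < ε → 12 * (n + 1) * ε ≤ 1 → 1 ≤ ε * N →
      ∀ f g : Lp ℂ 2 (volume : Measure ℝ),
      energy (fun x => ∫ t, smoothRestriction Φ f (ε * x - N * t) *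
        smoothRestriction Φ g (x - N * t ^ (n + 1)) * (oddBump ρ₁ t : ℂ)) ≤
        ENNReal.ofReal (C / N * (1 / (ε * N)) ^ (1 / 4 : ℝ)) * (‖f‖ₑ ^ 2 * ‖g‖ₑ ^ 2) ∧
      energy (fun x => ∫ t, smoothRestriction Φ f (x - N * t) *
        smoothRestriction Φ g (ε * x - N * t ^ (n + 1)) * (oddBump ρ₁ t : ℂ)) ≤
        ENNReal.ofReal (C / N * (1 / (ε * N)) ^ (1 / 4 : ℝ)) * (‖f‖ₑ ^ 2 * ‖g‖ₑ ^ 2) := by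
  obtain ⟨C, hC, h⟩ := exists_energy_bilinSymbol_curveSymbol_le hρ hs hn
  obtain ⟨A, hA, hE⟩ := exists_energy_restrictionFreq_le Φ
  obtain ⟨B, hB⟩ := exists_norm_curveSymbol_le hρ.continuous
  refine ⟨C * A ^ 2, by positivity, ?_⟩
  intro N ε hN hε hεn hεN f g
  have hN0 : 0 < N := by linarith
  have hpi : 1 ≤ 2 * Real.pi := by linarith [Real.pi_gt_three]
  have hN1 : N ≤ 2 * Real.pi * N := le_mul_of_one_le_left hN0.le hpi
  have hfin : ∀ f : Lp ℂ 2 (volume : Measure ℝ), energy (restrictionFreq Φ f) ≠ ⊤ := fun f =>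
    ne_top_of_le_ne_top (ENNReal.mul_ne_top ENNReal.ofReal_ne_top (by simp)) (hE f)
  have hsupp := annulusSupp_restrictionFreq hΘsupp hΘone hΦ
  have hmeas := measurable_restrictionFreq Φ
  have hint : ∀ f : Lp ℂ 2 (volume : Measure ℝ), Integrable (restrictionFreq Φ f) := fun f =>
    (hsupp f).integrable (hmeas f) (hfin f)
  have hm := measurable_curveSymbol hρ.continuous n (2 * Real.pi * N)
  have hm' : Measurable (Function.uncurry fun ξ η => curveSymbol ρ₁ n (2 * Real.pi * N) η ξ) :=
    hm.comp (f := fun z : ℝ × ℝ => (z.2, z.1)) (by fun_prop)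
  have hrep := curveSymbol_eq_integral hρ.continuous hs n N
  have hρi := integrable_oddBump hρ.continuous hs
  have main : ∀ f g : Lp ℂ 2 (volume : Measure ℝ),
      ENNReal.ofReal (C / (2 * Real.pi * N) * (1 / (|ε| * (2 * Real.pi * N))) ^ (1 / 4 : ℝ)) *
        (energy (restrictionFreq Φ f) * energy (restrictionFreq Φ g)) ≤
      ENNReal.ofReal (C * A ^ 2 / N * (1 / (ε * N)) ^ (1 / 4 : ℝ)) * (‖f‖ₑ ^ 2 * ‖g‖ₑ ^ 2) := by
    intro f g
    calc _ ≤ ENNReal.ofReal (C / N * (1 / (ε * N)) ^ (1 / 4 : ℝ)) *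
          ((ENNReal.ofReal A * ‖f‖ₑ ^ 2) * (ENNReal.ofReal A * ‖g‖ₑ ^ 2)) := by
          refine mul_le_mul' (ENNReal.ofReal_le_ofReal ?_) (mul_le_mul' (hE f) (hE g))
          rw [abs_of_pos hε]
          gcongr
      _ = (ENNReal.ofReal (C / N * (1 / (ε * N)) ^ (1 / 4 : ℝ)) *
          (ENNReal.ofReal A * ENNReal.ofReal A)) * (‖f‖ₑ ^ 2 * ‖g‖ₑ ^ 2) := by ring
      _ = _ := by
          rw [← ENNReal.ofReal_mul hA, ← ENNReal.ofReal_mul (by positivity)]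
          congr 2
          ring
  have hk : ∀ f g : Lp ℂ 2 (volume : Measure ℝ), _ := fun f g =>
    h (N := 2 * Real.pi * N) (ε := ε) (hN.trans hN1) hε.ne' (by rwa [abs_of_pos hε])
      (by rw [abs_of_pos hε]; exact hεN.trans (by gcongr)) (hmeas f) (hmeas g) (hsupp f) (hsupp g)
      (hfin f) (hfin g)
  constructor
  · refine le_trans ?_ ((hk f g).1.trans (main f g))
    exact energy_integral_fourierInv_curve_le (hmeas f) (hmeas g) (hint f) (hint g) hρi
      (X := fun t => N * t) (Y := fun t => N * t ^ (n + 1)) (by fun_prop) (by fun_prop) hm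
      (fun _ _ => hB _ _ _ _) hrep ε
  -- Here the dilation ε acts on the second factor. Exchanging f and g puts it on the first, at the
  -- price of transposing the symbol.
  · rw [mul_comm (‖f‖ₑ ^ 2)]
    refine le_trans ?_ ((hk g f).2.trans (main g f))
    have := energy_integral_fourierInv_curve_le (hmeas g) (hmeas f) (hint g) (hint f) hρi
      (Y := fun t => N * t) (X := fun t => N * t ^ (n + 1)) (by fun_prop) (by fun_prop) hm'
      (fun _ _ => hB _ _ _ _) (fun ξ η => by rw [hrep]; simp only [add_comm]) ε
    refine le_trans (le_of_eq ?_) this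
    refine congrArg energy (funext fun x => integral_congr_ae
      (Filter.Eventually.of_forall fun t => ?_))
    change _ = smoothRestriction Φ g (ε * x - N * t ^ (n + 1)) *
      smoothRestriction Φ f (x - N * t) * (oddBump ρ₁ t : ℂ)
    ring

/-! ### Localization in space -/

/-- Convolution of nonnegative functions. -/
noncomputable def posConv (k h : ℝ → ℝ≥0∞) (u : ℝ) : ℝ≥0∞ := ∫⁻ v, k (u - v) * h v

theorem measurable_posConv {k h : ℝ → ℝ≥0∞} (hk : Measurable k) (hh : Measurable h) :
    Measurable (posConv k h) :=
  Measurable.lintegral_prod_right' (f := fun z : ℝ × ℝ => k (z.1 - z.2) * h z.2) (by fun_prop)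

/-- Young's inequality for convolution of an integrable with a square integrable function. -/
theorem lintegral_posConv_sq_le {k h : ℝ → ℝ≥0∞} (hk : Measurable k) (hh : Measurable h) :
    ∫⁻ u, posConv k h u ^ 2 ≤ (∫⁻ x, k x) ^ 2 * ∫⁻ x, h x ^ 2 := by
  have h1 : ∀ u, posConv k h u ^ 2 ≤ (∫⁻ x, k x) * ∫⁻ v, k (u - v) * h v ^ 2 := by
    intro u
    have hku : Measurable fun v => k (u - v) := by fun_prop
    -- Cauchy–Schwarz against the measure k(u - v)dv, whose total mass is the integral of k.
    have := sq_setLIntegral_le (ν := volume.withDensity fun v => k (u - v)) (s := Set.univ)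
      hh.aemeasurable
    rw [Measure.restrict_univ, lintegral_withDensity_eq_lintegral_mul _ hku hh,
      lintegral_withDensity_eq_lintegral_mul _ hku (hh.pow_const 2),
      withDensity_apply _ MeasurableSet.univ, Measure.restrict_univ,
      lintegral_sub_left_eq_self] at this
    exact this
  calc ∫⁻ u, posConv k h u ^ 2 ≤ ∫⁻ u, (∫⁻ x, k x) * ∫⁻ v, k (u - v) * h v ^ 2 :=
        lintegral_mono h1
    _ = (∫⁻ x, k x) * ∫⁻ v, ∫⁻ u, k (u - v) * h v ^ 2 := by
        rw [lintegral_const_mul _ (Measurable.lintegral_prod_right'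
          (f := fun z : ℝ × ℝ => k (z.1 - z.2) * h z.2 ^ 2) (by fun_prop)),
          lintegral_lintegral_swap (by fun_prop)]
    _ = (∫⁻ x, k x) * ((∫⁻ x, k x) * ∫⁻ v, h v ^ 2) := by
        congr 1
        rw [← lintegral_const_mul _ (by fun_prop)]
        refine lintegral_congr fun v => ?_
        rw [lintegral_mul_const _ (by fun_prop), lintegral_sub_right_eq_self]
    _ = _ := by ring

/-- The kernel `|Φ|` restricted to `|x| ≥ N`. -/
noncomputable def tailKernel (Φ : 𝓢(ℝ, ℂ)) (N : ℝ) : ℝ → ℝ≥0∞ :=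
  {x : ℝ | N ≤ |x|}.indicator fun x => ‖Φ x‖ₑ

theorem measurable_tailKernel (Φ : 𝓢(ℝ, ℂ)) (N : ℝ) : Measurable (tailKernel Φ N) :=
  Φ.continuous.measurable.enorm.indicator (measurableSet_le measurable_const (by fun_prop))

/-- Markov's inequality with the first moment of |Φ|. Decay 1/N suffices, since only (εN)^(-1/8) is
needed. -/
theorem exists_lintegral_tailKernel_le (Φ : 𝓢(ℝ, ℂ)) :
    ∃ c : ℝ, 0 ≤ c ∧ ∀ N : ℝ, 0 < N → ∫⁻ x, tailKernel Φ N x ≤ ENNReal.ofReal (c / N) := by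
  have hi := Φ.integrable_pow_mul (μ := volume) 1
  refine ⟨∫ x, ‖x‖ ^ 1 * ‖Φ x‖, integral_nonneg fun x => by positivity, fun N hN => ?_⟩
  rw [div_eq_mul_inv, mul_comm, ← integral_const_mul,
    ofReal_integral_eq_lintegral_ofReal (hi.const_mul _)
      (Filter.Eventually.of_forall fun x => by positivity)]
  refine lintegral_mono fun x => ?_
  unfold tailKernel
  by_cases hx : N ≤ |x|
  · rw [Set.indicator_of_mem (by exact hx), ← ofReal_norm]
    refine ENNReal.ofReal_le_ofReal ?_
    rw [← mul_assoc, pow_one, Real.norm_eq_abs]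
    refine le_mul_of_one_le_left (norm_nonneg _) ?_
    rw [← div_eq_inv_mul, le_div_iff₀ hN]
    linarith
  · rw [Set.indicator_of_notMem (by exact hx)]
    exact zero_le

theorem lintegral_enorm_schwartz_lt_top (Φ : 𝓢(ℝ, ℂ)) : ∫⁻ x, ‖Φ x‖ₑ < ⊤ :=
  (SchwartzMap.integrable Φ (μ := volume)).2

/-- By Tonelli, each v lies in the window for a set of centres y of length 2r/a. A window moving at
speed a = ε thus counts every point 1/ε times as often. -/
theorem lintegral_lintegral_window {h : ℝ → ℝ≥0∞} (hh : Measurable h) {a : ℝ} (ha : 0 < a) (r : ℝ) :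
    ∫⁻ y, ∫⁻ v in Set.Icc (a * y - r) (a * y + r), h v =
      ENNReal.ofReal (2 * r / a) * ∫⁻ v, h v := by
  have hms : MeasurableSet {z : ℝ × ℝ | a * z.1 - r ≤ z.2 ∧ z.2 ≤ a * z.1 + r} :=
    (measurableSet_le (f := fun z : ℝ × ℝ => a * z.1 - r) (g := Prod.snd) (by fun_prop)
      (by fun_prop)).inter (measurableSet_le (f := Prod.snd) (g := fun z : ℝ × ℝ => a * z.1 + r)
      (by fun_prop) (by fun_prop))
  have e1 : ∀ y, ∫⁻ v in Set.Icc (a * y - r) (a * y + r), h v =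
      ∫⁻ v, ({z : ℝ × ℝ | a * z.1 - r ≤ z.2 ∧ z.2 ≤ a * z.1 + r}).indicator
        (fun z => h z.2) (y, v) := by
    intro y
    rw [← lintegral_indicator measurableSet_Icc]
    rfl
  simp only [e1]
  rw [lintegral_lintegral_swap (f := fun y v => ({z : ℝ × ℝ | a * z.1 - r ≤ z.2 ∧
    z.2 ≤ a * z.1 + r}).indicator (fun z => h z.2) (y, v)) ((by fun_prop : Measurable fun z : ℝ × ℝ => h z.2).indicator
    hms).aemeasurable, ← lintegral_const_mul _ hh]
  refine lintegral_congr fun v => ?_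
  have e2 : ∀ y, ({z : ℝ × ℝ | a * z.1 - r ≤ z.2 ∧ z.2 ≤ a * z.1 + r}).indicator
      (fun z => h z.2) (y, v) = (Set.Icc ((v - r) / a) ((v + r) / a)).indicator
        (fun _ => h v) y := by
    intro y
    simp only [Set.indicator_apply, Set.mem_ofPred_eq, Set.mem_Icc]
    congr 1
    rw [div_le_iff₀ ha, le_div_iff₀ ha]
    refine propext ⟨fun h => ⟨by linarith [h.2], by linarith [h.1]⟩,
      fun h => ⟨by linarith [h.2], by linarith [h.1]⟩⟩
  simp only [e2]
  rw [lintegral_indicator measurableSet_Icc, setLIntegral_const, Real.volume_Icc, mul_comm]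
  congr 2
  ring

theorem lintegral_mul_comp_affine_le {P Q : ℝ → ℝ≥0∞} (hP : Measurable P) (hQ : Measurable Q)
    {α β : ℝ} (hα : 0 < α) (hβ : 0 < β) (a b : ℝ) :
    ∫⁻ x, P (α * x - a) * Q (β * x - b) ≤
      (ENNReal.ofReal α⁻¹ * ∫⁻ x, P x ^ 2) ^ (1 / 2 : ℝ) *
      (ENNReal.ofReal β⁻¹ * ∫⁻ x, Q x ^ 2) ^ (1 / 2 : ℝ) := by
  have e : ∀ {P : ℝ → ℝ≥0∞}, Measurable P → ∀ {α : ℝ}, 0 < α → ∀ a : ℝ,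
      ∫⁻ x, P (α * x - a) ^ 2 = ENNReal.ofReal α⁻¹ * ∫⁻ x, P x ^ 2 := by
    intro P hP α hα a
    rw [lintegral_comp_mul_left (f := fun x => P (x - a) ^ 2) (by fun_prop) hα.ne',
      abs_of_pos hα, lintegral_sub_right_eq_self (fun x => P x ^ 2)]
  rw [← e hP hα a, ← e hQ hβ b]
  exact lintegral_mul_le_sqrt_mul_sqrt (by fun_prop) (by fun_prop)

/-- The restriction of an `L²` function to a measurable set. -/
noncomputable def truncate (f : Lp ℂ 2 (volume : Measure ℝ)) {s : Set ℝ} (hs : MeasurableSet s) :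
    Lp ℂ 2 (volume : Measure ℝ) := ((Lp.memLp f).indicator hs).toLp

theorem coeFn_truncate (f : Lp ℂ 2 (volume : Measure ℝ)) {s : Set ℝ} (hs : MeasurableSet s) :
    truncate f hs =ᵐ[volume] s.indicator f := MemLp.coeFn_toLp _

theorem enorm_truncate_sq (f : Lp ℂ 2 (volume : Measure ℝ)) {s : Set ℝ} (hs : MeasurableSet s) :
    ‖truncate f hs‖ₑ ^ 2 = ∫⁻ x in s, ‖f x‖ₑ ^ 2 := by
  rw [← energy_eq_enorm_sq, energy_congr_ae (coeFn_truncate f hs), energy,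
    ← lintegral_indicator hs]
  refine lintegral_congr fun x => ?_
  by_cases hx : x ∈ s
  · simp [hx]
  · simp [hx]

theorem smoothRestriction_truncate (Φ : 𝓢(ℝ, ℂ)) (f : Lp ℂ 2 (volume : Measure ℝ)) {s : Set ℝ}
    (hs : MeasurableSet s) (x : ℝ) :
    smoothRestriction Φ (truncate f hs) x = ∫ y, Φ (x - y) * s.indicator f y := by
  rw [smoothRestriction_eq_integral]
  refine integral_congr_ae ?_
  filter_upwards [coeFn_truncate f hs] with y hy
  rw [hy]

theorem measurable_enorm_Lp (f : Lp ℂ 2 (volume : Measure ℝ)) : Measurable fun x => ‖f x‖ₑ :=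
  (Lp.stronglyMeasurable f).measurable.enorm

theorem enorm_smoothRestriction_le (Φ : 𝓢(ℝ, ℂ)) (f : Lp ℂ 2 (volume : Measure ℝ)) (x : ℝ) :
    ‖smoothRestriction Φ f x‖ₑ ≤ posConv (fun y => ‖Φ y‖ₑ) (fun y => ‖f y‖ₑ) x := by
  rw [smoothRestriction_eq_integral]
  refine (enorm_integral_le_lintegral_enorm _).trans (lintegral_mono fun y => ?_)
  rw [enorm_mul]

theorem enorm_smoothRestriction_truncate_le (Φ : 𝓢(ℝ, ℂ)) (f : Lp ℂ 2 (volume : Measure ℝ))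
    {s : Set ℝ} (hs : MeasurableSet s) (x : ℝ) :
    ‖smoothRestriction Φ (truncate f hs) x‖ₑ ≤
      posConv (fun y => ‖Φ y‖ₑ) (fun y => ‖f y‖ₑ) x := by
  rw [smoothRestriction_truncate]
  refine (enorm_integral_le_lintegral_enorm _).trans (lintegral_mono fun y => ?_)
  rw [enorm_mul]
  gcongr
  exact enorm_indicator_le_enorm_self _ _

theorem enorm_smoothRestriction_sub_truncate_le (Φ : 𝓢(ℝ, ℂ)) (f : Lp ℂ 2 (volume : Measure ℝ))
    {s : Set ℝ} (hs : MeasurableSet s) {x N : ℝ} (hx : ∀ y, y ∉ s → N ≤ |x - y|) :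
    ‖smoothRestriction Φ f x - smoothRestriction Φ (truncate f hs) x‖ₑ ≤
      posConv (tailKernel Φ N) (fun y => ‖f y‖ₑ) x := by
  have hΦ : MemLp (fun y => Φ (x - y)) 2 volume :=
    (Φ.memLp 2 volume).comp_measurePreserving (Measure.measurePreserving_sub_left volume x)
  have i1 : Integrable fun y => Φ (x - y) * f y := hΦ.integrable_mul (Lp.memLp f)
  have i2 : Integrable fun y => Φ (x - y) * s.indicator f y :=
    hΦ.integrable_mul ((Lp.memLp f).indicator hs)
  rw [smoothRestriction_truncate, smoothRestriction_eq_integral, ← integral_sub i1 i2]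
  refine (enorm_integral_le_lintegral_enorm _).trans (lintegral_mono fun y => ?_)
  by_cases hy : y ∈ s
  · simp [hy]
  · rw [Set.indicator_of_notMem hy, mul_zero, sub_zero, enorm_mul, tailKernel,
      Set.indicator_of_mem (show x - y ∈ {x : ℝ | N ≤ |x|} from hx y hy)]

theorem integrable_restrictionFreq (Φ : 𝓢(ℝ, ℂ)) (f : Lp ℂ 2 (volume : Measure ℝ)) :
    Integrable (restrictionFreq Φ f) :=
  (Lp.memLp (𝓕 f : Lp ℂ 2 (volume : Measure ℝ))).integrable_mul
    ((𝓕 Φ : 𝓢(ℝ, ℂ)).memLp 2 volume)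

theorem continuous_smoothRestriction (Φ : 𝓢(ℝ, ℂ)) (f : Lp ℂ 2 (volume : Measure ℝ)) :
    Continuous (smoothRestriction Φ f) :=
  continuous_fourierInv (integrable_restrictionFreq Φ f)

theorem exists_norm_smoothRestriction_le (Φ : 𝓢(ℝ, ℂ)) (f : Lp ℂ 2 (volume : Measure ℝ)) :
    ∃ A : ℝ, ∀ x, ‖smoothRestriction Φ f x‖ ≤ A := by
  refine ⟨∫ ξ, ‖restrictionFreq Φ f ξ‖, fun x => ?_⟩
  have e : smoothRestriction Φ f x = ∫ ξ, osc (2 * Real.pi * (x * ξ)) * restrictionFreq Φ f ξ :=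
    fourierInv_eq_integral_osc _ x
  rw [e]
  refine (norm_integral_le_integral_norm _).trans (le_of_eq ?_)
  simp only [norm_mul, norm_osc, one_mul]

/-! ### Near and far parts, and the passage from L² to L¹. -/

/-- The bilinear operator along the curve `(N t, N t ^ d)` with dilations `α` and `β`. -/
noncomputable def curveOp (Φ : 𝓢(ℝ, ℂ)) (ρ : ℝ → ℝ) (d : ℕ) (N α β : ℝ)
    (f g : Lp ℂ 2 (volume : Measure ℝ)) (x : ℝ) : ℂ :=
  ∫ t, smoothRestriction Φ f (α * x - N * t) * smoothRestriction Φ g (β * x - N * t ^ d) * (ρ t : ℂ)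

theorem measurable_curveOp (Φ : 𝓢(ℝ, ℂ)) {ρ : ℝ → ℝ} (hρ : Measurable ρ) (d : ℕ) (N α β : ℝ)
    (f g : Lp ℂ 2 (volume : Measure ℝ)) : Measurable (curveOp Φ ρ d N α β f g) := by
  have hf := (continuous_smoothRestriction Φ f).measurable
  have hg := (continuous_smoothRestriction Φ g).measurable
  refine (StronglyMeasurable.integral_prod_right (f := fun x t =>
    smoothRestriction Φ f (α * x - N * t) * smoothRestriction Φ g (β * x - N * t ^ d) *
      (ρ t : ℂ)) ?_).measurable
  exact Measurable.stronglyMeasurable (by fun_prop)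

theorem integrable_curveOp (Φ : 𝓢(ℝ, ℂ)) {ρ : ℝ → ℝ} (hρ : Integrable ρ) (d : ℕ) (N α β : ℝ)
    (f g : Lp ℂ 2 (volume : Measure ℝ)) (x : ℝ) :
    Integrable fun t => smoothRestriction Φ f (α * x - N * t) *
      smoothRestriction Φ g (β * x - N * t ^ d) * (ρ t : ℂ) := by
  obtain ⟨A, hA⟩ := exists_norm_smoothRestriction_le Φ f
  obtain ⟨B, hB⟩ := exists_norm_smoothRestriction_le Φ g
  have hf := (continuous_smoothRestriction Φ f).measurable
  have hg := (continuous_smoothRestriction Φ g).measurable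
  refine hρ.ofReal.bdd_mul (c := A * B) (by fun_prop) (Filter.Eventually.of_forall fun t => ?_)
  rw [norm_mul]
  exact mul_le_mul (hA _) (hB _) (norm_nonneg _) ((norm_nonneg _).trans (hA 0))

/-- The pointwise bound for the contribution of the far parts. -/
noncomputable def farPart (Φ : 𝓢(ℝ, ℂ)) (ρ : ℝ → ℝ) (d : ℕ) (N α β : ℝ)
    (f g : Lp ℂ 2 (volume : Measure ℝ)) (x : ℝ) : ℝ≥0∞ :=
  ∫⁻ t, (posConv (tailKernel Φ N) (fun y => ‖f y‖ₑ) (α * x - N * t) *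
      posConv (fun y => ‖Φ y‖ₑ) (fun y => ‖g y‖ₑ) (β * x - N * t ^ d) +
    posConv (fun y => ‖Φ y‖ₑ) (fun y => ‖f y‖ₑ) (α * x - N * t) *
      posConv (tailKernel Φ N) (fun y => ‖g y‖ₑ) (β * x - N * t ^ d)) * ‖ρ t‖ₑ

/-- For each fixed t, Cauchy–Schwarz in x after the affine changes of variable, and Young's
inequality for each convolution. No oscillation is used; the gain lies in the small mass of the tail
kernel. -/
theorem lintegral_farPart_le (Φ : 𝓢(ℝ, ℂ)) {ρ : ℝ → ℝ} (hρ : Measurable ρ) (d : ℕ) {N α β : ℝ}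
    (hα : 0 < α) (hβ : 0 < β) (f g : Lp ℂ 2 (volume : Measure ℝ)) :
    ∫⁻ x, farPart Φ ρ d N α β f g x ≤
      2 * ((∫⁻ t, ‖ρ t‖ₑ) * ((∫⁻ x, tailKernel Φ N x) * ∫⁻ x, ‖Φ x‖ₑ)) *
        (ENNReal.ofReal α⁻¹ ^ (1 / 2 : ℝ) * ENNReal.ofReal β⁻¹ ^ (1 / 2 : ℝ)) *
        (‖f‖ₑ * ‖g‖ₑ) := by
  have hΦm : Measurable fun y => ‖Φ y‖ₑ := Φ.continuous.measurable.enorm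
  have hT := measurable_tailKernel Φ N
  obtain ⟨Tf, hTf⟩ : ∃ T, T = posConv (tailKernel Φ N) (fun y => ‖f y‖ₑ) := ⟨_, rfl⟩
  obtain ⟨Tg, hTg⟩ : ∃ T, T = posConv (tailKernel Φ N) (fun y => ‖g y‖ₑ) := ⟨_, rfl⟩
  obtain ⟨Af, hAf⟩ : ∃ T, T = posConv (fun y => ‖Φ y‖ₑ) (fun y => ‖f y‖ₑ) := ⟨_, rfl⟩
  obtain ⟨Ag, hAg⟩ : ∃ T, T = posConv (fun y => ‖Φ y‖ₑ) (fun y => ‖g y‖ₑ) := ⟨_, rfl⟩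
  have mTf : Measurable Tf := hTf ▸ measurable_posConv hT (measurable_enorm_Lp f)
  have mTg : Measurable Tg := hTg ▸ measurable_posConv hT (measurable_enorm_Lp g)
  have mAf : Measurable Af := hAf ▸ measurable_posConv hΦm (measurable_enorm_Lp f)
  have mAg : Measurable Ag := hAg ▸ measurable_posConv hΦm (measurable_enorm_Lp g)
  have root : ∀ {k : ℝ → ℝ≥0∞}, Measurable k → ∀ (h : Lp ℂ 2 (volume : Measure ℝ)) (a : ℝ),
      (ENNReal.ofReal a⁻¹ * ∫⁻ x, posConv k (fun y => ‖h y‖ₑ) x ^ 2) ^ (1 / 2 : ℝ) ≤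
      ENNReal.ofReal a⁻¹ ^ (1 / 2 : ℝ) * ((∫⁻ x, k x) * ‖h‖ₑ) := by
    intro k hk h a
    rw [ENNReal.mul_rpow_of_nonneg _ _ (by norm_num)]
    gcongr
    calc (∫⁻ x, posConv k (fun y => ‖h y‖ₑ) x ^ 2) ^ (1 / 2 : ℝ)
        ≤ ((∫⁻ x, k x) ^ 2 * ‖h‖ₑ ^ 2) ^ (1 / 2 : ℝ) := by
          refine ENNReal.rpow_le_rpow ?_ (by norm_num)
          rw [← energy_eq_enorm_sq]
          exact lintegral_posConv_sq_le hk (measurable_enorm_Lp h)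
      _ = _ := by rw [← mul_pow, ENNReal.sqrt_of_sq]
  obtain ⟨W, hW⟩ : ∃ W, W = ((∫⁻ x, tailKernel Φ N x) * ∫⁻ x, ‖Φ x‖ₑ) *
        (ENNReal.ofReal α⁻¹ ^ (1 / 2 : ℝ) * ENNReal.ofReal β⁻¹ ^ (1 / 2 : ℝ)) *
        (‖f‖ₑ * ‖g‖ₑ) := ⟨_, rfl⟩
  have b1 : ∀ a b : ℝ, ∫⁻ x, Tf (α * x - a) * Ag (β * x - b) ≤ W := fun a b => by
    refine (lintegral_mul_comp_affine_le mTf mAg hα hβ a b).trans ?_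
    rw [hTf, hAg]
    refine (mul_le_mul' (root hT f α) (root hΦm g β)).trans (le_of_eq ?_)
    rw [hW]
    ring
  have b2 : ∀ a b : ℝ, ∫⁻ x, Af (α * x - a) * Tg (β * x - b) ≤ W := fun a b => by
    refine (lintegral_mul_comp_affine_le mAf mTg hα hβ a b).trans ?_
    rw [hAf, hTg]
    refine (mul_le_mul' (root hΦm f α) (root hT g β)).trans (le_of_eq ?_)
    rw [hW]
    ring
  unfold farPart
  rw [← hTf, ← hTg, ← hAf, ← hAg, lintegral_lintegral_swap (by fun_prop)]
  calc _ ≤ ∫⁻ t, 2 * W * ‖ρ t‖ₑ := by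
        refine lintegral_mono fun t => ?_
        rw [lintegral_mul_const _ (by fun_prop), lintegral_add_left (by fun_prop), two_mul]
        gcongr
        · exact b1 _ _
        · exact b2 _ _
    _ = _ := by
        rw [lintegral_const_mul _ (by fun_prop), hW]
        ring

/-- Triangle inequality: moving x by N/2 and translating by s leaves a margin N, so outside the
window only the tail of Φ beyond N is seen. -/
theorem le_abs_sub_of_notMem_window {a s N D c y x : ℝ} (ha0 : 0 < a) (ha : a ≤ 1)
    (hx : |x - y| ≤ N / 2) (hs : |s| ≤ c) (hD : N / 2 + c + N ≤ D)
    (z : ℝ) (hz : z ∉ Set.Icc (a * y - D) (a * y + D)) : N ≤ |a * x - s - z| := by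
  have h1 : |a * (x - y)| ≤ N / 2 := by
    rw [abs_mul, abs_of_pos ha0]
    exact (mul_le_of_le_one_left (abs_nonneg _) ha).trans hx
  have h2 : D ≤ |a * y - z| := by
    by_contra hlt
    push Not at hlt
    rw [abs_lt] at hlt
    exact hz ⟨by linarith [hlt.2], by linarith [hlt.1]⟩
  have h3 : |a * y - z| ≤ |a * x - s - z| + |a * (x - y)| + |s| := by
    have e : a * y - z = (a * x - s - z) - a * (x - y) + s := by ring
    calc |a * y - z| = |(a * x - s - z) - a * (x - y) + s| := by rw [← e]
      _ ≤ |(a * x - s - z) - a * (x - y)| + |s| := abs_add_le _ _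
      _ ≤ _ := by gcongr; exact abs_sub _ _
  linarith

theorem enorm_curveOp_le_truncate_add (Φ : 𝓢(ℝ, ℂ)) {ρ : ℝ → ℝ} (hρ : Integrable ρ)
    (hρ2 : ∀ t, 2 < |t| → ρ t = 0) {d : ℕ} (hd : 1 ≤ d) {N α β : ℝ} (hN : 0 < N) (hα0 : 0 < α)
    (hα : α ≤ 1) (hβ0 : 0 < β) (hβ : β ≤ 1) (f g : Lp ℂ 2 (volume : Measure ℝ)) {x y : ℝ}
    (hxy : |x - y| ≤ N / 2) {D : ℝ} (hD : (2 ^ d + 2) * N ≤ D) :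
    ‖curveOp Φ ρ d N α β f g x‖ₑ ≤
      ‖curveOp Φ ρ d N α β
        (truncate f (measurableSet_Icc : MeasurableSet (Set.Icc (α * y - D) (α * y + D))))
        (truncate g (measurableSet_Icc : MeasurableSet (Set.Icc (β * y - D) (β * y + D)))) x‖ₑ +
      farPart Φ ρ d N α β f g x := by
  obtain ⟨f', hf'⟩ : ∃ f', f' =
    truncate f (measurableSet_Icc : MeasurableSet (Set.Icc (α * y - D) (α * y + D))) := ⟨_, rfl⟩
  obtain ⟨g', hg'⟩ : ∃ g', g' =
    truncate g (measurableSet_Icc : MeasurableSet (Set.Icc (β * y - D) (β * y + D))) := ⟨_, rfl⟩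
  rw [← hf', ← hg']
  have i1 := integrable_curveOp Φ hρ d N α β f g x
  have i2 := integrable_curveOp Φ hρ d N α β f' g' x
  have e : curveOp Φ ρ d N α β f g x = curveOp Φ ρ d N α β f' g' x +
      (curveOp Φ ρ d N α β f g x - curveOp Φ ρ d N α β f' g' x) := by ring
  rw [e]
  refine (enorm_add_le _ _).trans ?_
  gcongr
  unfold curveOp
  rw [← integral_sub i1 i2]
  refine (enorm_integral_le_lintegral_enorm _).trans (lintegral_mono fun t => ?_)
  by_cases ht : 2 < |t|
  · simp [hρ2 t ht]
  push Not at ht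
  have h2d : (2 : ℝ) ≤ 2 ^ d := by
    calc (2 : ℝ) = 2 ^ 1 := by norm_num
      _ ≤ 2 ^ d := pow_le_pow_right₀ (by norm_num) hd
  have hs1 : |N * t| ≤ 2 ^ d * N := by
    rw [abs_mul, abs_of_pos hN]
    nlinarith
  have hs2 : |N * t ^ d| ≤ 2 ^ d * N := by
    rw [abs_mul, abs_of_pos hN, abs_pow, mul_comm]
    gcongr
  have hD' : N / 2 + 2 ^ d * N + N ≤ D := by linarith
  have b1 := enorm_smoothRestriction_sub_truncate_le Φ f measurableSet_Icc
    (le_abs_sub_of_notMem_window hα0 hα hxy hs1 hD')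
  have b2 := enorm_smoothRestriction_sub_truncate_le Φ g measurableSet_Icc
    (le_abs_sub_of_notMem_window hβ0 hβ hxy hs2 hD')
  have b3 := enorm_smoothRestriction_le Φ g (β * x - N * t ^ d)
  have b4 := enorm_smoothRestriction_truncate_le Φ f
    (measurableSet_Icc : MeasurableSet (Set.Icc (α * y - D) (α * y + D))) (α * x - N * t)
  rw [← hf'] at b1 b4
  rw [← hg'] at b2
  -- The product is telescoped so that each term has exactly one difference, controlled by the tail
  -- kernel, and one factor controlled by the full convolution with |Φ|.
  calc _ = ‖((smoothRestriction Φ f (α * x - N * t) - smoothRestriction Φ f' (α * x - N * t)) *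
        smoothRestriction Φ g (β * x - N * t ^ d) + smoothRestriction Φ f' (α * x - N * t) *
        (smoothRestriction Φ g (β * x - N * t ^ d) -
          smoothRestriction Φ g' (β * x - N * t ^ d))) * (ρ t : ℂ)‖ₑ := by
        congr 1
        ring
    _ ≤ _ := by
        rw [enorm_mul, show ‖(ρ t : ℂ)‖ₑ = ‖ρ t‖ₑ from by
          rw [← ofReal_norm, ← ofReal_norm, Complex.norm_real]]
        refine mul_le_mul' ((enorm_add_le _ _).trans ?_) le_rfl
        rw [enorm_mul, enorm_mul]
        exact add_le_add (mul_le_mul' b1 b3) (mul_le_mul' b4 b2)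

theorem measurable_lintegral_window {h : ℝ → ℝ≥0∞} (hh : Measurable h) (a r : ℝ) :
    Measurable fun y => ∫⁻ v in Set.Icc (a * y - r) (a * y + r), h v := by
  have hms : MeasurableSet {z : ℝ × ℝ | a * z.1 - r ≤ z.2 ∧ z.2 ≤ a * z.1 + r} :=
    (measurableSet_le (f := fun z : ℝ × ℝ => a * z.1 - r) (g := Prod.snd) (by fun_prop)
      (by fun_prop)).inter (measurableSet_le (f := Prod.snd) (g := fun z : ℝ × ℝ => a * z.1 + r)
      (by fun_prop) (by fun_prop))
  have e1 : ∀ y, ∫⁻ v in Set.Icc (a * y - r) (a * y + r), h v =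
      ∫⁻ v, ({z : ℝ × ℝ | a * z.1 - r ≤ z.2 ∧ z.2 ≤ a * z.1 + r}).indicator
        (fun z => h z.2) (y, v) := by
    intro y
    rw [← lintegral_indicator measurableSet_Icc]
    rfl
  simp only [e1]
  exact Measurable.lintegral_prod_right' (((by fun_prop : Measurable fun z : ℝ × ℝ =>
    h z.2)).indicator hms)

/-- The `L² × L² → L²` bound gives an `L² × L² → L¹` bound, up to an error from the tails of the
kernel. -/
theorem lintegral_curveOp_le (Φ : 𝓢(ℝ, ℂ)) {ρ : ℝ → ℝ} (hρm : Measurable ρ) (hρ : Integrable ρ)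
    (hρ2 : ∀ t, 2 < |t| → ρ t = 0) {d : ℕ} (hd : 1 ≤ d) {N α β : ℝ} (hN : 0 < N) (hα0 : 0 < α)
    (hα : α ≤ 1) (hβ0 : 0 < β) (hβ : β ≤ 1) {K : ℝ≥0∞}
    (hK : ∀ f g : Lp ℂ 2 (volume : Measure ℝ),
      energy (curveOp Φ ρ d N α β f g) ≤ K * (‖f‖ₑ ^ 2 * ‖g‖ₑ ^ 2))
    (f g : Lp ℂ 2 (volume : Measure ℝ)) :
    ∫⁻ x, ‖curveOp Φ ρ d N α β f g x‖ₑ ≤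
      (ENNReal.ofReal (2 * (2 ^ d + 2)) * (ENNReal.ofReal N * K) ^ (1 / 2 : ℝ) +
        2 * ((∫⁻ t, ‖ρ t‖ₑ) * ((∫⁻ x, tailKernel Φ N x) * ∫⁻ x, ‖Φ x‖ₑ))) *
      (ENNReal.ofReal α⁻¹ ^ (1 / 2 : ℝ) * ENNReal.ofReal β⁻¹ ^ (1 / 2 : ℝ)) * (‖f‖ₑ * ‖g‖ₑ) := by
  -- For |t| ≤ 2 the translations Nt and Nt^d are at most 2^d N. To this are added N/2 for the
  -- position of x and N for the tail, and D exceeds the sum.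
  obtain ⟨D, hD⟩ : ∃ D : ℝ, D = (2 ^ d + 2) * N := ⟨_, rfl⟩
  have hD0 : 0 < D := by rw [hD]; positivity
  have hTm := measurable_curveOp Φ hρm d N α β f g
  obtain ⟨W, hW⟩ : ∃ W : Lp ℂ 2 (volume : Measure ℝ) → ℝ → ℝ → ℝ≥0∞, ∀ h a y, W h a y =
    ∫⁻ v in Set.Icc (a * y - D) (a * y + D), ‖h v‖ₑ ^ 2 := ⟨_, fun _ _ _ => rfl⟩
  have hWm : ∀ h a, Measurable (W h a) := fun h a => by
    have : W h a = fun y => ∫⁻ v in Set.Icc (a * y - D) (a * y + D), ‖h v‖ₑ ^ 2 :=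
      funext fun y => hW h a y
    rw [this]
    exact measurable_lintegral_window ((measurable_enorm_Lp h).pow_const 2) a D
  have hWi : ∀ h : Lp ℂ 2 (volume : Measure ℝ), ∀ a, 0 < a →
      ∫⁻ y, W h a y = ENNReal.ofReal (2 * D) * (ENNReal.ofReal a⁻¹ * ‖h‖ₑ ^ 2) := by
    intro h a ha
    simp only [hW]
    rw [lintegral_lintegral_window ((measurable_enorm_Lp h).pow_const 2) ha D, div_eq_mul_inv,
      ENNReal.ofReal_mul (by positivity), ← energy_eq_enorm_sq, mul_assoc]
    rfl
  obtain ⟨S, hS⟩ : ∃ S, S = (ENNReal.ofReal N * K) ^ (1 / 2 : ℝ) := ⟨_, rfl⟩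
  -- On an interval of length N, Cauchy–Schwarz turns the L² bound for the truncated functions into
  -- an L¹ bound. The factors `1 * y` match the form of `lintegral_lintegral_window` with a = 1.
  have near : ∀ y, ∫⁻ x in Set.Icc (1 * y - N / 2) (1 * y + N / 2),
      ‖curveOp Φ ρ d N α β f g x‖ₑ ≤ S * (W f α y ^ (1 / 2 : ℝ) * W g β y ^ (1 / 2 : ℝ)) +
      ∫⁻ x in Set.Icc (1 * y - N / 2) (1 * y + N / 2), farPart Φ ρ d N α β f g x := by
    intro y
    obtain ⟨f', hf'⟩ : ∃ f', f' =
      truncate f (measurableSet_Icc : MeasurableSet (Set.Icc (α * y - D) (α * y + D))) := ⟨_, rfl⟩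
    obtain ⟨g', hg'⟩ : ∃ g', g' =
      truncate g (measurableSet_Icc : MeasurableSet (Set.Icc (β * y - D) (β * y + D))) := ⟨_, rfl⟩
    have hm' := measurable_curveOp Φ hρm d N α β f' g'
    have h1 : ∫⁻ x in Set.Icc (1 * y - N / 2) (1 * y + N / 2),
        ‖curveOp Φ ρ d N α β f g x‖ₑ ≤ ∫⁻ x in Set.Icc (1 * y - N / 2) (1 * y + N / 2),
        (‖curveOp Φ ρ d N α β f' g' x‖ₑ + farPart Φ ρ d N α β f g x) := by
      refine setLIntegral_mono' measurableSet_Icc fun x hx => ?_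
      rw [hf', hg']
      refine enorm_curveOp_le_truncate_add Φ hρ hρ2 hd hN hα0 hα hβ0 hβ f g ?_ hD.ge
      rw [one_mul] at hx
      exact abs_le.2 ⟨by linarith [hx.1], by linarith [hx.2]⟩
    refine h1.trans ?_
    rw [lintegral_add_left hm'.enorm]
    gcongr
    rw [← ENNReal.sqrt_of_sq (∫⁻ x in Set.Icc (1 * y - N / 2) (1 * y + N / 2),
      ‖curveOp Φ ρ d N α β f' g' x‖ₑ), hS, ← ENNReal.mul_rpow_of_nonneg _ _ (by norm_num),
      ← ENNReal.mul_rpow_of_nonneg _ _ (by norm_num)]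
    refine ENNReal.rpow_le_rpow ?_ (by norm_num)
    refine (sq_setLIntegral_le hm'.enorm.aemeasurable).trans ?_
    rw [Real.volume_Icc, show 1 * y + N / 2 - (1 * y - N / 2) = N by ring, mul_assoc]
    refine mul_le_mul' le_rfl ((hK f' g').trans (le_of_eq ?_))
    rw [hf', hg', enorm_truncate_sq, enorm_truncate_sq, hW, hW]
  have hfar : Measurable (farPart Φ ρ d N α β f g) := by
    have hΦm : Measurable fun y => ‖Φ y‖ₑ := Φ.continuous.measurable.enorm
    have hT := measurable_tailKernel Φ N
    have m1 := measurable_posConv hT (measurable_enorm_Lp f)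
    have m2 := measurable_posConv hT (measurable_enorm_Lp g)
    have m3 := measurable_posConv hΦm (measurable_enorm_Lp f)
    have m4 := measurable_posConv hΦm (measurable_enorm_Lp g)
    exact Measurable.lintegral_prod_right' (f := fun z : ℝ × ℝ =>
      (posConv (tailKernel Φ N) (fun y => ‖f y‖ₑ) (α * z.1 - N * z.2) *
        posConv (fun y => ‖Φ y‖ₑ) (fun y => ‖g y‖ₑ) (β * z.1 - N * z.2 ^ d) +
      posConv (fun y => ‖Φ y‖ₑ) (fun y => ‖f y‖ₑ) (α * z.1 - N * z.2) *
        posConv (tailKernel Φ N) (fun y => ‖g y‖ₑ) (β * z.1 - N * z.2 ^ d)) * ‖ρ z.2‖ₑ)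
      (by fun_prop)
  have hNN : ENNReal.ofReal N ≠ 0 := by simpa using hN
  -- Integrating over the centre y counts each x with weight N. On the right, Cauchy–Schwarz in y
  -- and the window identity give 2D α^(-1/2) β^(-1/2), and D/N is a constant.
  have avg : ENNReal.ofReal N * ∫⁻ x, ‖curveOp Φ ρ d N α β f g x‖ₑ ≤
      S * (ENNReal.ofReal (2 * D) * (ENNReal.ofReal α⁻¹ ^ (1 / 2 : ℝ) *
        ENNReal.ofReal β⁻¹ ^ (1 / 2 : ℝ) * (‖f‖ₑ * ‖g‖ₑ))) +
      ENNReal.ofReal N * ∫⁻ x, farPart Φ ρ d N α β f g x := by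
    have e := lintegral_lintegral_window hTm.enorm one_pos (N / 2)
    have e' := lintegral_lintegral_window hfar one_pos (N / 2)
    rw [show 2 * (N / 2) / 1 = N by ring] at e e'
    rw [← e, ← e']
    refine (lintegral_mono near).trans ?_
    have hWr : ∀ h a, Measurable fun y => W h a y ^ (1 / 2 : ℝ) := fun h a =>
      (hWm h a).pow_const _
    have hWW : Measurable fun y => W f α y ^ (1 / 2 : ℝ) * W g β y ^ (1 / 2 : ℝ) :=
      (hWr f α).mul (hWr g β)
    rw [lintegral_add_left (hWW.const_mul S), lintegral_const_mul _ hWW]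
    gcongr
    refine (lintegral_mul_le_sqrt_mul_sqrt (hWr f α).aemeasurable
      (hWr g β).aemeasurable).trans (le_of_eq ?_)
    simp only [ENNReal.sqrt_sq]
    rw [hWi f α hα0, hWi g β hβ0, ENNReal.mul_rpow_of_nonneg _ _ (by norm_num),
      ENNReal.mul_rpow_of_nonneg _ _ (by norm_num), ENNReal.mul_rpow_of_nonneg _ _ (by norm_num),
      ENNReal.mul_rpow_of_nonneg _ _ (by norm_num), ENNReal.sqrt_of_sq, ENNReal.sqrt_of_sq]
    calc _ = (ENNReal.ofReal (2 * D) ^ (1 / 2 : ℝ)) ^ 2 * (ENNReal.ofReal α⁻¹ ^ (1 / 2 : ℝ) *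
        ENNReal.ofReal β⁻¹ ^ (1 / 2 : ℝ) * (‖f‖ₑ * ‖g‖ₑ)) := by ring
      _ = _ := by rw [ENNReal.sqrt_sq]
  rw [← ENNReal.mul_le_mul_iff_right hNN ENNReal.ofReal_ne_top]
  refine avg.trans ?_
  refine (add_le_add le_rfl (mul_le_mul' le_rfl
    (lintegral_farPart_le Φ hρm d hα0 hβ0 f g))).trans (le_of_eq ?_)
  rw [← hS, hD, show 2 * ((2 ^ d + 2) * N) = N * (2 * (2 ^ d + 2)) by ring,
    ENNReal.ofReal_mul hN.le]
  ring

theorem exists_lintegral_curveOp_oddBump_le {ρ₁ : ℝ → ℝ} (hρ : ContDiff ℝ ∞ ρ₁)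
    (hs : Function.support ρ₁ ⊆ Set.Icc (1 / 2) 2) {n : ℕ} (hn : 1 ≤ n) {Θ Φ : 𝓢(ℝ, ℂ)}
    (hΘsupp : Function.support Θ ⊆ Set.Ioo (-1) 1) (hΘone : ∀ ξ : ℝ, |ξ| ≤ 1 / 2 → Θ ξ = 1)
    (hΦ : ∀ ξ : ℝ, (𝓕 Φ : 𝓢(ℝ, ℂ)) ξ = Θ (ξ / 2) - Θ ξ) :
    ∃ C : ℝ, 0 ≤ C ∧ ∀ {N ε : ℝ}, 1 ≤ N → 0 < ε → 12 * (n + 1) * ε ≤ 1 → 1 ≤ ε * N →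
      ∀ {α β : ℝ}, (α = ε ∧ β = 1 ∨ α = 1 ∧ β = ε) → ∀ f g : Lp ℂ 2 (volume : Measure ℝ),
      ∫⁻ x, ‖curveOp Φ (oddBump ρ₁) (n + 1) N α β f g x‖ₑ ≤
        ENNReal.ofReal (C * (1 / (ε * N)) ^ (1 / 8 : ℝ) * ε⁻¹ ^ (1 / 2 : ℝ)) *
          (‖f‖ₑ * ‖g‖ₑ) := by
  obtain ⟨C, hC, hE⟩ := exists_energy_curve_le hρ hs hn hΘsupp hΘone hΦ
  obtain ⟨c, hc, htail⟩ := exists_lintegral_tailKernel_le Φ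
  have hρi := integrable_oddBump hρ.continuous hs
  have hρm := measurable_oddBump hρ.continuous hs
  obtain ⟨r, hr0, hr⟩ : ∃ r : ℝ, 0 ≤ r ∧ ∫⁻ t, ‖oddBump ρ₁ t‖ₑ = ENNReal.ofReal r :=
    ⟨_, ENNReal.toReal_nonneg, (ENNReal.ofReal_toReal hρi.2.ne).symm⟩
  obtain ⟨k, hk0, hk⟩ : ∃ k : ℝ, 0 ≤ k ∧ ∫⁻ t, ‖Φ t‖ₑ = ENNReal.ofReal k :=
    ⟨_, ENNReal.toReal_nonneg, (ENNReal.ofReal_toReal (lintegral_enorm_schwartz_lt_top Φ).ne).symm⟩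
  refine ⟨2 * (2 ^ (n + 1) + 2) * C ^ (1 / 2 : ℝ) + 2 * (r * (c * k)), by positivity, ?_⟩
  intro N ε hN hε hεn hεN α β hαβ f g
  have hN0 : 0 < N := by linarith
  have hn' : (1 : ℝ) ≤ n := by exact_mod_cast hn
  have hε1 : ε ≤ 1 := by nlinarith
  obtain ⟨x, hx⟩ : ∃ x : ℝ, x = 1 / (ε * N) := ⟨_, rfl⟩
  have hx0 : 0 < x := by rw [hx]; positivity
  have hx1 : x ≤ 1 := by rw [hx, div_le_one (by positivity)]; exact hεN
  obtain ⟨K, hK⟩ : ∃ K, K = ENNReal.ofReal (C / N * x ^ (1 / 4 : ℝ)) := ⟨_, rfl⟩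
  have hbound : ∀ f g : Lp ℂ 2 (volume : Measure ℝ),
      energy (curveOp Φ (oddBump ρ₁) (n + 1) N α β f g) ≤ K * (‖f‖ₑ ^ 2 * ‖g‖ₑ ^ 2) := by
    intro f g
    rw [hK, hx]
    rcases hαβ with ⟨rfl, rfl⟩ | ⟨rfl, rfl⟩
    · have := (hE hN hε hεn hεN f g).1
      unfold curveOp
      simpa only [one_mul] using this
    · have := (hE hN hε hεn hεN f g).2
      unfold curveOp
      simpa only [one_mul] using this
  -- The length N of the interval cancels the 1/N of the squared L² bound, and the square root
  -- halves the exponent 1/4.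
  have hroot : (ENNReal.ofReal N * K) ^ (1 / 2 : ℝ) =
      ENNReal.ofReal (C ^ (1 / 2 : ℝ) * x ^ (1 / 8 : ℝ)) := by
    rw [hK, ← ENNReal.ofReal_mul hN0.le, ENNReal.ofReal_rpow_of_nonneg (by positivity) (by norm_num)]
    congr 1
    rw [show N * (C / N * x ^ (1 / 4 : ℝ)) = C * x ^ (1 / 4 : ℝ) by field_simp,
      Real.mul_rpow hC (by positivity), ← Real.rpow_mul hx0.le]
    norm_num
  have htl : ∫⁻ x, tailKernel Φ N x ≤ ENNReal.ofReal (c * x ^ (1 / 8 : ℝ)) := by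
    refine (htail N hN0).trans (ENNReal.ofReal_le_ofReal ?_)
    rw [div_eq_mul_one_div]
    gcongr
    calc 1 / N ≤ x := by
          rw [hx]
          apply one_div_le_one_div_of_le (by positivity)
          exact mul_le_of_le_one_left hN0.le hε1
      _ = x ^ (1 : ℝ) := (Real.rpow_one _).symm
      _ ≤ _ := Real.rpow_le_rpow_of_exponent_ge hx0 hx1 (by norm_num)
  have hab : ENNReal.ofReal α⁻¹ ^ (1 / 2 : ℝ) * ENNReal.ofReal β⁻¹ ^ (1 / 2 : ℝ) =
      ENNReal.ofReal (ε⁻¹ ^ (1 / 2 : ℝ)) := by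
    rw [← ENNReal.ofReal_rpow_of_nonneg (by positivity) (by norm_num)]
    rcases hαβ with ⟨rfl, rfl⟩ | ⟨rfl, rfl⟩ <;> simp
  have hα0 : 0 < α := by rcases hαβ with ⟨rfl, rfl⟩ | ⟨rfl, rfl⟩ <;> linarith
  have hβ0 : 0 < β := by rcases hαβ with ⟨rfl, rfl⟩ | ⟨rfl, rfl⟩ <;> linarith
  have hα1 : α ≤ 1 := by rcases hαβ with ⟨rfl, rfl⟩ | ⟨rfl, rfl⟩ <;> linarith
  have hβ1 : β ≤ 1 := by rcases hαβ with ⟨rfl, rfl⟩ | ⟨rfl, rfl⟩ <;> linarith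
  refine (lintegral_curveOp_le Φ hρm hρi (fun t ht => oddBump_eq_zero hs ht) (by lia) hN0 hα0 hα1
    hβ0 hβ1 hbound f g).trans ?_
  rw [hab, hroot, hr, hk, ← hx]
  gcongr
  calc _ ≤ (ENNReal.ofReal (2 * (2 ^ (n + 1) + 2)) *
        ENNReal.ofReal (C ^ (1 / 2 : ℝ) * x ^ (1 / 8 : ℝ)) +
        2 * (ENNReal.ofReal r * (ENNReal.ofReal (c * x ^ (1 / 8 : ℝ)) * ENNReal.ofReal k))) *
        ENNReal.ofReal (ε⁻¹ ^ (1 / 2 : ℝ)) := by gcongr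
    _ = _ := by
        rw [show (2 : ℝ≥0∞) = ENNReal.ofReal 2 by simp, ← ENNReal.ofReal_mul (by positivity),
          ← ENNReal.ofReal_mul (by positivity), ← ENNReal.ofReal_mul (by positivity),
          ← ENNReal.ofReal_mul (by positivity), ← ENNReal.ofReal_add (by positivity)
          (by positivity), ← ENNReal.ofReal_mul (by positivity)]
        congr 1
        ring

/-! ### Choice of parameters and conclusion. -/

theorem twelve_mul_le_two_rpow {n : ℕ} (hn : 1 ≤ n) {a : ℝ} (ha : 5 ≤ a) :
    12 * ((n : ℝ) + 1) ≤ (2 : ℝ) ^ ((n : ℝ) * a) := by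
  have hn' : (1 : ℝ) ≤ n := by exact_mod_cast hn
  calc 12 * ((n : ℝ) + 1) ≤ 1 + n * 31 := by linarith
    _ ≤ (1 + 31) ^ n := one_add_mul_le_pow (by norm_num) n
    _ = (2 : ℝ) ^ ((n : ℝ) * 5) := by
        rw [mul_comm, Real.rpow_mul (by norm_num), Real.rpow_natCast]
        norm_num
    _ ≤ _ := Real.rpow_le_rpow_of_exponent_le (by norm_num) (by gcongr)

theorem mainTheorem4 (d : ℕ) (hd : 2 ≤ d)
    (ρ₁ : ℝ → ℝ) (hρ₁ : ContDiff ℝ ∞ ρ₁) (hρ₁supp : Function.support ρ₁ ⊆ Set.Icc (1 / 2) 2)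
    (Θ : 𝓢(ℝ, ℂ)) (hΘsupp : Function.support Θ ⊆ Set.Ioo (-1) 1)
    (hΘone : ∀ ξ : ℝ, |ξ| ≤ 1 / 2 → Θ ξ = 1)
    (Φ : 𝓢(ℝ, ℂ)) (hΦ : ∀ ξ : ℝ, (𝓕 Φ : 𝓢(ℝ, ℂ)) ξ = Θ (ξ / 2) - Θ ξ)
    (L : ℝ) (hL : 2 ^ 100 < L) :
    ∃ C : ℝ, ∀ (j : ℤ) (m : ℕ), L ≤ |(j : ℝ)| → |(j : ℝ)| ≤ (m : ℝ) / ((d : ℝ) - 1) →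
      ∀ f g : Lp ℂ 2 (volume : Measure ℝ),
        MemLp (bilinearRestriction d (oddBump ρ₁) Φ j m f g) 1 volume ∧
        eLpNorm (bilinearRestriction d (oddBump ρ₁) Φ j m f g) 1 volume ≤
          ENNReal.ofReal
            (C * (2 : ℝ) ^ ((((d : ℝ) - 1) * |(j : ℝ)| - (m : ℝ)) / 8) * ‖f‖ * ‖g‖) := by
  obtain ⟨n, rfl⟩ : ∃ n, d = n + 1 := ⟨d - 1, by lia⟩
  have hn : 1 ≤ n := by lia
  have hn0 : (0 : ℝ) < n := by exact_mod_cast hn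
  obtain ⟨C, hC, hbd⟩ := exists_lintegral_curveOp_oddBump_le hρ₁ hρ₁supp hn hΘsupp hΘone hΦ
  refine ⟨C, fun j m hLj hjm f g => ?_⟩
  have hd1 : ((n + 1 : ℕ) : ℝ) - 1 = n := by push_cast; ring
  rw [hd1] at hjm ⊢
  obtain ⟨a, ha⟩ : ∃ a : ℝ, a = n * |(j : ℝ)| := ⟨_, rfl⟩
  obtain ⟨ε, hεa⟩ : ∃ ε : ℝ, ε = (2 : ℝ) ^ (-a) := ⟨_, rfl⟩
  have hε : 0 < ε := by rw [hεa]; positivity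
  -- The lower bound on |j| makes ε small enough for the mixed derivative to be nondegenerate; |j| ≥
  -- 5 suffices because 12(n + 1) ≤ 32^n.
  have hε2 : 12 * ((n : ℝ) + 1) * ε ≤ 1 := by
    have h5 : (5 : ℝ) ≤ |(j : ℝ)| := by
      refine le_trans ?_ (hL.le.trans hLj)
      norm_num
    have := twelve_mul_le_two_rpow hn h5
    rw [hεa, Real.rpow_neg (by norm_num), ha, ← div_eq_mul_inv, div_le_one (by positivity)]
    exact this
  have ham : a ≤ m := by
    rw [ha, mul_comm]
    exact (le_div_iff₀ hn0).1 hjm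
  have hN1 : (1 : ℝ) ≤ 2 ^ m := one_le_pow₀ (by norm_num)
  have hεN : ε * 2 ^ m = (2 : ℝ) ^ ((m : ℝ) - a) := by
    rw [hεa, ← Real.rpow_natCast, ← Real.rpow_add (by norm_num)]
    congr 1
    ring
  have hεN1 : 1 ≤ ε * 2 ^ m := by
    rw [hεN]
    exact Real.one_le_rpow (by norm_num) (by linarith)
  have hgain : (1 / (ε * 2 ^ m)) ^ (1 / 8 : ℝ) = (2 : ℝ) ^ ((a - m) / 8) := by
    rw [hεN, one_div, ← Real.rpow_neg (by norm_num), ← Real.rpow_mul (by norm_num)]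
    congr 1
    ring
  -- The normalizing factor in the definition of the operator compensates exactly for the loss
  -- ε^(-1/2) of the averaging.
  have hpre : (2 : ℝ) ^ (-(a / 2)) * ε⁻¹ ^ (1 / 2 : ℝ) = 1 := by
    rw [hεa, ← Real.rpow_neg (by norm_num), ← Real.rpow_mul (by norm_num),
      ← Real.rpow_add (by norm_num)]
    norm_num
    ring_nf
    exact Real.rpow_zero 2
  obtain ⟨α, β, hαβ, hform⟩ : ∃ α β : ℝ, (α = ε ∧ β = 1 ∨ α = 1 ∧ β = ε) ∧
      bilinearRestriction (n + 1) (oddBump ρ₁) Φ j m f g = fun x =>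
        (((2 : ℝ) ^ (-(a / 2)) : ℝ) : ℂ) *
          curveOp Φ (oddBump ρ₁) (n + 1) (2 ^ m) α β f g x := by
    by_cases hj : 0 ≤ j
    · refine ⟨ε, 1, Or.inl ⟨rfl, rfl⟩, ?_⟩
      have hja : |(j : ℝ)| = j := abs_of_nonneg (by exact_mod_cast hj)
      funext x
      rw [bilinearRestriction, if_pos hj, curveOp, hd1, hεa, ha, hja]
      simp only [one_mul]
    · refine ⟨1, ε, Or.inr ⟨rfl, rfl⟩, ?_⟩
      have hja : |(j : ℝ)| = -j := abs_of_neg (by exact_mod_cast not_le.1 hj)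
      funext x
      rw [bilinearRestriction, if_neg hj, curveOp, hd1, hεa, ha, hja]
      simp only [one_mul, mul_neg, neg_neg, neg_div]
  have hmeas : Measurable (bilinearRestriction (n + 1) (oddBump ρ₁) Φ j m f g) := by
    rw [hform]
    exact (measurable_curveOp Φ (measurable_oddBump hρ₁.continuous hρ₁supp) (n + 1) (2 ^ m) α β
      f g).const_mul _
  have hle : eLpNorm (bilinearRestriction (n + 1) (oddBump ρ₁) Φ j m f g) 1 volume ≤
      ENNReal.ofReal (C * (2 : ℝ) ^ ((n * |(j : ℝ)| - m) / 8) * ‖f‖ * ‖g‖) := by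
    rw [eLpNorm_one_eq_lintegral_enorm, hform]
    simp only [enorm_mul]
    rw [lintegral_const_mul' _ _ (by simp)]
    refine (mul_le_mul' le_rfl (hbd hN1 hε hε2 hεN1 hαβ f g)).trans (le_of_eq ?_)
    rw [← ofReal_norm, ← ofReal_norm f, ← ofReal_norm g, Complex.norm_real, Real.norm_eq_abs,
      abs_of_pos (by positivity), ← ENNReal.ofReal_mul (norm_nonneg _),
      ← ENNReal.ofReal_mul (by positivity), ← ENNReal.ofReal_mul (by positivity), hgain, ← ha]
    congr 1
    linear_combination (C * (2 : ℝ) ^ ((a - m) / 8) * ‖f‖ * ‖g‖) * hpre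
  exact ⟨⟨hmeas.aestronglyMeasurable, hle.trans_lt ENNReal.ofReal_lt_top⟩, hle⟩
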